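/- Let $n\ge 1$ be an integer and let $m,s$ be real numbers with $0\le s<m<\frac n2$ and $s<2m-\frac n2$. Let $\Omega\subset\mathbb R^n$ be a bounded smooth domain, and put $2_m^*=\frac{2n}{n-2m}$. With $\mathcal F[u](\xi)=(2\pi)^{-n/2}\int_{\mathbb R^n}e^{-i\xi\cdot x}u(x)\,dx$, let $\|u\|_a^2=\int_{\mathbb R^n}|\xi|^{2a}|\mathcal F[u](\xi)|^2\,d\xi$ for $a\ge 0$. Let $\mathcal D^m(\mathbb R^n)$ be the completion of $C_0^\infty(\mathbb R^n)$ (real-valued functions) with respect to $\|\cdot\|_m$, which is a space of functions by the Sobolev embedding into $L^{2_m^*}(\mathbb R^n)$, and let $\widetilde H^m(\Omega)=\{u\in\mathcal D^m(\mathbb R^n):\operatorname{supp}u\subset\overline\Omega\}$. Put $$\Lambda_1(m,s)=\inf_{0\ne u\in\widetilde H^m(\Omega)}\frac{\|u\|_m^2}{\|u\|_s^2},\qquad \widetilde\Lambda_1(m,s)=\inf_{0\ne u\in\widetilde H^m(\Omega)}\frac{\|u\|_m^2}{\int_{\mathbb R^n}|x|^{-2s}|u|^2\,dx},$$ $$\mathcal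 S_\lambda^\Omega(m,s)=\inf_{0\ne u\in\widetilde H^m(\Omega)}\frac{\|u\|_m^2-\lambda\|u\|_s^2}{\big(\int_{\mathbb R^n}|u|^{2_m^*}dx\big)^{2/2_m^*}},\qquad \widetilde{\mathcal S}_\lambda^\Omega(m,s)=\inf_{0\ne u\in\widetilde H^m(\Omega)}\frac{\|u\|_m^2-\lambda\int_{\mathbb R^n}|x|^{-2s}|u|^2\,dx}{\big(\int_{\mathbb R^n}|u|^{2_m^*}dx\big)^{2/2_m^*}}.$$ i) There exists $\lambda^*\in[0,\Lambda_1(m,s))$ such that for every $\lambda\in(\lambda^*,\Lambda_1(m,s))$ the infimum $\mathcal S_\lambda^\Omega(m,s)$ is attained, and the Dirichlet problem for $$(-\Delta)^mu=\lambda(-\Delta)^su+|u|^{2_m^*-2}u\quad\text{in }\Omega$$ has a nontrivial weak solution, that is, there is $0\ne u\in\widetilde H^m(\Omega)$ with $$\int_{\mathbb R^n}|\xi|^{2m}\mathcal F[u]\,\overline{\mathcal F[v]}\,d\xi=\lambda\int_{\mathbb R^n}|\xi|^{2s}\mathcal F[u]\,\overline{\mathcal F[v]}\,d\xi+\int_{\mathbb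 R^n}|u|^{2_m^*-2}uv\,dx\quad\text{for all }v\in\widetilde H^m(\Omega).$$ ii) If $0\in\Omega$, then there exists $\widetilde\lambda^*\in[0,\widetilde\Lambda_1(m,s))$ such that for every $\lambda\in(\widetilde\lambda^*,\widetilde\Lambda_1(m,s))$ the infimum $\widetilde{\mathcal S}_\lambda^\Omega(m,s)$ is attained, and the Dirichlet problem for $$(-\Delta)^mu=\lambda|x|^{-2s}u+|u|^{2_m^*-2}u\quad\text{in }\Omega$$ has a nontrivial weak solution, that is, there is $0\ne u\in\widetilde H^m(\Omega)$ with $$\int_{\mathbb R^n}|\xi|^{2m}\mathcal F[u]\,\overline{\mathcal F[v]}\,d\xi=\lambda\int_{\mathbb R^n}|x|^{-2s}uv\,dx+\int_{\mathbb R^n}|u|^{2_m^*-2}uv\,dx\quad\text{for all }v\in\widetilde H^m(\Omega).$$ -/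

import Mathlib

open MeasureTheory Filter Topology
open scoped FourierTransform ContDiff ENNReal

noncomputable section

namespace FracCritical

/-- The space `ℝⁿ` with its Euclidean norm. -/
abbrev E (n : ℕ) : Type := EuclideanSpace ℝ (Fin n)

/-- The unitary Fourier transform `F[u](ξ) = (2π)^(-n/2) ∫ exp(-i ξ·x) u(x) dx` of a real function;
Mathlib's `𝓕` has the kernel `exp(-2πi ξ·x)`, hence the rescaling. -/
def fourierU {n : ℕ} (u : E n → ℝ) (ξ : E n) : ℂ :=
  (((2 * Real.pi) ^ (-((n : ℝ) / 2)) : ℝ) : ℂ) * 𝓕 (fun x : E n => (u x : ℂ)) ((2 * Real.pi)⁻¹ • ξ)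

theorem fourierU_eq {n : ℕ} (u : E n → ℝ) (ξ : E n) :
    fourierU u ξ = (((2 * Real.pi) ^ (-((n : ℝ) / 2)) : ℝ) : ℂ) *
      ∫ x : E n, Complex.exp (-Complex.I * ((inner ℝ ξ x : ℝ) : ℂ)) * (u x : ℂ) := by
  unfold fourierU
  rw [Real.fourier_eq']
  congr 1
  refine integral_congr_ae (Eventually.of_forall fun x => ?_)
  have h : -2 * Real.pi * inner ℝ x ((2 * Real.pi)⁻¹ • ξ) = -(inner ℝ ξ x) := by
    rw [inner_smul_right, real_inner_comm]
    field_simp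
  simp only [h, smul_eq_mul]
  congr 2
  push_cast
  ring

/-- The energy form `∫ |ξ|^(2a) F[u] conj(F[v]) dξ`, that is, the integral over `ℝⁿ` of
`(-Δ)^(a/2) u · (-Δ)^(a/2) v`. It is real for real functions, which is why only
the real part of the integrand is kept. -/
def energyForm {n : ℕ} (a : ℝ) (u v : E n → ℝ) : ℝ :=
  ∫ ξ : E n, ‖ξ‖ ^ (2 * a) * (fourierU u ξ * (starRingEnd ℂ) (fourierU v ξ)).re

/-- The squared norm `‖u‖_a² = ∫ |ξ|^(2a) |F[u](ξ)|² dξ`. -/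
def normSq {n : ℕ} (a : ℝ) (u : E n → ℝ) : ℝ :=
  ∫ ξ : E n, ‖ξ‖ ^ (2 * a) * ‖fourierU u ξ‖ ^ 2

/-- The critical Sobolev exponent `2n/(n-2m)`. -/
def critExp (n : ℕ) (m : ℝ) : ℝ := 2 * (n : ℝ) / ((n : ℝ) - 2 * m)

/-- Membership in the completion of `C_c^∞(ℝⁿ)` for the norm `‖·‖_m` (`0 < m < n/2`), realised as a
space of functions through its Sobolev embedding in `L^(2n/(n-2m))`: the function `u` is the limit
in `L^(2n/(n-2m))` of test functions that form a Cauchy sequence for `‖·‖_m`. -/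
def MemD {n : ℕ} (m : ℝ) (u : E n → ℝ) : Prop :=
  MemLp u (ENNReal.ofReal (critExp n m)) volume ∧
  ∃ φ : ℕ → E n → ℝ,
    (∀ k, ContDiff ℝ ∞ (φ k) ∧ HasCompactSupport (φ k)) ∧
    Tendsto (fun k => eLpNorm (φ k - u) (ENNReal.ofReal (critExp n m)) volume) atTop (𝓝 0) ∧
    Tendsto (fun p : ℕ × ℕ => normSq m (φ p.1 - φ p.2)) atTop (𝓝 0)

/-- The space of those `u` in the above completion whose (essential) support lies in the closure
of `Ω`. For bounded `Ω` these functions are integrable, so that `fourierU`, `normSq` and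
`energyForm` apply to them. Functions are not identified when equal almost everywhere. -/
def HTilde {n : ℕ} (Ω : Set (E n)) (m : ℝ) : Set (E n → ℝ) :=
  {u | MemD m u ∧ ∀ᵐ x ∂(volume : Measure (E n)), x ∉ closure Ω → u x = 0}

/-- The nonzero elements of `HTilde Ω m`. -/
def HTildeNZ {n : ℕ} (Ω : Set (E n)) (m : ℝ) : Set (E n → ℝ) :=
  {u | u ∈ HTilde Ω m ∧ ¬ (u =ᵐ[(volume : Measure (E n))] 0)}

/-- `∫ |x|^(-2s) u² dx`. -/
def hardySq {n : ℕ} (s : ℝ) (u : E n → ℝ) : ℝ :=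
  ∫ x : E n, ‖x‖ ^ (-(2 * s)) * u x ^ 2

/-- `(∫ |u|^p dx)^(2/p)` with `p = 2n/(n-2m)`. -/
def critSq {n : ℕ} (m : ℝ) (u : E n → ℝ) : ℝ :=
  (∫ x : E n, |u x| ^ critExp n m) ^ (2 / critExp n m)

/-- The infimum of `‖u‖_m² / ‖u‖_s²` over the nonzero elements of `HTilde Ω m`. -/
def Lambda1 {n : ℕ} (Ω : Set (E n)) (m s : ℝ) : ℝ :=
  sInf ((fun u => normSq m u / normSq s u) '' HTildeNZ Ω m)

/-- The infimum of `‖u‖_m² / ‖|x|^(-s) u‖_0²` over the nonzero elements of `HTilde Ω m`. -/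
def Lambda1Tilde {n : ℕ} (Ω : Set (E n)) (m s : ℝ) : ℝ :=
  sInf ((fun u => normSq m u / hardySq s u) '' HTildeNZ Ω m)

/-- The quotient `(‖u‖_m² - lam ‖u‖_s²) / ‖u‖²` with the critical Lebesgue norm below. -/
def quotR {n : ℕ} (m s lam : ℝ) (u : E n → ℝ) : ℝ :=
  (normSq m u - lam * normSq s u) / critSq m u

/-- The quotient `(‖u‖_m² - lam ‖|x|^(-s) u‖_0²) / ‖u‖²` with the critical Lebesgue norm below. -/
def quotRTilde {n : ℕ} (m s lam : ℝ) (u : E n → ℝ) : ℝ :=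
  (normSq m u - lam * hardySq s u) / critSq m u

/-- The infimum of `quotR` over the nonzero elements of `HTilde Ω m`. -/
def infS {n : ℕ} (Ω : Set (E n)) (m s lam : ℝ) : ℝ :=
  sInf (quotR m s lam '' HTildeNZ Ω m)

/-- The infimum of `quotRTilde` over the nonzero elements of `HTilde Ω m`. -/
def infSTilde {n : ℕ} (Ω : Set (E n)) (m s lam : ℝ) : ℝ :=
  sInf (quotRTilde m s lam '' HTildeNZ Ω m)

/-- `u` is a nontrivial weak solution, in `HTilde Ω m`, of
`(-Δ)^m u = lam (-Δ)^s u + |u|^(p-2) u` in `Ω`, with `p = 2n/(n-2m)`. -/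
def IsNontrivialSol {n : ℕ} (Ω : Set (E n)) (m s lam : ℝ) (u : E n → ℝ) : Prop :=
  u ∈ HTildeNZ Ω m ∧ ∀ v ∈ HTilde Ω m,
    energyForm m u v = lam * energyForm s u v +
      ∫ x : E n, |u x| ^ (critExp n m - 2) * u x * v x

/-- `u` is a nontrivial weak solution, in `HTilde Ω m`, of
`(-Δ)^m u = lam |x|^(-2s) u + |u|^(p-2) u` in `Ω`, with `p = 2n/(n-2m)`. -/
def IsNontrivialSolTilde {n : ℕ} (Ω : Set (E n)) (m s lam : ℝ) (u : E n → ℝ) : Prop :=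
  u ∈ HTildeNZ Ω m ∧ ∀ v ∈ HTilde Ω m,
    energyForm m u v = lam * (∫ x : E n, ‖x‖ ^ (-(2 * s)) * u x * v x) +
      ∫ x : E n, |u x| ^ (critExp n m - 2) * u x * v x

/-- A bounded smooth domain: a nonempty, bounded, connected open set which near each of its boundary
points is the sublevel set `{ρ < 0}` of a smooth function `ρ` with nonzero differential there. -/
structure IsBoundedSmoothDomain {n : ℕ} (Ω : Set (E n)) : Prop where
  isOpen : IsOpen Ω
  isConnected : IsConnected Ω
  isBounded : Bornology.IsBounded Ω
  smooth_boundary : ∀ x ∈ frontier Ω, ∃ U : Set (E n), IsOpen U ∧ x ∈ U ∧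
    ∃ ρ : E n → ℝ, ContDiff ℝ ∞ ρ ∧ fderiv ℝ ρ x ≠ 0 ∧ Ω ∩ U = {y | ρ y < 0} ∩ U

end FracCritical

end

/-! Both problems have the form `‖u‖_m² - λ b(u,u)`, where `b` is a nonnegative quadratic form that
is continuous along weakly convergent sequences: the energy of order `s < m`, or the Hardy integral
with the subcritical weight `|x|^(-2s)`. `CompactForm` records this common structure, and
`CompactForm.exists_threshold` treats both cases at once.

Compactness of `b` yields a first eigenfunction `φ` with eigenvalue `Λ > 0`. The quotient at `φ` is
`(Λ - λ) b(φ,φ)` divided by the critical norm squared, so it tends to `0` as `λ` increases to `Λ`.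
In particular the infimum `S` falls below any fixed constant `c` for which the Sobolev inequality `c
· critSq ≤ normSq` holds, and `c` need not be sharp. For `0 < λ < Λ` the numerator is coercive,
hence `S > 0`.

When `0 < S < c`, a minimizing sequence loses no critical mass. The energy of the difference from
the weak limit splits off (`EnergyConverges.tendsto_normSq_sub_sub`), one half of Brezis–Lieb
controls the critical integrals, and lost mass would cost at least `c` per unit of critical norm
squared. Since `c > S`, this is too expensive (`le_of_minimizing`). The minimizer satisfies an
Euler–Lagrange equation with a positive multiplier, which is scaled away because the nonlinearity is
not linear.

The analytic basis is proved on the Fourier side. The Sobolev inequality comes from splitting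
frequencies at a level-dependent radius; membership in the completion is identified with finite
energy (`mem_HTilde_iff`); and weak compactness follows from the equicontinuity of Fourier
transforms of functions supported in a fixed bounded set. -/

namespace FracCritical

/-! ### The Fourier transform on `L¹ ∩ L²` and Plancherel's identity -/

section L2Fourier

variable {V : Type*} [NormedAddCommGroup V] [InnerProductSpace ℝ V] [FiniteDimensional ℝ V]
  [MeasurableSpace V] [BorelSpace V]

theorem integral_fourier_mul_eq {f g : V → ℂ} (hf : Integrable f) (hg : Integrable g) :
    ∫ ξ, 𝓕 f ξ * g ξ = ∫ x, f x * 𝓕 g x := by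
  have h := VectorFourier.integral_fourierIntegral_smul_eq_flip (μ := (volume : Measure V))
    (ν := (volume : Measure V)) (L := innerₗ V) Real.continuous_fourierChar continuous_inner hf hg
  rw [flip_innerₗ] at h
  exact h

theorem continuous_fourier {f : V → ℂ} (hf : Integrable f) : Continuous (𝓕 f) :=
  VectorFourier.fourierIntegral_continuous Real.continuous_fourierChar continuous_inner hf

theorem norm_fourier_le {f : V → ℂ} (ξ : V) : ‖𝓕 f ξ‖ ≤ ∫ x, ‖f x‖ :=
  VectorFourier.norm_fourierIntegral_le_integral_norm _ _ _ _ _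

/-- The `L²` transform is characterised by its action on tempered distributions, the integral by the
symmetry of the Fourier kernel. The two functions therefore have the same pairing with every test
function. -/
theorem coeFn_fourier_toLp {f : V → ℂ} (hf1 : Integrable f) (hf2 : MemLp f 2) :
    ((𝓕 (hf2.toLp f) : Lp ℂ 2 (volume : Measure V)) : V → ℂ) =ᵐ[volume] 𝓕 f := by
  refine ae_eq_of_integral_contDiff_smul_eq
    ((Lp.memLp _).locallyIntegrable (by norm_num))
    (continuous_fourier hf1).locallyIntegrable fun g hg hgc => ?_
  have hg' : ContDiff ℝ ∞ (fun x => (g x : ℂ)) := Complex.ofRealCLM.contDiff.comp hg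
  have hgc' : HasCompactSupport (fun x => (g x : ℂ)) := hgc.comp_left Complex.ofReal_zero
  set ψ : SchwartzMap V ℂ := hgc'.toSchwartzMap hg' with hψ
  have hψx : ∀ x, ψ x = (g x : ℂ) := fun x => rfl
  have h := congrArg (fun T => T ψ) (Lp.fourier_toTemperedDistribution_eq (hf2.toLp f))
  simp only [TemperedDistribution.fourier_apply, Lp.toTemperedDistribution_apply] at h
  have h1 : ∫ x, (𝓕 ψ) x • (hf2.toLp f) x = ∫ x, f x * 𝓕 (ψ : V → ℂ) x := by
    refine integral_congr_ae ?_
    filter_upwards [hf2.coeFn_toLp] with x hx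
    rw [hx, smul_eq_mul, mul_comm]; rfl
  rw [h1, ← integral_fourier_mul_eq hf1 ψ.integrable] at h
  calc _ = ∫ x, ψ x • ((𝓕 (hf2.toLp f) : Lp ℂ 2 (volume : Measure V)) : V → ℂ) x := rfl
    _ = _ := h.symm
    _ = _ := by
      refine integral_congr_ae (Eventually.of_forall fun x => ?_)
      simp only [hψx, Complex.real_smul, mul_comm]

theorem memLp_fourier {f : V → ℂ} (hf1 : Integrable f) (hf2 : MemLp f 2) : MemLp (𝓕 f) 2 :=
  (memLp_congr_ae (coeFn_fourier_toLp hf1 hf2)).1 (Lp.memLp _)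

theorem eLpNorm_fourier {f : V → ℂ} (hf1 : Integrable f) (hf2 : MemLp f 2) :
    eLpNorm (𝓕 f) 2 volume = eLpNorm f 2 volume := by
  rw [← eLpNorm_congr_ae (coeFn_fourier_toLp hf1 hf2), ← eLpNorm_congr_ae hf2.coeFn_toLp]
  have h := Lp.norm_fourier_eq (hf2.toLp f)
  rw [Lp.norm_def, Lp.norm_def, ENNReal.toReal_eq_toReal_iff' (Lp.eLpNorm_ne_top _)
    (Lp.eLpNorm_ne_top _)] at h
  exact h

theorem integral_fourierInv_mul_eq {f g : V → ℂ} (hf : Integrable f) (hg : Integrable g) :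
    ∫ ξ, 𝓕⁻ f ξ * g ξ = ∫ x, f x * 𝓕⁻ g x := by
  rw [Real.fourierInv_eq_fourier_comp_neg, integral_fourier_mul_eq hf.comp_neg hg,
    ← integral_neg_eq_self]
  refine integral_congr_ae (Eventually.of_forall fun x => ?_)
  simp only [neg_neg, Real.fourierInv_eq_fourier_neg]

theorem coeFn_fourierInv_toLp {f : V → ℂ} (hf1 : Integrable f) (hf2 : MemLp f 2) :
    ((𝓕⁻ (hf2.toLp f) : Lp ℂ 2 (volume : Measure V)) : V → ℂ) =ᵐ[volume] 𝓕⁻ f := by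
  refine ae_eq_of_integral_contDiff_smul_eq
    ((Lp.memLp _).locallyIntegrable (by norm_num))
    (by rw [Real.fourierInv_eq_fourier_comp_neg]
        exact (continuous_fourier hf1.comp_neg).locallyIntegrable) fun g hg hgc => ?_
  have hg' : ContDiff ℝ ∞ (fun x => (g x : ℂ)) := Complex.ofRealCLM.contDiff.comp hg
  have hgc' : HasCompactSupport (fun x => (g x : ℂ)) := hgc.comp_left Complex.ofReal_zero
  set ψ : SchwartzMap V ℂ := hgc'.toSchwartzMap hg' with hψ
  have hψx : ∀ x, ψ x = (g x : ℂ) := fun x => rfl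
  have h := congrArg (fun T => T ψ) (Lp.fourierInv_toTemperedDistribution_eq (hf2.toLp f))
  simp only [TemperedDistribution.fourierInv_apply, Lp.toTemperedDistribution_apply] at h
  have h1 : ∫ x, (𝓕⁻ ψ) x • (hf2.toLp f) x = ∫ x, f x * 𝓕⁻ (ψ : V → ℂ) x := by
    refine integral_congr_ae ?_
    filter_upwards [hf2.coeFn_toLp] with x hx
    rw [hx, smul_eq_mul, mul_comm, SchwartzMap.fourierInv_coe]
  rw [h1, ← integral_fourierInv_mul_eq hf1 ψ.integrable] at h
  calc _ = ∫ x, ψ x • ((𝓕⁻ (hf2.toLp f) : Lp ℂ 2 (volume : Measure V)) : V → ℂ) x := rfl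
    _ = _ := h.symm
    _ = _ := by
      refine integral_congr_ae (Eventually.of_forall fun x => ?_)
      simp only [hψx, Complex.real_smul, mul_comm]

/-- The part of `f` left after removing `𝓕⁻ h` has the `L²` norm of `𝓕 f - h`. -/
theorem eLpNorm_sub_fourierInv {f h : V → ℂ} (hf1 : Integrable f) (hf2 : MemLp f 2)
    (hh1 : Integrable h) (hh2 : MemLp h 2) :
    eLpNorm (fun x => f x - 𝓕⁻ h x) 2 volume = eLpNorm (fun ξ => 𝓕 f ξ - h ξ) 2 volume := by
  set F := hf2.toLp f
  set H := hh2.toLp h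
  have e : ‖F - 𝓕⁻ H‖ = ‖𝓕 F - H‖ := by
    rw [← Lp.norm_fourier_eq (F - 𝓕⁻ H)]
    congr 1
    have := (Lp.fourierTransformₗᵢ V ℂ).map_sub F (𝓕⁻ H)
    refine this.trans ?_
    congr 1
    exact (Lp.fourierTransformₗᵢ V ℂ).apply_symm_apply H
  rw [Lp.norm_def, Lp.norm_def, ENNReal.toReal_eq_toReal_iff' (Lp.eLpNorm_ne_top _)
    (Lp.eLpNorm_ne_top _)] at e
  have e1 : (fun x => f x - 𝓕⁻ h x) =ᵐ[volume] ((F - 𝓕⁻ H : Lp ℂ 2 volume) : V → ℂ) := by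
    filter_upwards [Lp.coeFn_sub F (𝓕⁻ H), hf2.coeFn_toLp, coeFn_fourierInv_toLp hh1 hh2]
      with x h1 h2 h3
    rw [h1, Pi.sub_apply, h2, h3]
  have e2 : (fun x => 𝓕 f x - h x) =ᵐ[volume] ((𝓕 F - H : Lp ℂ 2 volume) : V → ℂ) := by
    filter_upwards [Lp.coeFn_sub (𝓕 F) H, hh2.coeFn_toLp, coeFn_fourier_toLp hf1 hf2]
      with x h1 h2 h3
    rw [h1, Pi.sub_apply, h2, h3]
  rw [eLpNorm_congr_ae e1, eLpNorm_congr_ae e2, e]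

end L2Fourier

end FracCritical

namespace FracCritical

/-! ### The critical Sobolev inequality by frequency splitting -/

section Sobolev

variable {n : ℕ}

theorem integrableOn_ball_rpow_neg {a R : ℝ} (hn : 1 ≤ n) (ha : a < n) :
    IntegrableOn (fun ξ : E n => ‖ξ‖ ^ (-a)) (Metric.ball 0 R) := by
  refine integrableOn_ball_of_norm_le_rpow (C := 1) (α := a) (by simpa using hn) (by simpa using ha)
    (Eventually.of_forall fun x => ?_) ?_
  · rw [one_mul, Real.norm_of_nonneg (by positivity)]
  · exact (measurable_norm.pow_const _).aestronglyMeasurable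

theorem integral_ball_rpow_neg {a R : ℝ} (hR : 0 < R) :
    ∫ ξ in Metric.ball (0 : E n) R, ‖ξ‖ ^ (-a) =
      R ^ ((n : ℝ) - a) * ∫ ξ in Metric.ball (0 : E n) 1, ‖ξ‖ ^ (-a) := by
  have h := Measure.setIntegral_comp_smul_of_pos (volume : Measure (E n))
    (fun ξ : E n => ‖ξ‖ ^ (-a)) (Metric.ball 0 1) hR
  rw [smul_unitBall_of_pos hR] at h
  simp only [norm_smul, Real.norm_of_nonneg hR.le, Real.mul_rpow hR.le (norm_nonneg _),
    integral_const_mul, finrank_euclideanSpace, Fintype.card_fin, smul_eq_mul] at h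
  have h2 : R ^ n * (R ^ (-a) * ∫ ξ in Metric.ball (0 : E n) 1, ‖ξ‖ ^ (-a)) =
      ∫ ξ in Metric.ball (0 : E n) R, ‖ξ‖ ^ (-a) := by
    rw [h]
    field_simp
  rw [← h2, ← mul_assoc, ← Real.rpow_natCast, ← Real.rpow_add hR]
  rfl

theorem lintegral_ball_rpow_neg {a R : ℝ} (hn : 1 ≤ n) (ha : a < n) (hR : 0 < R) :
    ∫⁻ ξ in Metric.ball (0 : E n) R, ENNReal.ofReal (‖ξ‖ ^ (-a)) =
      ENNReal.ofReal (R ^ ((n : ℝ) - a) * ∫ ξ in Metric.ball (0 : E n) 1, ‖ξ‖ ^ (-a)) := by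
  rw [← integral_ball_rpow_neg hR, ofReal_integral_eq_lintegral_ofReal
    (integrableOn_ball_rpow_neg hn ha) (Eventually.of_forall fun x => by positivity)]

/-- The homogeneous Sobolev energy of order `m` of a function with Fourier transform `g`. -/
noncomputable def energyLint (m : ℝ) (g : E n → ℂ) : ℝ≥0∞ :=
  ∫⁻ ξ, ENNReal.ofReal (‖ξ‖ ^ (2 * m)) * ‖g ξ‖ₑ ^ 2

theorem ofReal_sq_rpow_half {x : ℝ} (hx : 0 ≤ x) (a : ℝ) :
    ENNReal.ofReal (x ^ a) ^ 2 = ENNReal.ofReal (x ^ (2 * a)) := by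
  rw [← ENNReal.ofReal_pow (by positivity), mul_comm, Real.rpow_mul hx]
  norm_num

/-- Cauchy–Schwarz with the weights `|ξ|^(-m)` and `|ξ|^m`. The first is square integrable on balls
because `2m < n`, and scaling gives the power of `R`. -/
theorem lintegral_ball_enorm_le {m R : ℝ} (hn : 1 ≤ n) (hm : 2 * m < n) (hR : 0 < R)
    {g : E n → ℂ} (hg : Measurable g) :
    ∫⁻ ξ in Metric.ball (0 : E n) R, ‖g ξ‖ₑ ≤
      ENNReal.ofReal (R ^ ((n : ℝ) - 2 * m) *
        ∫ ξ in Metric.ball (0 : E n) 1, ‖ξ‖ ^ (-(2 * m))) ^ (1 / 2 : ℝ) *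
      energyLint m g ^ (1 / 2 : ℝ) := by
  have : Nonempty (Fin n) := ⟨⟨0, hn⟩⟩
  have hne : ∀ᵐ ξ ∂(volume.restrict (Metric.ball (0 : E n) R)), ξ ≠ 0 :=
    ae_restrict_of_ae (Measure.ae_ne volume (0 : E n))
  have e : ∫⁻ ξ in Metric.ball (0 : E n) R, ‖g ξ‖ₑ =
      ∫⁻ ξ in Metric.ball (0 : E n) R, ((fun ξ : E n => ENNReal.ofReal (‖ξ‖ ^ (-m))) *
        fun ξ : E n => (ENNReal.ofReal (‖ξ‖ ^ m) * ‖g ξ‖ₑ)) ξ := by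
    refine lintegral_congr_ae (hne.mono fun ξ hξ => ?_)
    have h0 : 0 < ‖ξ‖ := norm_pos_iff.2 hξ
    simp only [Pi.mul_apply]
    rw [← mul_assoc, ← ENNReal.ofReal_mul (by positivity), ← Real.rpow_add h0]
    simp
  rw [e]
  refine (ENNReal.lintegral_mul_le_Lp_mul_Lq _ Real.HolderConjugate.two_two ?_ ?_).trans ?_
  · exact ((measurable_norm.pow_const _).ennreal_ofReal).aemeasurable
  · exact (((measurable_norm.pow_const _).ennreal_ofReal).mul hg.enorm).aemeasurable
  · refine mul_le_mul' (ENNReal.rpow_le_rpow ?_ (by norm_num))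
      (ENNReal.rpow_le_rpow ?_ (by norm_num))
    · rw [← lintegral_ball_rpow_neg hn hm hR]
      refine lintegral_mono fun ξ => ?_
      simp only [ENNReal.rpow_two]
      rw [ofReal_sq_rpow_half (norm_nonneg _)]
      apply le_of_eq; congr 2; ring
    · refine (setLIntegral_le_lintegral _ _).trans (lintegral_mono fun ξ => ?_)
      simp only [ENNReal.rpow_two]
      rw [mul_pow, ofReal_sq_rpow_half (norm_nonneg _)]

/-- A sup bound on the low-frequency part gives a bound of the distribution function by the
high-frequency part. -/
theorem measure_lt_norm_le {R t : ℝ} (ht : 0 < t) {f : E n → ℂ} (hf1 : Integrable f)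
    (hf2 : MemLp f 2)
    (hlow : ∫⁻ ξ in Metric.ball (0 : E n) R, ‖𝓕 f ξ‖ₑ ≤ ENNReal.ofReal (t / 2)) :
    volume {x | t < ‖f x‖} ≤ ENNReal.ofReal (4 / t ^ 2) *
      ∫⁻ ξ, (Metric.ball (0 : E n) R)ᶜ.indicator (fun ξ => ‖𝓕 f ξ‖ₑ ^ 2) ξ := by
  set B := Metric.ball (0 : E n) R
  have hB : MeasurableSet B := measurableSet_ball
  have hcont := continuous_fourier hf1
  -- `h` is the low-frequency part of the transform. By the hypothesis its inverse transform is at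
  -- most `t/2` everywhere, so where `|f| > t` the high-frequency remainder exceeds `t/2`; Chebyshev
  -- in `L²` and Plancherel finish.
  set h : E n → ℂ := B.indicator (𝓕 f) with hh
  have hh2 : MemLp h 2 := (memLp_fourier hf1 hf2).indicator hB
  have hh1 : Integrable h := by
    rw [integrable_indicator_iff hB]
    exact (hcont.locallyIntegrable.integrableOn_isCompact
      (isCompact_closedBall (0 : E n) R)).mono_set Metric.ball_subset_closedBall
  have hbound : ∀ x, ‖𝓕⁻ h x‖ ≤ t / 2 := by
    intro x
    rw [Real.fourierInv_eq_fourier_neg]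
    refine (norm_fourier_le _).trans ?_
    rw [integral_norm_eq_lintegral_enorm hh1.1]
    refine ENNReal.toReal_le_of_le_ofReal (by positivity) (le_trans (le_of_eq ?_) hlow)
    rw [← lintegral_indicator hB]
    refine lintegral_congr fun ξ => ?_
    rw [hh, enorm_indicator_eq_indicator_enorm]
  have hsub : {x | t < ‖f x‖} ⊆ {x | ENNReal.ofReal (t / 2) ≤ ‖f x - 𝓕⁻ h x‖ₑ} := by
    intro x hx
    simp only [Set.mem_ofPred_eq] at hx ⊢
    rw [← ofReal_norm]
    refine ENNReal.ofReal_le_ofReal ?_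
    have := norm_sub_norm_le (f x) (𝓕⁻ h x)
    linarith [hbound x]
  have hmeas : AEStronglyMeasurable (fun x => f x - 𝓕⁻ h x) volume := by
    refine hf1.1.sub ?_
    rw [Real.fourierInv_eq_fourier_comp_neg]
    exact (continuous_fourier hh1.comp_neg).aestronglyMeasurable
  have hcheb := meas_ge_le_mul_pow_eLpNorm_enorm (μ := (volume : Measure (E n))) (p := 2)
    (by norm_num) (by norm_num) hmeas (ε := ENNReal.ofReal (t / 2)) (by simpa using ht)
    (fun h => absurd h ENNReal.ofReal_ne_top)
  refine (measure_mono hsub).trans (hcheb.trans ?_)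
  rw [eLpNorm_sub_fourierInv hf1 hf2 hh1 hh2]
  have e2 : eLpNorm (fun ξ => 𝓕 f ξ - h ξ) 2 volume ^ (2 : ℝ≥0∞).toReal =
      ∫⁻ ξ, Bᶜ.indicator (fun ξ => ‖𝓕 f ξ‖ₑ ^ 2) ξ := by
    rw [eLpNorm_eq_lintegral_rpow_enorm_toReal (by norm_num) (by norm_num), ← ENNReal.rpow_mul]
    norm_num
    refine lintegral_congr fun ξ => ?_
    by_cases hξ : ξ ∈ B
    · simp [hh, hξ]
    · simp [hh, hξ]
  rw [e2]
  refine mul_le_mul' (le_of_eq ?_) le_rfl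
  rw [ENNReal.toReal_ofNat, ENNReal.rpow_two, ← ENNReal.ofReal_inv_of_pos (by positivity),
    ← ENNReal.ofReal_pow (by positivity)]
  congr 1
  field_simp
  norm_num

theorem lintegral_Ioc_rpow {a τ : ℝ} (ha : 0 < a) (hτ : 0 ≤ τ) :
    ∫⁻ t in Set.Ioc 0 τ, ENNReal.ofReal (t ^ (a - 1)) = ENNReal.ofReal (τ ^ a / a) := by
  rw [← ofReal_integral_eq_lintegral_ofReal
    ((intervalIntegral.intervalIntegrable_rpow' (by linarith)).1)
    ((ae_restrict_iff' measurableSet_Ioc).2 (Eventually.of_forall fun t ht =>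
      Real.rpow_nonneg ht.1.le _)), ← intervalIntegral.integral_of_le hτ,
    integral_rpow (Or.inl (by linarith))]
  rw [sub_add_cancel, Real.zero_rpow ha.ne', sub_zero]

theorem critExp_gt_two {m : ℝ} (hm : 0 < m) (hmn : m < (n : ℝ) / 2) : 2 < critExp n m := by
  unfold critExp
  rw [lt_div_iff₀ (by linarith)]
  linarith

/-- Layer-cake formula with a frequency cut-off that depends on the level `t`. After Tonelli, a
frequency `ξ` only contributes at levels `t ≤ K|ξ|^θ`, and integrating `t^(p-3)` over them gives a
multiple of `|ξ|^(θ(p-2)) = |ξ|^(2m)`, which is the energy weight. -/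
theorem lintegral_critExp_le_of_energy_pos {m D M : ℝ} (hm : 0 < m) (hmn : m < (n : ℝ) / 2)
    (hM : 0 < M) (hD : 0 < D)
    (hDle : ∫ ξ in Metric.ball (0 : E n) 1, ‖ξ‖ ^ (-(2 * m)) ≤ D)
    {f : E n → ℂ} (hf1 : Integrable f) (hf2 : MemLp f 2)
    (hE : energyLint m (𝓕 f) = ENNReal.ofReal M) :
    ∫⁻ x, ENNReal.ofReal (‖f x‖ ^ critExp n m) ≤
      ENNReal.ofReal (critExp n m * (4 * ((2 * (D * M) ^ (1 / 2 : ℝ)) ^ (critExp n m - 2) /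
        (critExp n m - 2) * M))) := by
  have hn : 1 ≤ n := by
    by_contra h
    have : n = 0 := by omega
    subst this
    norm_num at hmn; linarith
  set p := critExp n m with hp
  have hp2 : 2 < p := critExp_gt_two hm hmn
  set θ : ℝ := ((n : ℝ) - 2 * m) / 2 with hθ
  have hθ0 : 0 < θ := by rw [hθ]; linarith
  set K : ℝ := 2 * (D * M) ^ (1 / 2 : ℝ) with hK
  have hK0 : 0 < K := by positivity
  have hcont := continuous_fourier hf1
  set F : E n → ℝ≥0∞ := fun ξ => ‖𝓕 f ξ‖ₑ ^ 2 with hF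
  have hFm : Measurable F := hcont.measurable.enorm.pow_const 2
  have hdist : ∀ t ∈ Set.Ioi (0 : ℝ), volume {x | t < ‖f x‖} * ENNReal.ofReal (t ^ (p - 1)) ≤
      ENNReal.ofReal 4 * ∫⁻ ξ, {q : ℝ × E n | 0 < q.1 ∧ q.1 ≤ K * ‖q.2‖ ^ θ}.indicator
        (fun q => ENNReal.ofReal (q.1 ^ (p - 2 - 1)) * F q.2) (t, ξ) := by
    intro t ht
    have ht : 0 < t := ht
    -- The radius at which the Cauchy–Schwarz bound `R^θ (D M)^(1/2)` of the low frequencies equals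
    -- `t/2`.
    set R : ℝ := (t / K) ^ (1 / θ) with hR
    have hR0 : 0 < R := by positivity
    have hRθ : R ^ θ = t / K := by
      rw [hR, ← Real.rpow_mul (by positivity), one_div_mul_cancel hθ0.ne', Real.rpow_one]
    have hlow : ∫⁻ ξ in Metric.ball (0 : E n) R, ‖𝓕 f ξ‖ₑ ≤ ENNReal.ofReal (t / 2) := by
      refine (lintegral_ball_enorm_le (m := m) hn (by linarith) hR0 hcont.measurable).trans ?_
      rw [hE, ENNReal.ofReal_rpow_of_nonneg (mul_nonneg (by positivity)
          (integral_nonneg fun x => by positivity)) (by norm_num),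
        ENNReal.ofReal_rpow_of_nonneg hM.le (by norm_num), ← ENNReal.ofReal_mul
          (Real.rpow_nonneg (mul_nonneg (by positivity)
          (integral_nonneg fun x => by positivity)) _)]
      refine ENNReal.ofReal_le_ofReal ?_
      have h1 : (R ^ ((n : ℝ) - 2 * m) *
          ∫ ξ in Metric.ball (0 : E n) 1, ‖ξ‖ ^ (-(2 * m))) ^ (1 / 2 : ℝ) ≤
          (R ^ ((n : ℝ) - 2 * m) * D) ^ (1 / 2 : ℝ) := by
        refine Real.rpow_le_rpow (mul_nonneg (by positivity)
          (integral_nonneg fun x => by positivity)) ?_ (by norm_num)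
        gcongr
      refine (mul_le_mul_of_nonneg_right h1 (by positivity)).trans (le_of_eq ?_)
      rw [← Real.mul_rpow (by positivity) (by positivity), mul_assoc,
        Real.mul_rpow (by positivity) (by positivity), ← Real.rpow_mul hR0.le,
        show ((n : ℝ) - 2 * m) * (1 / 2) = θ by rw [hθ]; ring, hRθ, hK]
      field_simp
    refine (mul_le_mul' (measure_lt_norm_le ht hf1 hf2 hlow) le_rfl).trans ?_
    rw [mul_assoc, mul_comm (∫⁻ ξ, _), ← mul_assoc, ← lintegral_const_mul' _ _ (by finiteness),
      ← lintegral_const_mul' _ _ (by finiteness)]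
    refine lintegral_mono fun ξ => ?_
    by_cases hξ : ξ ∈ Metric.ball (0 : E n) R
    · simp [hξ]
    · have hmem : (t, ξ) ∈ {q : ℝ × E n | 0 < q.1 ∧ q.1 ≤ K * ‖q.2‖ ^ θ} := by
        refine ⟨ht, ?_⟩
        have : R ≤ ‖ξ‖ := by simpa using hξ
        have h3 : R ^ θ ≤ ‖ξ‖ ^ θ := Real.rpow_le_rpow hR0.le this hθ0.le
        rw [hRθ, div_le_iff₀ hK0] at h3
        simp only
        linarith
      rw [Set.indicator_of_mem hmem, Set.indicator_of_mem (by simpa using hξ), ← mul_assoc,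
        ← ENNReal.ofReal_mul (by positivity), ← ENNReal.ofReal_mul (by positivity)]
      refine mul_le_mul' (le_of_eq ?_) le_rfl
      congr 1
      have : t ^ (p - 1) = t ^ (p - 2 - 1) * t ^ 2 := by
        rw [← Real.rpow_natCast t 2, ← Real.rpow_add ht]; congr 1; push_cast; ring
      rw [this]; field_simp
  have hSm : MeasurableSet {q : ℝ × E n | 0 < q.1 ∧ q.1 ≤ K * ‖q.2‖ ^ θ} := by
    refine (measurableSet_lt measurable_const measurable_fst).inter
      (measurableSet_le measurable_fst ?_)
    exact ((measurable_norm.comp measurable_snd).pow_const θ).const_mul K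
  have hGm : Measurable ({q : ℝ × E n | 0 < q.1 ∧ q.1 ≤ K * ‖q.2‖ ^ θ}.indicator
        (fun q => ENNReal.ofReal (q.1 ^ (p - 2 - 1)) * F q.2)) := by
    refine Measurable.indicator ?_ hSm
    exact ((measurable_fst.pow_const _).ennreal_ofReal).mul (hFm.comp measurable_snd)
  have hlc := lintegral_rpow_eq_lintegral_meas_lt_mul (volume : Measure (E n))
    (f := fun x => ‖f x‖) (Eventually.of_forall fun x => norm_nonneg _)
    hf1.1.norm.aemeasurable (show 0 < p by linarith)
  rw [hlc, ENNReal.ofReal_mul (p := p) (by linarith), ENNReal.ofReal_mul (p := 4) (by norm_num)]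
  refine mul_le_mul' le_rfl ?_
  refine (setLIntegral_mono' measurableSet_Ioi hdist).trans ?_
  rw [lintegral_const_mul _ hGm.lintegral_prod_right']
  refine mul_le_mul' le_rfl ?_
  rw [lintegral_lintegral_swap (f := fun t ξ =>
    {q : ℝ × E n | 0 < q.1 ∧ q.1 ≤ K * ‖q.2‖ ^ θ}.indicator
      (fun q => ENNReal.ofReal (q.1 ^ (p - 2 - 1)) * F q.2) (t, ξ)) hGm.aemeasurable]
  -- For fixed `ξ` the section of the region in `t` is the interval `(0, K|ξ|^θ]`.
  have hinner : ∀ ξ : E n, ∫⁻ t in Set.Ioi (0 : ℝ),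
      {q : ℝ × E n | 0 < q.1 ∧ q.1 ≤ K * ‖q.2‖ ^ θ}.indicator
        (fun q => ENNReal.ofReal (q.1 ^ (p - 2 - 1)) * F q.2) (t, ξ) =
      ENNReal.ofReal (K ^ (p - 2) / (p - 2)) * (ENNReal.ofReal (‖ξ‖ ^ (2 * m)) * F ξ) := by
    intro ξ
    have e1 : ∀ t : ℝ, {q : ℝ × E n | 0 < q.1 ∧ q.1 ≤ K * ‖q.2‖ ^ θ}.indicator
        (fun q => ENNReal.ofReal (q.1 ^ (p - 2 - 1)) * F q.2) (t, ξ) =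
        (Set.Ioc 0 (K * ‖ξ‖ ^ θ)).indicator (fun t => ENNReal.ofReal (t ^ (p - 2 - 1))) t * F ξ := by
      intro t
      by_cases h : t ∈ Set.Ioc 0 (K * ‖ξ‖ ^ θ)
      · rw [Set.indicator_of_mem h, Set.indicator_of_mem (by exact h)]
      · rw [Set.indicator_of_notMem h, Set.indicator_of_notMem (by exact h), zero_mul]
    simp_rw [e1]
    rw [lintegral_mul_const' _ _ (by simp [hF]), lintegral_indicator measurableSet_Ioc,
      Measure.restrict_restrict measurableSet_Ioc,
      Set.inter_eq_self_of_subset_left Set.Ioc_subset_Ioi_self,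
      lintegral_Ioc_rpow (by linarith) (by positivity), ← mul_assoc,
      ← ENNReal.ofReal_mul (div_nonneg (by positivity) (by linarith))]
    congr 2
    rw [Real.mul_rpow hK0.le (by positivity), ← Real.rpow_mul (norm_nonneg _),
      show θ * (p - 2) = 2 * m by
        rw [hθ, hp, critExp]; field_simp [show (n : ℝ) - 2 * m ≠ 0 by linarith]; ring]
    ring
  rw [lintegral_congr hinner, lintegral_const_mul' _ _ (by finiteness),
    ENNReal.ofReal_mul (div_nonneg (by positivity) (by linarith))]
  exact mul_le_mul' le_rfl (le_of_eq hE)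

/-- The critical Sobolev inequality for functions in `L¹ ∩ L²`. -/
theorem exists_sobolev_const {m : ℝ} (hm : 0 < m) (hmn : m < (n : ℝ) / 2) :
    ∃ C : ℝ, 0 < C ∧ ∀ f : E n → ℂ, Integrable f → MemLp f 2 →
      ∫⁻ x, ENNReal.ofReal (‖f x‖ ^ critExp n m) ≤
        ENNReal.ofReal C * energyLint m (𝓕 f) ^ (critExp n m / 2) := by
  set p := critExp n m with hp
  have hp2 : 2 < p := critExp_gt_two hm hmn
  have hn : 1 ≤ n := by
    by_contra h
    have : n = 0 := by omega
    subst this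
    norm_num at hmn; linarith
  have : Nonempty (Fin n) := ⟨⟨0, hn⟩⟩
  -- Adding `1` makes positivity immediate; only an upper bound of the integral is needed.
  set D : ℝ := (∫ ξ in Metric.ball (0 : E n) 1, ‖ξ‖ ^ (-(2 * m))) + 1 with hD
  have hD0 : 0 < D := by
    have : 0 ≤ ∫ ξ in Metric.ball (0 : E n) 1, ‖ξ‖ ^ (-(2 * m)) :=
      integral_nonneg fun x => by positivity
    linarith
  have hp20 : 0 < p - 2 := by linarith
  have hp0 : 0 < p := by linarith
  set C := p * (4 * ((2 * D ^ (1 / 2 : ℝ)) ^ (p - 2) / (p - 2))) with hC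
  have hC0 : 0 < C := by positivity
  refine ⟨C, hC0, fun f hf1 hf2 => ?_⟩
  by_cases htop : energyLint m (𝓕 f) = ⊤
  · rw [htop, ENNReal.top_rpow_of_pos (by linarith), ENNReal.mul_top (by simpa using hC0)]
    exact le_top
  by_cases hzero : energyLint m (𝓕 f) = 0
  -- With zero energy the transform vanishes almost everywhere, hence so does `f` by Plancherel.
  · have hcont := continuous_fourier hf1
    have h1 : 𝓕 f =ᵐ[volume] 0 := by
      have h2 := (lintegral_eq_zero_iff (((measurable_norm.pow_const _).ennreal_ofReal).mul
        (hcont.measurable.enorm.pow_const 2))).1 hzero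
      filter_upwards [h2, Measure.ae_ne volume (0 : E n)] with ξ h3 h4
      have h5 : 0 < ‖ξ‖ := norm_pos_iff.2 h4
      rcases mul_eq_zero.1
        (show ENNReal.ofReal (‖ξ‖ ^ (2 * m)) * ‖𝓕 f ξ‖ₑ ^ 2 = 0 from h3) with h3 | h3
      · exact absurd (ENNReal.ofReal_eq_zero.1 h3) (not_le.2 (by positivity))
      · simpa using h3
    have h6 : f =ᵐ[volume] 0 := by
      rw [← eLpNorm_eq_zero_iff hf1.1 (two_ne_zero), ← eLpNorm_fourier hf1 hf2,
        eLpNorm_eq_zero_iff hcont.aestronglyMeasurable two_ne_zero]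
      exact h1
    have : ∫⁻ x, ENNReal.ofReal (‖f x‖ ^ p) = 0 := by
      rw [lintegral_eq_zero_iff' ((hf1.1.norm.aemeasurable.pow_const p).ennreal_ofReal)]
      filter_upwards [h6] with x hx
      simp [hx, Real.zero_rpow hp0.ne']
    rw [this]; exact zero_le
  · set M := (energyLint m (𝓕 f)).toReal with hM
    have hM0 : 0 < M := ENNReal.toReal_pos hzero htop
    have hE : energyLint m (𝓕 f) = ENNReal.ofReal M := (ENNReal.ofReal_toReal htop).symm
    refine (lintegral_critExp_le_of_energy_pos hm hmn hM0 hD0 (by linarith) hf1 hf2 hE).trans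
      (le_of_eq ?_)
    rw [hE, ENNReal.ofReal_rpow_of_nonneg hM0.le (by linarith), ← ENNReal.ofReal_mul hC0.le]
    congr 1
    rw [← hp, hC, Real.mul_rpow hD0.le hM0.le, ← mul_assoc 2,
      Real.mul_rpow (by positivity) (by positivity), ← Real.rpow_mul hM0.le]
    have : M ^ (p / 2) = M ^ (1 / 2 * (p - 2)) * M := by
      nth_rewrite 3 [← Real.rpow_one M]
      rw [← Real.rpow_add hM0]; congr 1; ring
    rw [this]; ring

end Sobolev

end FracCritical

namespace FracCritical

variable {n : ℕ}

/-! ### The unitary Fourier transform and the energy norms -/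

section FourierU

theorem integrable_coe {u : E n → ℝ} (hu : Integrable u) :
    Integrable (fun x => (u x : ℂ)) := hu.ofReal

theorem memLp_coe {u : E n → ℝ} {p : ℝ≥0∞} (hu : MemLp u p) :
    MemLp (fun x => (u x : ℂ)) p := hu.ofReal

theorem fourierU_congr_ae {u v : E n → ℝ} (h : u =ᵐ[volume] v) : fourierU u = fourierU v := by
  ext ξ
  unfold fourierU
  rw [Real.fourier_congr_ae (f₂ := fun x => (v x : ℂ)) (h.mono fun x hx => by simp [hx])]

theorem continuous_fourierU {u : E n → ℝ} (hu : Integrable u) : Continuous (fourierU u) := by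
  unfold fourierU
  exact continuous_const.mul ((continuous_fourier (integrable_coe hu)).comp (continuous_const_smul _))

theorem norm_fourierU_le {u : E n → ℝ} (ξ : E n) :
    ‖fourierU u ξ‖ ≤ (2 * Real.pi) ^ (-((n : ℝ) / 2)) * ∫ x, |u x| := by
  unfold fourierU
  rw [norm_mul, Complex.norm_real, Real.norm_of_nonneg (by positivity)]
  refine mul_le_mul_of_nonneg_left ((norm_fourier_le _).trans (le_of_eq ?_)) (by positivity)
  simp

theorem fourierU_add {u v : E n → ℝ} (hu : Integrable u) (hv : Integrable v) :
    fourierU (u + v) = fourierU u + fourierU v := by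
  ext ξ
  simp only [fourierU, Pi.add_apply]
  rw [← mul_add]
  congr 1
  have := VectorFourier.fourierIntegral_add (μ := (volume : Measure (E n))) (L := innerₗ (E n))
    Real.continuous_fourierChar continuous_inner (integrable_coe hu) (integrable_coe hv)
  have h2 := congrFun this ((2 * Real.pi)⁻¹ • ξ)
  simp only [Pi.add_apply] at h2
  have h3 : (fun x => ((u x + v x : ℝ) : ℂ)) = (fun x => (u x : ℂ)) + fun x => (v x : ℂ) := by
    ext x; simp
  rw [h3]
  exact h2

theorem fourierU_smul (c : ℝ) (u : E n → ℝ) : fourierU (c • u) = (c : ℂ) • fourierU u := by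
  ext ξ
  simp only [fourierU, Pi.smul_apply, smul_eq_mul]
  have h : 𝓕 (fun x => ((c * u x : ℝ) : ℂ)) ((2 * Real.pi)⁻¹ • ξ) =
      (c : ℂ) * 𝓕 (fun x => (u x : ℂ)) ((2 * Real.pi)⁻¹ • ξ) := by
    simp only [Real.fourier_eq, ← integral_const_mul]
    refine integral_congr_ae (Eventually.of_forall fun x => ?_)
    simp only [Complex.ofReal_mul, Circle.smul_def, smul_eq_mul]
    ring
  rw [h]; ring

theorem fourierU_sub {u v : E n → ℝ} (hu : Integrable u) (hv : Integrable v) :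
    fourierU (u - v) = fourierU u - fourierU v := by
  have : u - v = u + (-1 : ℝ) • v := by ext x; simp; ring
  rw [this, fourierU_add hu (hv.smul _), fourierU_smul]
  ext ξ; simp; ring

/-- The change of variables `η = ξ/(2π)` carries every statement about the unitary normalisation to
the kernel `exp(-2πi ξ·x)`. -/
theorem weighted_fourierU_eq (a : ℝ) (u : E n → ℝ) (ξ : E n) :
    ‖ξ‖ ^ (2 * a) * ‖fourierU u ξ‖ ^ 2 =
      (fun η : E n => (2 * Real.pi) ^ (2 * a) * (2 * Real.pi) ^ (-(n : ℝ)) *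
        (‖η‖ ^ (2 * a) * ‖𝓕 (fun x => (u x : ℂ)) η‖ ^ 2)) ((2 * Real.pi)⁻¹ • ξ) := by
  have hpi : 0 < 2 * Real.pi := by positivity
  unfold fourierU
  simp only [norm_mul, Complex.norm_real, norm_smul]
  rw [Real.norm_of_nonneg (by positivity), Real.norm_of_nonneg (by positivity),
    Real.mul_rpow (by positivity) (norm_nonneg _), mul_pow, ← Real.rpow_natCast (_ ^ _) 2,
    ← Real.rpow_mul hpi.le, Real.inv_rpow hpi.le]
  have h1 : (2 * Real.pi) ^ (2 * a) ≠ 0 := (Real.rpow_pos_of_pos hpi _).ne'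
  have h2 : -((n : ℝ) / 2) * (2 : ℕ) = -(n : ℝ) := by push_cast; ring
  rw [h2]
  field_simp

theorem normSq_eq (a : ℝ) (u : E n → ℝ) :
    normSq a u = (2 * Real.pi) ^ (2 * a) *
      ∫ η : E n, ‖η‖ ^ (2 * a) * ‖𝓕 (fun x => (u x : ℂ)) η‖ ^ 2 := by
  have hpi : 0 < 2 * Real.pi := by positivity
  unfold normSq
  simp_rw [weighted_fourierU_eq]
  rw [Measure.integral_comp_smul volume (fun η : E n => (2 * Real.pi) ^ (2 * a) *
    (2 * Real.pi) ^ (-(n : ℝ)) * (‖η‖ ^ (2 * a) * ‖𝓕 (fun x => (u x : ℂ)) η‖ ^ 2)), integral_const_mul, smul_eq_mul, finrank_euclideanSpace,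
    Fintype.card_fin, abs_of_nonneg (by positivity), inv_pow, inv_inv, Real.rpow_neg hpi.le,
    Real.rpow_natCast]
  field_simp

theorem integrable_weighted_iff (a : ℝ) (u : E n → ℝ) :
    Integrable (fun ξ : E n => ‖ξ‖ ^ (2 * a) * ‖fourierU u ξ‖ ^ 2) ↔
      Integrable (fun η : E n => ‖η‖ ^ (2 * a) * ‖𝓕 (fun x => (u x : ℂ)) η‖ ^ 2) := by
  have hpi : 0 < 2 * Real.pi := by positivity
  simp_rw [weighted_fourierU_eq]
  rw [integrable_comp_smul_iff volume
    (fun η : E n => (2 * Real.pi) ^ (2 * a) * (2 * Real.pi) ^ (-(n : ℝ)) *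
        (‖η‖ ^ (2 * a) * ‖𝓕 (fun x => (u x : ℂ)) η‖ ^ 2)) (by positivity)]
  exact integrable_const_mul_iff (IsUnit.mk0 _ (by positivity)) _

theorem integrable_sq_fourierU {u : E n → ℝ} (hu1 : Integrable u) (hu2 : MemLp u 2) :
    Integrable (fun ξ => ‖fourierU u ξ‖ ^ 2) := by
  have h := (integrable_weighted_iff 0 u).2 (by
    simpa using (memLp_fourier (integrable_coe hu1) (memLp_coe hu2)).integrable_norm_pow two_ne_zero)
  simpa using h

/-- Plancherel's identity for the rescaled Fourier transform. -/
theorem integral_sq_fourierU {u : E n → ℝ} (hu1 : Integrable u) (hu2 : MemLp u 2) :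
    ∫ ξ, ‖fourierU u ξ‖ ^ 2 = ∫ x, u x ^ 2 := by
  have h := normSq_eq 0 u
  unfold normSq at h
  simp only [mul_zero, Real.rpow_zero, one_mul] at h
  rw [h]
  have h2 := eLpNorm_fourier (integrable_coe hu1) (memLp_coe hu2)
  have h3 : ∀ f : E n → ℂ, MemLp f 2 → ∫ x, ‖f x‖ ^ 2 = (eLpNorm f 2 volume).toReal ^ 2 := by
    intro f hf
    rw [hf.eLpNorm_eq_integral_rpow_norm two_ne_zero (by norm_num), ENNReal.toReal_ofReal
      (by positivity), ENNReal.toReal_ofNat, ← Real.rpow_natCast, ← Real.rpow_mul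
      (integral_nonneg fun x => by positivity)]
    norm_num
  rw [h3 _ (memLp_fourier (integrable_coe hu1) (memLp_coe hu2))]
  refine (congrArg (fun z => ENNReal.toReal z ^ 2) h2).trans ?_
  rw [← h3 (fun x => (u x : ℂ)) (memLp_coe hu2)]
  simp

theorem normSq_nonneg (a : ℝ) (u : E n → ℝ) : 0 ≤ normSq a u :=
  integral_nonneg fun ξ => by positivity

theorem critSq_nonneg (m : ℝ) (u : E n → ℝ) : 0 ≤ critSq m u :=
  Real.rpow_nonneg (integral_nonneg fun ξ => by positivity) _

theorem dim_pos {m : ℝ} (hm : 0 < m) (hmn : m < (n : ℝ) / 2) : 0 < n := by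
  have : (0 : ℝ) < n := by linarith
  exact_mod_cast this

/-- The critical Sobolev inequality in the notation of the energy norms. -/
theorem exists_sobolev {m : ℝ} (hm : 0 < m) (hmn : m < (n : ℝ) / 2) :
    ∃ c : ℝ, 0 < c ∧ ∀ u : E n → ℝ, Integrable u → MemLp u 2 →
      Integrable (fun ξ => ‖ξ‖ ^ (2 * m) * ‖fourierU u ξ‖ ^ 2) →
      MemLp u (ENNReal.ofReal (critExp n m)) ∧ c * critSq m u ≤ normSq m u := by
  obtain ⟨C, hC, h⟩ := exists_sobolev_const hm hmn
  set p := critExp n m with hp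
  have hp2 : 2 < p := critExp_gt_two hm hmn
  have hpi : 0 < 2 * Real.pi := by positivity
  -- The first factor is the one in `normSq_eq`; the second inverts the constant left after raising
  -- the Sobolev bound to the power `2/p`.
  refine ⟨(2 * Real.pi) ^ (2 * m) * (C ^ (2 / p))⁻¹, by positivity, fun u hu1 hu2 hu3 => ?_⟩
  have hS := h (fun x => (u x : ℂ)) (integrable_coe hu1) (memLp_coe hu2)
  rw [integrable_weighted_iff] at hu3
  set M := ∫ η : E n, ‖η‖ ^ (2 * m) * ‖𝓕 (fun x => (u x : ℂ)) η‖ ^ 2 with hM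
  have hM0 : 0 ≤ M := integral_nonneg fun x => by positivity
  have hE : energyLint m (𝓕 (fun x => (u x : ℂ))) = ENNReal.ofReal M := by
    rw [hM, ofReal_integral_eq_lintegral_ofReal hu3 (Eventually.of_forall fun x => by positivity)]
    refine lintegral_congr fun ξ => ?_
    rw [ENNReal.ofReal_mul (by positivity), ENNReal.ofReal_pow (norm_nonneg _), ofReal_norm]
  rw [hE, ENNReal.ofReal_rpow_of_nonneg hM0 (by linarith), ← ENNReal.ofReal_mul hC.le] at hS
  simp only [Complex.norm_real, Real.norm_eq_abs] at hS
  have hint : Integrable (fun x => |u x| ^ p) := by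
    refine ⟨((hu1.1.norm.aemeasurable).pow_const p).aestronglyMeasurable, ?_⟩
    rw [hasFiniteIntegral_iff_ofReal (Eventually.of_forall fun x => by positivity)]
    exact lt_of_le_of_lt hS ENNReal.ofReal_lt_top
  have hle : ∫ x, |u x| ^ p ≤ C * M ^ (p / 2) := by
    rw [integral_eq_lintegral_of_nonneg_ae (Eventually.of_forall fun x => by positivity) hint.1]
    exact ENNReal.toReal_le_of_le_ofReal (by positivity) hS
  constructor
  · have := integrable_norm_rpow_iff (p := ENNReal.ofReal p) hu1.1
      (by simp; linarith) ENNReal.ofReal_ne_top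
    rw [ENNReal.toReal_ofReal (by linarith)] at this
    exact this.1 hint
  · have h1 : critSq m u ≤ C ^ (2 / p) * M := by
      unfold critSq
      rw [← hp]
      refine (Real.rpow_le_rpow (integral_nonneg fun x => by positivity) hle
        (by positivity)).trans (le_of_eq ?_)
      rw [Real.mul_rpow hC.le (by positivity), ← Real.rpow_mul hM0]
      have : p / 2 * (2 / p) = 1 := by field_simp
      rw [this, Real.rpow_one]
    rw [normSq_eq, ← hM, mul_assoc]
    refine mul_le_mul_of_nonneg_left ?_ (by positivity)
    rwa [inv_mul_le_iff₀ (by positivity)]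

end FourierU

/-! ### Finite-energy functions with bounded support -/

section BoundedSupport

/-- Functions that vanish almost everywhere off a set of finite measure. -/
theorem memLp_of_memLp_of_ae_zero {K : Set (E n)} (hK : Bornology.IsBounded K) {u : E n → ℝ}
    {p q : ℝ≥0∞} (hu : MemLp u q) (h0 : ∀ᵐ x, x ∉ K → u x = 0) (hpq : p ≤ q) : MemLp u p := by
  have hae : K.indicator u =ᵐ[volume] u := by
    filter_upwards [h0] with x hx
    by_cases h : x ∈ K
    · simp [h]
    · simp [h, hx h]
  rw [← memLp_congr_ae hae]
  refine ((memLp_congr_ae hae).2 hu).mono_exponent_of_measure_support_ne_top (s := K)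
    (fun x hx => by simp [hx]) hK.measure_lt_top.ne hpq

end BoundedSupport

/-- Square integrable functions with finite energy of order `m` that vanish off `K`. -/
structure FiniteEnergy (K : Set (E n)) (m : ℝ) (u : E n → ℝ) : Prop where
  memLp : MemLp u 2
  ae_zero : ∀ᵐ x, x ∉ K → u x = 0
  integrable_energy : Integrable (fun ξ => ‖ξ‖ ^ (2 * m) * ‖fourierU u ξ‖ ^ 2)

namespace FiniteEnergy

variable {K : Set (E n)} {m a : ℝ} {u v w : E n → ℝ}

theorem integrable (hK : Bornology.IsBounded K) (hu : FiniteEnergy K m u) : Integrable u :=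
  memLp_one_iff_integrable.1 (memLp_of_memLp_of_ae_zero hK hu.memLp hu.ae_zero (by norm_num))

/-- Interpolates the weights: with Plancherel it makes every energy of order between `0` and `m`
finite. -/
theorem rpow_le_one_add {x : ℝ} (hx : 0 ≤ x) (ha : 0 ≤ a) (ham : a ≤ m) :
    x ^ (2 * a) ≤ 1 + x ^ (2 * m) := by
  rcases le_total x 1 with h | h
  · have := Real.rpow_le_one hx h (show 0 ≤ 2 * a by linarith)
    have := Real.rpow_nonneg hx (2 * m)
    linarith
  · have := Real.rpow_le_rpow_of_exponent_le h (show 2 * a ≤ 2 * m by linarith)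
    linarith

theorem integrable_weighted (hK : Bornology.IsBounded K) (hu : FiniteEnergy K m u)
    (ha : 0 ≤ a) (ham : a ≤ m) :
    Integrable (fun ξ => ‖ξ‖ ^ (2 * a) * ‖fourierU u ξ‖ ^ 2) := by
  have hu1 := hu.integrable hK
  refine ((integrable_sq_fourierU hu1 hu.memLp).add hu.integrable_energy).mono'
    (((measurable_norm.pow_const _).mul
      ((continuous_fourierU hu1).measurable.norm.pow_const 2)).aestronglyMeasurable)
    (Eventually.of_forall fun ξ => ?_)
  rw [Real.norm_of_nonneg (by positivity)]
  have := rpow_le_one_add (norm_nonneg ξ) ha ham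
  have h2 : 0 ≤ ‖fourierU u ξ‖ ^ 2 := by positivity
  simp only [Pi.add_apply]
  nlinarith

theorem integrable_energyForm (hK : Bornology.IsBounded K) (hu : FiniteEnergy K m u)
    (hv : FiniteEnergy K m v) (ha : 0 ≤ a) (ham : a ≤ m) :
    Integrable (fun ξ => ‖ξ‖ ^ (2 * a) *
      (fourierU u ξ * (starRingEnd ℂ) (fourierU v ξ)).re) := by
  refine ((hu.integrable_weighted hK ha ham).add (hv.integrable_weighted hK ha ham)).mono' ?_
    (Eventually.of_forall fun ξ => ?_)
  · refine ((measurable_norm.pow_const _).mul ?_).aestronglyMeasurable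
    have h1 := (continuous_fourierU (hu.integrable hK))
    have h2 := (continuous_fourierU (hv.integrable hK))
    exact (Complex.continuous_re.comp (h1.mul (Complex.continuous_conj.comp h2))).measurable
  · rw [norm_mul, Real.norm_of_nonneg (by positivity), Pi.add_apply, ← mul_add]
    refine mul_le_mul_of_nonneg_left ?_ (by positivity)
    refine (Complex.abs_re_le_norm _).trans ?_
    rw [norm_mul, RCLike.norm_conj]
    nlinarith [sq_nonneg (‖fourierU u ξ‖ - ‖fourierU v ξ‖), sq_nonneg (‖fourierU u ξ‖),
      sq_nonneg (‖fourierU v ξ‖)]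

theorem add (hK : Bornology.IsBounded K) (hu : FiniteEnergy K m u) (hv : FiniteEnergy K m v) :
    FiniteEnergy K m (u + v) := by
  refine ⟨hu.memLp.add hv.memLp, ?_, ?_⟩
  · filter_upwards [hu.ae_zero, hv.ae_zero] with x h1 h2 hx
    simp [h1 hx, h2 hx]
  · have hu1 := hu.integrable hK
    have hv1 := hv.integrable hK
    refine ((hu.integrable_energy.add hv.integrable_energy).const_mul 2).mono'
      (((measurable_norm.pow_const _).mul
      ((continuous_fourierU (hu1.add hv1)).measurable.norm.pow_const 2)).aestronglyMeasurable)
      (Eventually.of_forall fun ξ => ?_)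
    rw [Real.norm_of_nonneg (by positivity), fourierU_add hu1 hv1, Pi.add_apply, Pi.add_apply,
      ← mul_add, mul_left_comm]
    refine mul_le_mul_of_nonneg_left ?_ (by positivity)
    have h := norm_add_le (fourierU u ξ) (fourierU v ξ)
    have h2 := pow_le_pow_left₀ (norm_nonneg _) h 2
    nlinarith [sq_nonneg (‖fourierU u ξ‖ - ‖fourierU v ξ‖)]

theorem smul (c : ℝ) (hu : FiniteEnergy K m u) : FiniteEnergy K m (c • u) := by
  refine ⟨hu.memLp.const_smul c, ?_, ?_⟩
  · filter_upwards [hu.ae_zero] with x h1 hx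
    simp [h1 hx]
  · refine (hu.integrable_energy.const_mul (c ^ 2)).congr (Eventually.of_forall fun ξ => ?_)
    simp only [fourierU_smul, Pi.smul_apply, smul_eq_mul, norm_mul, Complex.norm_real,
      Real.norm_eq_abs, mul_pow, sq_abs]
    ring

theorem sub (hK : Bornology.IsBounded K) (hu : FiniteEnergy K m u) (hv : FiniteEnergy K m v) :
    FiniteEnergy K m (u - v) := by
  have : u - v = u + (-1 : ℝ) • v := by ext x; simp; ring
  rw [this]
  exact hu.add hK (hv.smul _)

end FiniteEnergy

theorem energyForm_self (a : ℝ) (u : E n → ℝ) : energyForm a u u = normSq a u := by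
  unfold energyForm normSq
  refine integral_congr_ae (Eventually.of_forall fun ξ => ?_)
  simp only [Complex.mul_conj, Complex.ofReal_re, Complex.normSq_eq_norm_sq]

theorem energyForm_smul_left (a c : ℝ) (u v : E n → ℝ) :
    energyForm a (c • u) v = c * energyForm a u v := by
  unfold energyForm
  rw [← integral_const_mul]
  refine integral_congr_ae (Eventually.of_forall fun ξ => ?_)
  simp only [fourierU_smul, Pi.smul_apply, smul_eq_mul, mul_assoc, Complex.re_ofReal_mul]
  ring

theorem normSq_smul (a c : ℝ) (u : E n → ℝ) : normSq a (c • u) = c ^ 2 * normSq a u := by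
  unfold normSq
  rw [← integral_const_mul]
  refine integral_congr_ae (Eventually.of_forall fun ξ => ?_)
  simp only [fourierU_smul, Pi.smul_apply, smul_eq_mul, norm_mul, Complex.norm_real,
      Real.norm_eq_abs, mul_pow, sq_abs]
  ring

theorem normSq_add_smul {K : Set (E n)} {m a : ℝ} {u v : E n → ℝ} (hK : Bornology.IsBounded K)
    (hu : FiniteEnergy K m u) (hv : FiniteEnergy K m v) (ha : 0 ≤ a) (ham : a ≤ m) (t : ℝ) :
    normSq a (u + t • v) = normSq a u + 2 * t * energyForm a u v + t ^ 2 * normSq a v := by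
  have hu1 := hu.integrable hK
  have hv1 := hv.integrable hK
  unfold normSq energyForm
  have h12 : Integrable (fun ξ => ‖ξ‖ ^ (2 * a) * ‖fourierU u ξ‖ ^ 2 +
      2 * t * (‖ξ‖ ^ (2 * a) * (fourierU u ξ * (starRingEnd ℂ) (fourierU v ξ)).re)) := (hu.integrable_weighted hK ha ham).add
    ((hu.integrable_energyForm hK hv ha ham).const_mul (2 * t))
  rw [← integral_const_mul, ← integral_const_mul, ← integral_add
    (hu.integrable_weighted hK ha ham) ((hu.integrable_energyForm hK hv ha ham).const_mul _),
    ← integral_add h12 ((hv.integrable_weighted hK ha ham).const_mul _)]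
  refine integral_congr_ae (Eventually.of_forall fun ξ => ?_)
  simp only [fourierU_add hu1 (hv1.smul t), fourierU_smul, Pi.add_apply, Pi.smul_apply,
    smul_eq_mul]
  rw [← Complex.normSq_eq_norm_sq, Complex.normSq_add, ← Complex.normSq_eq_norm_sq,
    ← Complex.normSq_eq_norm_sq, Complex.normSq_mul, map_mul, Complex.conj_ofReal,
    Complex.normSq_ofReal, mul_left_comm, Complex.re_ofReal_mul]
  ring

end FracCritical

namespace FracCritical

variable {n : ℕ}

/-! ### Mollification: finite energy implies membership in the completion -/

section Mollification

theorem eLpNorm_critExp_eq {m : ℝ} (hm : 0 < m) (hmn : m < (n : ℝ) / 2) {u : E n → ℝ}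
    (hu : MemLp u (ENNReal.ofReal (critExp n m))) :
    eLpNorm u (ENNReal.ofReal (critExp n m)) volume = ENNReal.ofReal (√(critSq m u)) := by
  have hp2 := critExp_gt_two hm hmn
  have hp0 : 0 < critExp n m := by linarith
  rw [hu.eLpNorm_eq_integral_rpow_norm (by simpa using hp0) ENNReal.ofReal_ne_top,
    ENNReal.toReal_ofReal hp0.le]
  unfold critSq
  rw [Real.sqrt_eq_rpow, ← Real.rpow_mul (integral_nonneg fun x => by positivity)]
  simp only [Real.norm_eq_abs]
  congr 2
  field_simp

/-- The bound `2` covers the difference of two bump multipliers, or of one and the constant `1`,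
since each has modulus at most `1`. -/
theorem integrable_energy_of_multiplier {m : ℝ} {u w : E n → ℝ} (hu1 : Integrable u)
    (hu : Integrable (fun ξ => ‖ξ‖ ^ (2 * m) * ‖fourierU u ξ‖ ^ 2)) {c : E n → ℂ}
    (hw : ∀ ξ, fourierU w ξ = c ξ * fourierU u ξ) (hc : Continuous c) (hb : ∀ ξ, ‖c ξ‖ ≤ 2) :
    Integrable (fun ξ => ‖ξ‖ ^ (2 * m) * ‖fourierU w ξ‖ ^ 2) := by
  have hcu := (continuous_fourierU hu1)
  refine (hu.const_mul 4).mono' ?_ (Eventually.of_forall fun ξ => ?_)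
  · simp_rw [hw]
    exact ((measurable_norm.pow_const _).mul
      ((hc.mul hcu).measurable.norm.pow_const 2)).aestronglyMeasurable
  · rw [Real.norm_of_nonneg (by positivity), hw, norm_mul, mul_pow, mul_left_comm]
    refine mul_le_mul_of_nonneg_right ?_ (by positivity)
    nlinarith [hb ξ, norm_nonneg (c ξ)]

theorem tendsto_normSq_of_multiplier {ι : Type*} {l : Filter ι} [l.IsCountablyGenerated] {m : ℝ}
    {u : E n → ℝ} {w : ι → E n → ℝ} (hu1 : Integrable u)
    (hu : Integrable (fun ξ => ‖ξ‖ ^ (2 * m) * ‖fourierU u ξ‖ ^ 2)) {c : ι → E n → ℂ}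
    (hw : ∀ i ξ, fourierU (w i) ξ = c i ξ * fourierU u ξ) (hc : ∀ i, Continuous (c i))
    (hb : ∀ i ξ, ‖c i ξ‖ ≤ 2) (hlim : ∀ ξ, Tendsto (fun i => c i ξ) l (𝓝 0)) :
    Tendsto (fun i => normSq m (w i)) l (𝓝 0) := by
  unfold normSq
  have h0 : (0 : ℝ) = ∫ _ : E n, (0 : ℝ) := by simp
  rw [h0]
  refine tendsto_integral_filter_of_dominated_convergence
    (fun ξ => 4 * (‖ξ‖ ^ (2 * m) * ‖fourierU u ξ‖ ^ 2))
    (Eventually.of_forall fun i =>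
      (integrable_energy_of_multiplier hu1 hu (hw i) (hc i) (hb i)).1)
    (Eventually.of_forall fun i => Eventually.of_forall fun ξ => ?_) (hu.const_mul 4)
    (Eventually.of_forall fun ξ => ?_)
  · rw [Real.norm_of_nonneg (by positivity), hw, norm_mul, mul_pow, mul_left_comm]
    refine mul_le_mul_of_nonneg_right ?_ (by positivity)
    nlinarith [hb i ξ, norm_nonneg (c i ξ)]
  · simp_rw [hw, norm_mul, mul_pow]
    have := (((hlim ξ).norm.pow 2).mul_const (‖fourierU u ξ‖ ^ 2)).const_mul (‖ξ‖ ^ (2 * m))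
    simpa using this

/-- The frequency multiplier of the mollification by a bump function. -/
noncomputable def bumpMultiplier (ρ : ContDiffBump (0 : E n)) (ξ : E n) : ℂ :=
  𝓕 (fun x => ((ρ.normed volume x : ℝ) : ℂ)) ((2 * Real.pi)⁻¹ • ξ)

theorem continuous_bumpMultiplier (ρ : ContDiffBump (0 : E n)) :
    Continuous (bumpMultiplier ρ) :=
  (continuous_fourier (integrable_coe ρ.integrable_normed)).comp (continuous_const_smul _)

theorem norm_bumpMultiplier_le (ρ : ContDiffBump (0 : E n)) (ξ : E n) :
    ‖bumpMultiplier ρ ξ‖ ≤ 1 := by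
  refine (norm_fourier_le _).trans (le_of_eq ?_)
  simp only [Complex.norm_real, Real.norm_of_nonneg (ρ.nonneg_normed _)]
  exact ρ.integral_normed

/-- The multiplier at `ξ` is the convolution, evaluated at `0`, of an approximate identity with a
character, and a character equals `1` at `0`. -/
theorem tendsto_bumpMultiplier {ι : Type*} {l : Filter ι} {ρ : ι → ContDiffBump (0 : E n)}
    (hρ : Tendsto (fun i => (ρ i).rOut) l (𝓝 0)) (ξ : E n) :
    Tendsto (fun i => bumpMultiplier (ρ i) ξ) l (𝓝 1) := by
  set g : E n → ℂ := fun y => (Real.fourierChar (inner ℝ y ((2 * Real.pi)⁻¹ • ξ)) : ℂ) with hg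
  have hgc : Continuous g := by
    rw [hg]
    exact continuous_induced_dom.comp (Real.continuous_fourierChar.comp
      (continuous_id.inner continuous_const))
  have h := ContDiffBump.convolution_tendsto_right_of_continuous (μ := (volume : Measure (E n)))
    hρ hgc 0
  have hg0 : g 0 = 1 := by simp [hg]
  rw [hg0] at h
  refine h.congr fun i => ?_
  rw [bumpMultiplier, Real.fourier_eq]
  unfold convolution
  refine integral_congr_ae (Eventually.of_forall fun x => ?_)
  simp only [hg, zero_sub, inner_neg_left, ContinuousLinearMap.lsmul_apply, Complex.real_smul,
    Circle.smul_def, smul_eq_mul]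
  ring

theorem fourierU_convolution_normed (ρ : ContDiffBump (0 : E n)) {u : E n → ℝ}
    (hu : Integrable u) (ξ : E n) :
    fourierU (convolution (ρ.normed volume) u (ContinuousLinearMap.lsmul ℝ ℝ) volume) ξ =
      bumpMultiplier ρ ξ * fourierU u ξ := by
  unfold fourierU bumpMultiplier
  have e : (fun x => ((convolution (ρ.normed volume) u (ContinuousLinearMap.lsmul ℝ ℝ) volume x
      : ℝ) : ℂ)) = convolution (fun x => ((ρ.normed volume x : ℝ) : ℂ)) (fun x => (u x : ℂ))
        (ContinuousLinearMap.mul ℂ ℂ) volume := by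
    ext x
    unfold convolution
    rw [← integral_complex_ofReal]
    refine integral_congr_ae (Eventually.of_forall fun x => ?_)
    simp
  rw [e, Real.fourier_mul_convolution_eq (integrable_coe ρ.integrable_normed) (integrable_coe hu)]
  ring

/-- The mollifications are test functions whose transforms are `fourierU u` times bounded
multipliers tending to `1`. Dominated convergence gives convergence in energy, and the Sobolev
inequality turns it into convergence in the critical Lebesgue space. -/
theorem FiniteEnergy.memD {K : Set (E n)} {m : ℝ} (hm : 0 < m) (hmn : m < (n : ℝ) / 2)
    (hK : Bornology.IsBounded K) {u : E n → ℝ} (hu : FiniteEnergy K m u) : MemD m u := by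
  obtain ⟨c, hc, hS⟩ := exists_sobolev hm hmn
  have hu1 := hu.integrable hK
  refine ⟨(hS u hu1 hu.memLp hu.integrable_energy).1, ?_⟩
  obtain ⟨R, hR⟩ := hK.subset_closedBall 0
  set B := Metric.closedBall (0 : E n) R with hB
  -- `u` vanishes only almost everywhere off `K`. A representative with genuinely compact support is
  -- needed for the convolutions to have compact support.
  set u₀ := B.indicator u with hu₀
  have hae : u₀ =ᵐ[volume] u := by
    filter_upwards [hu.ae_zero] with x hx
    by_cases h : x ∈ B
    · simp [hu₀, h]
    · have : x ∉ K := fun h' => h (hR h')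
      simp [hu₀, h, hx this]
  have hu₀1 : Integrable u₀ := (integrable_congr hae).2 hu1
  have hu₀c : HasCompactSupport u₀ :=
    HasCompactSupport.intro (isCompact_closedBall 0 R) fun x hx => by simp [hu₀, hB, hx]
  set ρ : ℕ → ContDiffBump (0 : E n) := fun k =>
    ⟨1 / ((k : ℝ) + 1) / 2, 1 / ((k : ℝ) + 1), by positivity, half_lt_self (by positivity)⟩ with hρ
  have hρlim : Tendsto (fun k => (ρ k).rOut) atTop (𝓝 0) := tendsto_one_div_add_atTop_nhds_zero_nat
  set φ : ℕ → E n → ℝ := fun k =>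
    convolution ((ρ k).normed volume) u₀ (ContinuousLinearMap.lsmul ℝ ℝ) volume with hφ
  have hφs : ∀ k, ContDiff ℝ ∞ (φ k) := fun k =>
    (ρ k).hasCompactSupport_normed.contDiff_convolution_left _ (ρ k).contDiff_normed
      hu₀1.locallyIntegrable
  have hφc : ∀ k, HasCompactSupport (φ k) := fun k =>
    (ρ k).hasCompactSupport_normed.convolution _ hu₀c
  have hφ1 : ∀ k, Integrable (φ k) := fun k =>
    (hφs k).continuous.integrable_of_hasCompactSupport (hφc k)
  have hφ2 : ∀ k, MemLp (φ k) 2 := fun k =>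
    (hφs k).continuous.memLp_of_hasCompactSupport (hφc k)
  have hφF : ∀ k ξ, fourierU (φ k) ξ = bumpMultiplier (ρ k) ξ * fourierU u ξ := fun k ξ => by
    rw [hφ, fourierU_convolution_normed _ hu₀1, fourierU_congr_ae hae]
  have hlim : ∀ ξ, Tendsto (fun k => bumpMultiplier (ρ k) ξ) atTop (𝓝 1) :=
    tendsto_bumpMultiplier hρlim
  have hdF : ∀ k ξ, fourierU (φ k - u) ξ = (bumpMultiplier (ρ k) ξ - 1) * fourierU u ξ :=
    fun k ξ => by rw [fourierU_sub (hφ1 k) hu1, Pi.sub_apply, hφF]; ring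
  have hdc : ∀ k, Continuous fun ξ => bumpMultiplier (ρ k) ξ - 1 := fun k =>
    (continuous_bumpMultiplier _).sub continuous_const
  have hdb : ∀ k ξ, ‖bumpMultiplier (ρ k) ξ - 1‖ ≤ 2 := fun k ξ => by
    refine (norm_sub_le _ _).trans ?_
    have := norm_bumpMultiplier_le (ρ k) ξ
    rw [norm_one]; linarith
  refine ⟨φ, fun k => ⟨hφs k, hφc k⟩, ?_, ?_⟩
  · have hE := fun k => hS (φ k - u) ((hφ1 k).sub hu1) ((hφ2 k).sub hu.memLp)
      (integrable_energy_of_multiplier hu1 hu.integrable_energy (hdF k) (hdc k) (hdb k))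
    have h1 : Tendsto (fun k => normSq m (φ k - u)) atTop (𝓝 0) :=
      tendsto_normSq_of_multiplier hu1 hu.integrable_energy hdF hdc hdb fun ξ => by
        simpa using (hlim ξ).sub_const 1
    have h2 : Tendsto (fun k => critSq m (φ k - u)) atTop (𝓝 0) := by
      refine squeeze_zero (fun k => critSq_nonneg _ _) (fun k => ?_)
        (by simpa using h1.const_mul c⁻¹)
      rw [← div_eq_inv_mul, le_div_iff₀ hc, mul_comm]
      exact (hE k).2
    have h3 := ENNReal.tendsto_ofReal (h2.sqrt)
    rw [Real.sqrt_zero, ENNReal.ofReal_zero] at h3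
    exact h3.congr fun k => (eLpNorm_critExp_eq hm hmn (hE k).1).symm
  · refine tendsto_normSq_of_multiplier (c := fun q ξ => bumpMultiplier (ρ q.1) ξ -
      bumpMultiplier (ρ q.2) ξ) hu1 hu.integrable_energy (fun q ξ => ?_) (fun q => ?_)
      (fun q ξ => ?_) fun ξ => ?_
    · rw [fourierU_sub (hφ1 _) (hφ1 _), Pi.sub_apply, hφF, hφF]; ring
    · exact (continuous_bumpMultiplier _).sub (continuous_bumpMultiplier _)
    · refine (norm_sub_le _ _).trans ?_
      have h1 := norm_bumpMultiplier_le (ρ q.1) ξ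
      have h2 := norm_bumpMultiplier_le (ρ q.2) ξ
      linarith
    · rw [← prod_atTop_atTop_eq]
      have := ((hlim ξ).comp (tendsto_fst (g := (atTop : Filter ℕ)))).sub
        ((hlim ξ).comp (tendsto_snd (f := (atTop : Filter ℕ))))
      rw [sub_self] at this
      exact this

theorem FiniteEnergy.mem_HTilde {Ω : Set (E n)} {m : ℝ} (hm : 0 < m) (hmn : m < (n : ℝ) / 2)
    (hΩ : Bornology.IsBounded Ω) {u : E n → ℝ} (hu : FiniteEnergy (closure Ω) m u) :
    u ∈ HTilde Ω m :=
  ⟨hu.memD hm hmn hΩ.closure, hu.ae_zero⟩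

end Mollification

end FracCritical

namespace FracCritical

variable {n : ℕ}

/-! ### The completion: membership implies finite energy -/

section Completion

theorem tendsto_integral_mul_of_tendsto_eLpNorm {α : Type*} [MeasurableSpace α] {μ : Measure α}
    {p q : ℝ≥0∞} [ENNReal.HolderConjugate p q] {f : ℕ → α → ℂ} {g h : α → ℂ}
    (hf : ∀ k, MemLp (f k) p μ) (hg : MemLp g p μ) (hh : MemLp h q μ)
    (hlim : Tendsto (fun k => eLpNorm (f k - g) p μ) atTop (𝓝 0)) :
    Tendsto (fun k => ∫ x, f k x * h x ∂μ) atTop (𝓝 (∫ x, g x * h x ∂μ)) := by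
  refine tendsto_integral_of_L1' _ (hg.1.mul hh.1)
    (Eventually.of_forall fun k => ?_) ?_
  · exact memLp_one_iff_integrable.1 (hh.mul' (hf k))
  · have h1 : Tendsto (fun k => eLpNorm (f k - g) p μ * eLpNorm h q μ) atTop (𝓝 0) := by
      simpa using ENNReal.Tendsto.mul_const hlim (Or.inr hh.2.ne)
    refine tendsto_of_tendsto_of_tendsto_of_le_of_le tendsto_const_nhds h1 (fun k => zero_le)
      fun k => ?_
    have := eLpNorm_smul_le_mul_eLpNorm (r := 1) hh.1 ((hf k).1.sub hg.1) (p := p) (q := q)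
    refine le_trans (le_of_eq (congrArg (fun F => eLpNorm F 1 μ) ?_)) this
    ext x
    simp [sub_mul]

theorem integrable_energy_schwartz {m : ℝ} (hm : 0 ≤ m) (ψ : SchwartzMap (E n) ℂ) :
    Integrable (fun ξ => ‖ξ‖ ^ (2 * m) * ‖ψ ξ‖ ^ 2) := by
  obtain ⟨N, hN⟩ := exists_nat_ge (2 * m)
  obtain ⟨C, hC0, hC⟩ := ψ.decay 0 0
  have hC' : ∀ ξ, ‖ψ ξ‖ ≤ C := fun ξ => by simpa using hC ξ
  refine (((ψ.integrable_pow_mul volume 0).add (ψ.integrable_pow_mul volume N)).const_mul C).mono'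
    ((measurable_norm.pow_const _).mul
      (ψ.continuous.measurable.norm.pow_const 2)).aestronglyMeasurable
    (Eventually.of_forall fun ξ => ?_)
  rw [Real.norm_of_nonneg (by positivity), Pi.add_apply, ← add_mul, sq, ← mul_assoc, mul_comm C,
    pow_zero]
  refine mul_le_mul (mul_le_mul_of_nonneg_right ?_ (norm_nonneg _)) (hC' ξ) (norm_nonneg _)
    (by positivity)
  rcases le_total ‖ξ‖ 1 with h | h
  · have := Real.rpow_le_one (norm_nonneg ξ) h (show 0 ≤ 2 * m by linarith)
    have : 0 ≤ ‖ξ‖ ^ N := by positivity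
    linarith
  · have := Real.rpow_le_rpow_of_exponent_le h hN
    rw [Real.rpow_natCast] at this
    linarith

/-- A real test function, as a complex-valued Schwartz function. -/
theorem exists_schwartz_eq {φ : E n → ℝ} (h1 : ContDiff ℝ ∞ φ) (h2 : HasCompactSupport φ) :
    ∃ ψ : SchwartzMap (E n) ℂ, (ψ : E n → ℂ) = fun x => (φ x : ℂ) := by
  have h1' : ContDiff ℝ ∞ (fun x => (φ x : ℂ)) := Complex.ofRealCLM.contDiff.comp h1
  have h2' : HasCompactSupport (fun x => (φ x : ℂ)) := h2.comp_left Complex.ofReal_zero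
  exact ⟨h2'.toSchwartzMap h1', rfl⟩

theorem locallyIntegrable_rpow_neg_mul {m : ℝ} (hmn : m < (n : ℝ) / 2)
    (hn : 0 < n) {g : E n → ℂ} (hg : MemLp g 2) :
    LocallyIntegrable (fun ξ => ((‖ξ‖ ^ (-m) : ℝ) : ℂ) * g ξ) := by
  have h1 : LocallyIntegrable (fun ξ : E n => ‖ξ‖ ^ (-(2 * m))) :=
    locallyIntegrable_of_norm_le_rpow (C := 1) (α := 2 * m)
      (by rw [finrank_euclideanSpace, Fintype.card_fin]; exact hn)
      (by rw [finrank_euclideanSpace, Fintype.card_fin]; linarith)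
      (Eventually.of_forall fun x => by
        rw [one_mul, Real.norm_of_nonneg (by positivity)])
      (measurable_norm.pow_const _).aestronglyMeasurable
  have h2 : Integrable (fun ξ => ‖g ξ‖ ^ 2) := hg.integrable_norm_pow two_ne_zero
  refine (h1.add h2.locallyIntegrable).mono ?_ (Eventually.of_forall fun ξ => ?_)
  · exact (Complex.measurable_ofReal.comp (measurable_norm.pow_const _)).aestronglyMeasurable.mul
      hg.1
  · have e : ‖ξ‖ ^ (-(2 * m)) = (‖ξ‖ ^ (-m)) ^ 2 := by
      rw [← Real.rpow_natCast, ← Real.rpow_mul (norm_nonneg _)]; congr 1; push_cast; ring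
    have h3 : 0 ≤ ‖ξ‖ ^ (-m) := by positivity
    rw [norm_mul, Complex.norm_real, Real.norm_of_nonneg h3, Pi.add_apply, e,
      Real.norm_of_nonneg (by positivity)]
    nlinarith [sq_nonneg (‖ξ‖ ^ (-m) - ‖g ξ‖), sq_nonneg (‖ξ‖ ^ (-m)), sq_nonneg (‖g ξ‖)]

/-- Allows the singular factor `|ξ|^(-m)` to be moved onto the test function in an `L²` pairing; `2m
< n` makes its square locally integrable. -/
theorem memLp_rpow_neg_mul_test {m : ℝ} (hmn : m < (n : ℝ) / 2)
    (hn : 0 < n) {ψ : E n → ℝ} (h1 : Continuous ψ) (h2 : HasCompactSupport ψ) :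
    MemLp (fun ξ => ((‖ξ‖ ^ (-m) : ℝ) : ℂ) * (ψ ξ : ℂ)) 2 := by
  have hm : AEStronglyMeasurable (fun ξ : E n => ((‖ξ‖ ^ (-m) : ℝ) : ℂ) * (ψ ξ : ℂ)) volume :=
    ((Complex.measurable_ofReal.comp (measurable_norm.pow_const _)).mul
      (Complex.measurable_ofReal.comp h1.measurable)).aestronglyMeasurable
  rw [memLp_two_iff_integrable_sq_norm hm]
  have h3 : LocallyIntegrable (fun ξ : E n => ‖ξ‖ ^ (-(2 * m))) :=
    locallyIntegrable_of_norm_le_rpow (C := 1) (α := 2 * m)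
      (by rw [finrank_euclideanSpace, Fintype.card_fin]; exact hn)
      (by rw [finrank_euclideanSpace, Fintype.card_fin]; linarith)
      (Eventually.of_forall fun x => by
        rw [one_mul, Real.norm_of_nonneg (by positivity)])
      (measurable_norm.pow_const _).aestronglyMeasurable
  have h4 := h3.integrable_smul_left_of_hasCompactSupport (g := fun ξ => ψ ξ ^ 2) (by fun_prop)
    (h2.comp_left (g := fun x : ℝ => x ^ 2) (by simp))
  refine h4.congr (Eventually.of_forall fun ξ => ?_)
  have e : ‖ξ‖ ^ (-(2 * m)) = (‖ξ‖ ^ (-m)) ^ 2 := by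
    rw [← Real.rpow_natCast, ← Real.rpow_mul (norm_nonneg _)]; congr 1; push_cast; ring
  simp only [smul_eq_mul, norm_mul, Complex.norm_real, e, mul_pow, Real.norm_eq_abs, sq_abs]
  ring

/-- The functions `|ξ|^m` times the transforms of the approximating test functions are Cauchy in
`L²`. Their limit `γ` equals `|ξ|^m` times the transform of `u`, so the energy is `∫ |γ|²` up to
normalisation. -/
theorem MemD.integrable_energy {m : ℝ} (hm : 0 < m) (hmn : m < (n : ℝ) / 2) {u : E n → ℝ}
    (hu : MemD m u) (hu1 : Integrable u) :
    Integrable (fun ξ => ‖ξ‖ ^ (2 * m) * ‖fourierU u ξ‖ ^ 2) := by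
  obtain ⟨hup, φ, hφ, hlim, hcauchy⟩ := hu
  have hn := dim_pos hm hmn
  have hp2 := critExp_gt_two hm hmn
  set p := critExp n m with hp
  have : Nonempty (Fin n) := ⟨⟨0, hn⟩⟩
  choose Φ hΦ using fun k => exists_schwartz_eq (hφ k).1 (hφ k).2
  have hΦ' : ∀ k, ((𝓕 (Φ k) : SchwartzMap (E n) ℂ) : E n → ℂ) = 𝓕 (fun x => (φ k x : ℂ)) :=
    fun k => by rw [← hΦ]; rfl
  set G : ℕ → E n → ℂ := fun k ξ => ((‖ξ‖ ^ m : ℝ) : ℂ) * 𝓕 (fun x => (φ k x : ℂ)) ξ with hG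
  have hsq : ∀ ξ : E n, (‖ξ‖ ^ m) ^ 2 = ‖ξ‖ ^ (2 * m) := fun ξ => by
    rw [← Real.rpow_natCast, ← Real.rpow_mul (norm_nonneg _)]; congr 1; push_cast; ring
  have hφ1 : ∀ k, Integrable (φ k) := fun k =>
    (hφ k).1.continuous.integrable_of_hasCompactSupport (hφ k).2
  have hGm : ∀ k, AEStronglyMeasurable (G k) volume := fun k =>
    ((Complex.measurable_ofReal.comp (measurable_norm.pow_const _)).mul
      (continuous_fourier (integrable_coe (hφ1 k))).measurable).aestronglyMeasurable
  have hG2 : ∀ k, MemLp (G k) 2 := fun k => by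
    rw [memLp_two_iff_integrable_sq_norm (hGm k)]
    refine (integrable_energy_schwartz hm.le (𝓕 (Φ k))).congr (Eventually.of_forall fun ξ => ?_)
    simp only [hG, norm_mul, Complex.norm_real, mul_pow, hΦ', Real.norm_eq_abs, sq_abs, hsq]
  set g : ℕ → Lp ℂ 2 (volume : Measure (E n)) := fun k => (hG2 k).toLp (G k) with hg
  have hdist : ∀ j k, dist (g j) (g k) ^ 2 =
      ((2 * Real.pi) ^ (2 * m))⁻¹ * normSq m (φ j - φ k) := by
    intro j k
    rw [dist_eq_norm, hg, ← MemLp.toLp_sub, Lp.norm_toLp,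
      ((hG2 j).sub (hG2 k)).eLpNorm_eq_integral_rpow_norm two_ne_zero (by norm_num),
      ENNReal.toReal_ofReal (by positivity), ENNReal.toReal_ofNat, ← Real.rpow_natCast,
      ← Real.rpow_mul (integral_nonneg fun x => by positivity), normSq_eq,
      inv_mul_cancel_left₀ (by positivity)]
    norm_num
    refine integral_congr_ae (Eventually.of_forall fun ξ => ?_)
    have e : 𝓕 (fun x => ((φ j x : ℂ) - (φ k x : ℂ))) ξ =
        𝓕 (fun x => (φ j x : ℂ)) ξ - 𝓕 (fun x => (φ k x : ℂ)) ξ := by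
      have e1 : (fun x => ((φ j x : ℂ) - (φ k x : ℂ))) = ((Φ j - Φ k : SchwartzMap (E n) ℂ)) := by
        ext x; simp [hΦ]
      rw [e1, ← SchwartzMap.fourier_coe, show 𝓕 (Φ j - Φ k) = 𝓕 (Φ j) - 𝓕 (Φ k) from
          map_sub (FourierTransform.fourierCLM ℂ (SchwartzMap (E n) ℂ)) _ _, sub_apply,
        hΦ', hΦ']
    simp only [hG, e, ← mul_sub, norm_mul, Complex.norm_real, mul_pow, Real.norm_eq_abs,
      sq_abs, hsq]
  have hcs : CauchySeq g := by
    rw [cauchySeq_iff_tendsto_dist_atTop_0]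
    have h1 := (hcauchy.const_mul ((2 * Real.pi) ^ (2 * m))⁻¹).sqrt
    rw [mul_zero, Real.sqrt_zero] at h1
    refine h1.congr fun q => ?_
    rw [← hdist, Real.sqrt_sq dist_nonneg]
  obtain ⟨γ, hγ⟩ := cauchySeq_tendsto_of_complete hcs
  have hγ2 : MemLp (γ : E n → ℂ) 2 := Lp.memLp γ
  have hGγ : Tendsto (fun k => eLpNorm (G k - (γ : E n → ℂ)) 2 volume) atTop (𝓝 0) := by
    have h1 := (Lp.tendsto_Lp_iff_tendsto_eLpNorm' g γ).1 hγ
    refine h1.congr fun k => eLpNorm_congr_ae ?_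
    filter_upwards [(hG2 k).coeFn_toLp] with x hx
    simp [hg, hx]
  -- Both sides are tested against smooth `ψ`. Pairings with the transforms of the test functions
  -- converge in two ways: in space by Hölder in the critical exponent, because `𝓕 Ψ` is Schwartz,
  -- and in frequency by the `L²` limit `γ`. The limits must agree.
  have hid : ∀ᵐ ξ, 𝓕 (fun x => (u x : ℂ)) ξ = ((‖ξ‖ ^ (-m) : ℝ) : ℂ) * γ ξ := by
    refine ae_eq_of_integral_contDiff_smul_eq
      (continuous_fourier (integrable_coe hu1)).locallyIntegrable
      (locallyIntegrable_rpow_neg_mul hmn hn hγ2) fun ψ hψ hψc => ?_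
    obtain ⟨Ψ, hΨ⟩ := exists_schwartz_eq hψ hψc
    have hψi : Integrable (fun x => (ψ x : ℂ)) := hΨ ▸ Ψ.integrable
    have hpair : ∀ w : E n → ℝ, Integrable w →
        ∫ ξ, ψ ξ • 𝓕 (fun x => (w x : ℂ)) ξ = ∫ x, (w x : ℂ) * (𝓕 Ψ) x := by
      intro w hw
      have h1 := integral_fourier_mul_eq (integrable_coe hw) hψi
      rw [← hΨ] at h1
      refine Eq.trans (integral_congr_ae (Eventually.of_forall fun ξ => ?_)) h1
      simp only [Complex.real_smul]
      ring
    have : Fact (1 ≤ ENNReal.ofReal p) := ⟨by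
      rw [← ENNReal.ofReal_one]; exact ENNReal.ofReal_le_ofReal (by linarith)⟩
    have hL : Tendsto (fun k => ∫ x, (φ k x : ℂ) * (𝓕 Ψ) x) atTop
        (𝓝 (∫ x, (u x : ℂ) * (𝓕 Ψ) x)) := by
      refine tendsto_integral_mul_of_tendsto_eLpNorm (p := ENNReal.ofReal p)
        (q := ENNReal.conjExponent (ENNReal.ofReal p)) (f := fun k x => (φ k x : ℂ))
        (fun k => memLp_coe ((hφ k).1.continuous.memLp_of_hasCompactSupport (hφ k).2))
        (memLp_coe hup) ((𝓕 Ψ).memLp _) ?_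
      refine hlim.congr fun k => ?_
      refine eLpNorm_congr_norm_ae (Eventually.of_forall fun x => ?_)
      simp only [Pi.sub_apply, ← Complex.ofReal_sub, Complex.norm_real]
    have hR := tendsto_integral_mul_of_tendsto_eLpNorm (p := 2) (q := 2) hG2 hγ2
      (memLp_rpow_neg_mul_test (m := m) hmn hn hψ.continuous hψc) hGγ
    have hmid : ∀ k, ∫ ξ, G k ξ * (((‖ξ‖ ^ (-m) : ℝ) : ℂ) * (ψ ξ : ℂ)) =
        ∫ x, (φ k x : ℂ) * (𝓕 Ψ) x := by
      intro k
      rw [← hpair _ (hφ1 k)]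
      refine integral_congr_ae ?_
      filter_upwards [Measure.ae_ne volume (0 : E n)] with ξ hξ
      have h0 : 0 < ‖ξ‖ := norm_pos_iff.2 hξ
      have h1 : ((‖ξ‖ ^ m : ℝ) : ℂ) * ((‖ξ‖ ^ (-m) : ℝ) : ℂ) = 1 := by
        rw [← Complex.ofReal_mul, ← Real.rpow_add h0, add_neg_cancel, Real.rpow_zero,
          Complex.ofReal_one]
      simp only [hG, Complex.real_smul]
      linear_combination (𝓕 (fun x => (φ k x : ℂ)) ξ * (ψ ξ : ℂ)) * h1
    rw [hpair u hu1]
    rw [funext hmid] at hR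
    rw [tendsto_nhds_unique hL hR]
    refine integral_congr_ae (Eventually.of_forall fun ξ => ?_)
    simp only [Complex.real_smul]
    ring
  rw [integrable_weighted_iff]
  refine (hγ2.integrable_norm_pow two_ne_zero).congr ?_
  filter_upwards [hid, Measure.ae_ne volume (0 : E n)] with ξ h1 h2
  have h0 : 0 < ‖ξ‖ := norm_pos_iff.2 h2
  rw [h1, norm_mul, mul_pow, Complex.norm_real, Real.norm_eq_abs, sq_abs, ← mul_assoc, ← hsq,
    ← mul_pow, ← Real.rpow_add h0]
  simp

/-- On bounded support the critical Lebesgue space embeds in `L²` and `L¹`, so the transform is an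
honest integral. From here on only finite energy is used in place of the completion. -/
theorem mem_HTilde_iff {Ω : Set (E n)} {m : ℝ} (hm : 0 < m) (hmn : m < (n : ℝ) / 2)
    (hΩ : Bornology.IsBounded Ω) {u : E n → ℝ} :
    u ∈ HTilde Ω m ↔ FiniteEnergy (closure Ω) m u := by
  refine ⟨fun hu => ?_, fun hu => hu.mem_HTilde hm hmn hΩ⟩
  have hp2 := critExp_gt_two hm hmn
  have h2 : MemLp u 2 := memLp_of_memLp_of_ae_zero hΩ.closure hu.1.1 hu.2 (by
    rw [← ENNReal.ofReal_ofNat 2]; exact ENNReal.ofReal_le_ofReal hp2.le)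
  have h1 : Integrable u := memLp_one_iff_integrable.1
    (memLp_of_memLp_of_ae_zero hΩ.closure h2 hu.2 (by norm_num))
  exact ⟨h2, hu.2, hu.1.integrable_energy hm hmn h1⟩

end Completion

end FracCritical

namespace FracCritical

variable {n : ℕ}

/-! ### Convergence lemmas for integrals with uniformly small tails -/

section Analysis

/-- If `f i → 0` almost everywhere and `f i ≤ δ g i + G` with `G` integrable and `∫ g i` bounded,
for every `δ > 0`, then the limit superior of `∫ f i` is nonpositive. -/
theorem eventually_integral_le_of_le_add {α ι : Type*} [MeasurableSpace α] {μ : Measure α}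
    {l : Filter ι} [l.IsCountablyGenerated] {f g : ι → α → ℝ} {M : ℝ}
    (hf : ∀ i, Integrable (f i) μ) (hg : ∀ i, Integrable (g i) μ) (hg0 : ∀ i x, 0 ≤ g i x)
    (hM : ∀ i, ∫ x, g i x ∂μ ≤ M) (hlim : ∀ᵐ x ∂μ, Tendsto (fun i => f i x) l (𝓝 0))
    (hdom : ∀ δ : ℝ, 0 < δ → ∃ G : α → ℝ, Integrable G μ ∧
      ∀ i, ∀ᵐ x ∂μ, f i x ≤ δ * g i x + G x) {ε : ℝ} (hε : 0 < ε) :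
    ∀ᶠ i in l, ∫ x, f i x ∂μ ≤ ε := by
  set δ : ℝ := ε / (2 * (|M| + 1)) with hδ
  have hδ0 : 0 < δ := by positivity
  obtain ⟨G, hG, hfG⟩ := hdom δ hδ0
  -- The positive part of `f i - δ g i` is dominated by `|G|`, so its integral tends to `0`; what
  -- remains is at most `δ ∫ g i ≤ ε/2`.
  have hpos : ∀ i, Integrable (fun x => max (f i x - δ * g i x) 0) μ := fun i =>
    ((hf i).sub ((hg i).const_mul δ)).pos_part
  have h1 : Tendsto (fun i => ∫ x, max (f i x - δ * g i x) 0 ∂μ) l (𝓝 0) := by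
    rw [show 𝓝 (0 : ℝ) = 𝓝 (∫ _ : α, (0 : ℝ) ∂μ) by simp]
    refine tendsto_integral_filter_of_dominated_convergence (fun x => |G x|)
      (Eventually.of_forall fun i => (hpos i).1) (Eventually.of_forall fun i => ?_) hG.abs ?_
    · filter_upwards [hfG i] with x hx
      rw [Real.norm_of_nonneg (le_max_right _ _)]
      exact max_le (by linarith [le_abs_self (G x)]) (abs_nonneg _)
    · filter_upwards [hlim] with x hx
      refine squeeze_zero (fun i => le_max_right _ _) (fun i => ?_) (by simpa using hx.abs)
      refine max_le ?_ (abs_nonneg _)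
      have := mul_nonneg hδ0.le (hg0 i x)
      linarith [le_abs_self (f i x)]
  filter_upwards [h1.eventually (gt_mem_nhds (half_pos hε))] with i hi
  have h2 : ∫ x, f i x ∂μ ≤ ∫ x, (δ * g i x + max (f i x - δ * g i x) 0) ∂μ := by
    refine integral_mono (hf i) (((hg i).const_mul δ).add (hpos i)) fun x => ?_
    simp only
    linarith [le_max_left (f i x - δ * g i x) 0]
  rw [integral_add ((hg i).const_mul δ) (hpos i), integral_const_mul] at h2
  have h3 : δ * ∫ x, g i x ∂μ ≤ δ * (|M| + 1) :=
    mul_le_mul_of_nonneg_left ((hM i).trans (by linarith [le_abs_self M])) hδ0.le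
  have h4 : δ * (|M| + 1) = ε / 2 := by rw [hδ]; field_simp
  linarith

theorem tendsto_integral_zero_of_le_add {α ι : Type*} [MeasurableSpace α] {μ : Measure α}
    {l : Filter ι} [l.IsCountablyGenerated] {f g : ι → α → ℝ} {M : ℝ}
    (hf : ∀ i, Integrable (f i) μ) (hf0 : ∀ i x, 0 ≤ f i x)
    (hg : ∀ i, Integrable (g i) μ) (hg0 : ∀ i x, 0 ≤ g i x)
    (hM : ∀ i, ∫ x, g i x ∂μ ≤ M) (hlim : ∀ᵐ x ∂μ, Tendsto (fun i => f i x) l (𝓝 0))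
    (hdom : ∀ δ : ℝ, 0 < δ → ∃ G : α → ℝ, Integrable G μ ∧
      ∀ i, ∀ᵐ x ∂μ, f i x ≤ δ * g i x + G x) :
    Tendsto (fun i => ∫ x, f i x ∂μ) l (𝓝 0) := by
  rw [Metric.tendsto_nhds]
  intro ε hε
  filter_upwards [eventually_integral_le_of_le_add hf hg hg0 hM hlim hdom (half_pos hε)] with i hi
  rw [Real.dist_eq, sub_zero, abs_of_nonneg (integral_nonneg (hf0 i))]
  linarith

theorem exists_add_rpow_le {p δ : ℝ} (hp : 1 < p) (hδ : 0 < δ) :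
    ∃ C : ℝ, 0 ≤ C ∧ ∀ x y : ℝ, 0 ≤ x → 0 ≤ y →
      (x + y) ^ p ≤ (1 + δ) * y ^ p + C * x ^ p := by
  -- Write `x + y = (1-τ)·x/(1-τ) + τ·y/τ` and use the convexity of the power `p`. The coefficient
  -- of `y^p` is `τ^(1-p)`, and this `τ` makes it `1 + δ`.
  set τ : ℝ := (1 + δ) ^ (-(1 / (p - 1))) with hτ
  have hp1 : 0 < p - 1 := by linarith
  have hτ0 : 0 < τ := by positivity
  have hτ1 : τ < 1 := by
    refine Real.rpow_lt_one_of_one_lt_of_neg (by linarith) ?_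
    rw [neg_lt_zero]; positivity
  have h1τ : 0 < 1 - τ := by linarith
  have hτp : τ * (τ⁻¹) ^ p = 1 + δ := by
    have : (τ⁻¹) ^ p = τ ^ (-p) := by rw [Real.rpow_neg hτ0.le, Real.inv_rpow hτ0.le]
    rw [this]
    nth_rewrite 1 [← Real.rpow_one τ]
    rw [← Real.rpow_add hτ0, hτ, ← Real.rpow_mul (by linarith)]
    have : -(1 / (p - 1)) * (1 + -p) = 1 := by field_simp; ring
    rw [this, Real.rpow_one]
  refine ⟨(1 - τ) * ((1 - τ)⁻¹) ^ p, by positivity, fun x y hx hy => ?_⟩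
  have h := (convexOn_rpow hp.le).2 
    (Set.mem_Ici.2 (show 0 ≤ (1 - τ)⁻¹ * x by positivity))
    (Set.mem_Ici.2 (show 0 ≤ τ⁻¹ * y by positivity)) h1τ.le hτ0.le (by ring)
  simp only [smul_eq_mul] at h
  rw [mul_inv_cancel_left₀ h1τ.ne', mul_inv_cancel_left₀ hτ0.ne',
    Real.mul_rpow (by positivity) hx, Real.mul_rpow (by positivity) hy, ← mul_assoc, ← mul_assoc,
    hτp] at h
  linarith

/-- Energies of lower order tend to zero along bounded sequences with pointwise convergence of the
Fourier transforms. -/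
theorem tendsto_integral_weighted_zero {ι : Type*} {l : Filter ι} [l.IsCountablyGenerated]
    {a m A M : ℝ} (ha : 0 ≤ a) (ham : a < m) {h : ι → E n → ℂ}
    (hint : ∀ i, Integrable (fun ξ => ‖ξ‖ ^ (2 * a) * ‖h i ξ‖ ^ 2))
    (hintm : ∀ i, Integrable (fun ξ => ‖ξ‖ ^ (2 * m) * ‖h i ξ‖ ^ 2))
    (hA : ∀ i ξ, ‖h i ξ‖ ≤ A) (hM : ∀ i, ∫ ξ, ‖ξ‖ ^ (2 * m) * ‖h i ξ‖ ^ 2 ≤ M)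
    (hlim : ∀ ξ, Tendsto (fun i => h i ξ) l (𝓝 0)) :
    Tendsto (fun i => ∫ ξ, ‖ξ‖ ^ (2 * a) * ‖h i ξ‖ ^ 2) l (𝓝 0) := by
  refine tendsto_integral_zero_of_le_add hint (fun i x => by positivity) hintm
    (fun i x => by positivity) hM (Eventually.of_forall fun ξ => ?_) fun δ hδ => ?_
  · simpa using (((hlim ξ).norm.pow 2).const_mul (‖ξ‖ ^ (2 * a)))
  · have hma : 0 < 2 * (m - a) := by linarith
    -- Beyond this radius `|ξ|^(2a) ≤ δ |ξ|^(2m)`; inside it the sup bound `A` gives an integrable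
    -- constant.
    set R : ℝ := (δ⁻¹) ^ (1 / (2 * (m - a))) with hR
    have hR0 : 0 < R := by positivity
    refine ⟨(Metric.closedBall (0 : E n) R).indicator fun _ => R ^ (2 * a) * A ^ 2, ?_,
      fun i => Eventually.of_forall fun ξ => ?_⟩
    · rw [integrable_indicator_iff measurableSet_closedBall]
      exact integrableOn_const (measure_closedBall_lt_top.ne)
    · by_cases hξ : ‖ξ‖ ≤ R
      · rw [Set.indicator_of_mem (by simpa using hξ)]
        have h1 : ‖ξ‖ ^ (2 * a) ≤ R ^ (2 * a) :=
          Real.rpow_le_rpow (norm_nonneg _) hξ (by linarith)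
        have h2 : ‖h i ξ‖ ^ 2 ≤ A ^ 2 := pow_le_pow_left₀ (norm_nonneg _) (hA i ξ) 2
        have h3 : ‖ξ‖ ^ (2 * a) * ‖h i ξ‖ ^ 2 ≤ R ^ (2 * a) * A ^ 2 :=
          mul_le_mul h1 h2 (by positivity) (by positivity)
        have h4 : 0 ≤ δ * (‖ξ‖ ^ (2 * m) * ‖h i ξ‖ ^ 2) := by positivity
        linarith
      · rw [Set.indicator_of_notMem (by simpa using hξ), add_zero, ← mul_assoc]
        refine mul_le_mul_of_nonneg_right ?_ (by positivity)
        have h0 : R < ‖ξ‖ := not_le.1 hξ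
        have hξ0 : 0 < ‖ξ‖ := hR0.trans h0
        have h1 : R ^ (2 * (m - a)) ≤ ‖ξ‖ ^ (2 * (m - a)) :=
          Real.rpow_le_rpow hR0.le h0.le hma.le
        rw [hR, ← Real.rpow_mul (by positivity), one_div_mul_cancel hma.ne', Real.rpow_one,
          inv_le_iff_one_le_mul₀' hδ] at h1
        have h2 : ‖ξ‖ ^ (2 * m) = ‖ξ‖ ^ (2 * (m - a)) * ‖ξ‖ ^ (2 * a) := by
          rw [← Real.rpow_add hξ0]; congr 1; ring
        rw [h2, ← mul_assoc]
        exact le_mul_of_one_le_left (by positivity) h1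

end Analysis

/-! ### Uniform bounds from the energy, on functions and their transforms -/

section Compactness

variable {K : Set (E n)} {m : ℝ}

theorem FiniteEnergy.memLp_crit (hm : 0 < m) (hmn : m < (n : ℝ) / 2)
    (hK : Bornology.IsBounded K) {u : E n → ℝ} (hu : FiniteEnergy K m u) :
    MemLp u (ENNReal.ofReal (critExp n m)) := by
  obtain ⟨c, hc, hS⟩ := exists_sobolev hm hmn
  exact (hS u (hu.integrable hK) hu.memLp hu.integrable_energy).1

theorem integrable_rpow_critExp (hm : 0 < m) (hmn : m < (n : ℝ) / 2) {u : E n → ℝ}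
    (hu : MemLp u (ENNReal.ofReal (critExp n m))) :
    Integrable (fun x => |u x| ^ critExp n m) := by
  have hp2 := critExp_gt_two hm hmn
  have := hu.integrable_norm_rpow (by simp; linarith) ENNReal.ofReal_ne_top
  rwa [ENNReal.toReal_ofReal (by linarith)] at this

theorem integral_rpow_critExp_eq (hm : 0 < m) (hmn : m < (n : ℝ) / 2) (u : E n → ℝ) :
    ∫ x, |u x| ^ critExp n m = critSq m u ^ (critExp n m / 2) := by
  have hp2 := critExp_gt_two hm hmn
  unfold critSq
  rw [← Real.rpow_mul (integral_nonneg fun x => by positivity)]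
  have : 2 / critExp n m * (critExp n m / 2) = 1 := by
    have : critExp n m ≠ 0 := by linarith
    field_simp
  rw [this, Real.rpow_one]

theorem exists_integral_rpow_bound (hm : 0 < m) (hmn : m < (n : ℝ) / 2)
    (hK : Bornology.IsBounded K) (M : ℝ) :
    ∃ L : ℝ, ∀ u : E n → ℝ, FiniteEnergy K m u → normSq m u ≤ M →
      ∫ x, |u x| ^ critExp n m ≤ L := by
  obtain ⟨c, hc, hS⟩ := exists_sobolev hm hmn
  have hp2 := critExp_gt_two hm hmn
  refine ⟨(M / c) ^ (critExp n m / 2), fun u hu huM => ?_⟩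
  have h1 := (hS u (hu.integrable hK) hu.memLp hu.integrable_energy).2
  rw [integral_rpow_critExp_eq hm hmn]
  refine Real.rpow_le_rpow (critSq_nonneg _ _) ?_ (by linarith)
  rw [le_div_iff₀ hc]
  linarith

theorem exists_integral_abs_bound (hm : 0 < m) (hmn : m < (n : ℝ) / 2)
    (hK : Bornology.IsBounded K) (M : ℝ) :
    ∃ L : ℝ, ∀ u : E n → ℝ, FiniteEnergy K m u → normSq m u ≤ M → ∫ x, |u x| ≤ L := by
  obtain ⟨L, hL⟩ := exists_integral_rpow_bound hm hmn hK M
  obtain ⟨R, hR⟩ := hK.subset_closedBall 0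
  have hp2 := critExp_gt_two hm hmn
  have hB : Integrable ((Metric.closedBall (0 : E n) R).indicator fun _ => (1 : ℝ)) := by
    rw [integrable_indicator_iff measurableSet_closedBall]
    exact integrableOn_const (measure_closedBall_lt_top.ne)
  refine ⟨(∫ x, (Metric.closedBall (0 : E n) R).indicator (fun _ => (1 : ℝ)) x) + L,
    fun u hu huM => ?_⟩
  have hi := integrable_rpow_critExp hm hmn (hu.memLp_crit hm hmn hK)
  -- Pointwise `|u| ≤ 1 + |u|^p` on the support, which lies in a fixed ball.
  have h1 : ∫ x, |u x| ≤ ∫ x, ((Metric.closedBall (0 : E n) R).indicator (fun _ => (1 : ℝ)) x +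
      |u x| ^ critExp n m) := by
    refine integral_mono_ae (hu.integrable hK).abs (hB.add hi) ?_
    filter_upwards [hu.ae_zero] with x hx
    have h0 : 0 ≤ |u x| ^ critExp n m := by positivity
    by_cases hxK : x ∈ K
    · rw [Set.indicator_of_mem (hR hxK)]
      rcases le_total |u x| 1 with h | h
      · linarith
      · have := Real.rpow_le_rpow_of_exponent_le h (show (1 : ℝ) ≤ critExp n m by linarith)
        rw [Real.rpow_one] at this
        linarith
    · rw [hx hxK, abs_zero]
      exact add_nonneg (Set.indicator_nonneg (fun _ _ => zero_le_one) _) (by positivity)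
  rw [integral_add hB hi] at h1
  linarith [hL u hu huM]

/-- The two exponentials differ by at most `|ξ - η||x|`, and `|x| ≤ R` where `u` does not vanish. -/
theorem norm_fourierU_sub_le {R : ℝ} {u : E n → ℝ} (hu : Integrable u)
    (h0 : ∀ᵐ x, x ∉ Metric.closedBall (0 : E n) R → u x = 0) (ξ η : E n) :
    ‖fourierU u ξ - fourierU u η‖ ≤
      (2 * Real.pi) ^ (-((n : ℝ) / 2)) * (‖ξ - η‖ * R * ∫ x, |u x|) := by
  have hint : ∀ ζ : E n, Integrable (fun x : E n =>
      Complex.exp (-Complex.I * ((inner ℝ ζ x : ℝ) : ℂ)) * (u x : ℂ)) := fun ζ => by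
    refine (integrable_coe hu).bdd_mul (c := 1) ?_ (Eventually.of_forall fun x => ?_)
    · exact (Continuous.aestronglyMeasurable (by fun_prop))
    · rw [Complex.norm_exp]; simp
  rw [fourierU_eq, fourierU_eq, ← mul_sub, norm_mul, Complex.norm_real,
    Real.norm_of_nonneg (by positivity), ← integral_sub (hint ξ) (hint η)]
  refine mul_le_mul_of_nonneg_left ?_ (by positivity)
  rw [← integral_const_mul]
  refine norm_integral_le_of_norm_le (hu.abs.const_mul _) ?_
  filter_upwards [h0] with x hx
  rw [← sub_mul, norm_mul, Complex.norm_real, Real.norm_eq_abs]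
  by_cases hxR : x ∈ Metric.closedBall (0 : E n) R
  · refine mul_le_mul_of_nonneg_right ?_ (abs_nonneg _)
    have e : Complex.exp (-Complex.I * ((inner ℝ ξ x : ℝ) : ℂ)) -
        Complex.exp (-Complex.I * ((inner ℝ η x : ℝ) : ℂ)) =
        Complex.exp (-Complex.I * ((inner ℝ η x : ℝ) : ℂ)) *
          (Complex.exp (Complex.I * ((-inner ℝ (ξ - η) x : ℝ) : ℂ)) - 1) := by
      rw [mul_sub, ← Complex.exp_add, mul_one, inner_sub_left]
      congr 2
      push_cast; ring
    rw [e, norm_mul, Complex.norm_exp]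
    simp only [Complex.neg_re, Complex.mul_re, Complex.I_re, Complex.I_im, Complex.ofReal_im,
      Complex.ofReal_re, zero_mul, mul_zero, sub_zero, neg_mul, neg_zero, Real.exp_zero, one_mul]
    refine (Real.norm_exp_I_mul_ofReal_sub_one_le).trans ?_
    rw [norm_neg]
    refine (norm_inner_le_norm _ _).trans ?_
    exact mul_le_mul_of_nonneg_left (by simpa using hxR) (norm_nonneg _)
  · rw [hx hxR]; simp

end Compactness

end FracCritical

namespace FracCritical

variable {n : ℕ}

/-! ### Weak convergence and compactness in the energy space -/

section Compactness

variable {K : Set (E n)} {m : ℝ}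

theorem normSq_add_normSq_sub (hK : Bornology.IsBounded K) (hm : 0 ≤ m) {u v : E n → ℝ}
    (hu : FiniteEnergy K m u) (hv : FiniteEnergy K m v) :
    normSq m (u + v) + normSq m (u - v) = 2 * normSq m u + 2 * normSq m v := by
  have h1 := normSq_add_smul hK hu hv hm le_rfl 1
  have h2 := normSq_add_smul hK hu hv hm le_rfl (-1)
  have e1 : u + (1 : ℝ) • v = u + v := by rw [one_smul]
  have e2 : u + (-1 : ℝ) • v = u - v := by rw [neg_one_smul, sub_eq_add_neg]
  rw [e1] at h1
  rw [e2] at h2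
  rw [h1, h2]; ring

theorem normSq_sub_le (hK : Bornology.IsBounded K) (hm : 0 ≤ m) {u v : E n → ℝ}
    (hu : FiniteEnergy K m u) (hv : FiniteEnergy K m v) :
    normSq m (u - v) ≤ 2 * normSq m u + 2 * normSq m v := by
  linarith [normSq_add_normSq_sub hK hm hu hv, normSq_nonneg m (u + v)]

theorem exists_norm_fourierU_bound (hm : 0 < m) (hmn : m < (n : ℝ) / 2)
    (hK : Bornology.IsBounded K) (M : ℝ) :
    ∃ A : ℝ, ∀ u : E n → ℝ, FiniteEnergy K m u → normSq m u ≤ M → ∀ ξ, ‖fourierU u ξ‖ ≤ A := by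
  obtain ⟨L, hL⟩ := exists_integral_abs_bound hm hmn hK M
  exact ⟨(2 * Real.pi) ^ (-((n : ℝ) / 2)) * L, fun u hu huM ξ => (norm_fourierU_le ξ).trans
    (mul_le_mul_of_nonneg_left (hL u hu huM) (by positivity))⟩

theorem exists_lipschitz_fourierU (hm : 0 < m) (hmn : m < (n : ℝ) / 2)
    (hK : Bornology.IsBounded K) (M : ℝ) :
    ∃ Λ : ℝ, 0 < Λ ∧ ∀ u : E n → ℝ, FiniteEnergy K m u → normSq m u ≤ M →
      ∀ ξ η, ‖fourierU u ξ - fourierU u η‖ ≤ Λ * ‖ξ - η‖ := by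
  obtain ⟨L, hL⟩ := exists_integral_abs_bound hm hmn hK M
  obtain ⟨R, hR⟩ := hK.subset_closedBall 0
  refine ⟨(2 * Real.pi) ^ (-((n : ℝ) / 2)) * (|R| * |L|) + 1, by positivity,
    fun u hu huM ξ η => ?_⟩
  have h0 : ∀ᵐ x, x ∉ Metric.closedBall (0 : E n) |R| → u x = 0 := by
    filter_upwards [hu.ae_zero] with x hx hxR
    exact hx fun h => hxR (Metric.closedBall_subset_closedBall (le_abs_self R) (hR h))
  refine (norm_fourierU_sub_le (hu.integrable hK) h0 ξ η).trans ?_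
  have h1 : ∫ x, |u x| ≤ |L| := (hL u hu huM).trans (le_abs_self L)
  have h2 : ‖ξ - η‖ * |R| * ∫ x, |u x| ≤ ‖ξ - η‖ * |R| * |L| :=
    mul_le_mul_of_nonneg_left h1 (by positivity)
  have h3 := mul_le_mul_of_nonneg_left h2
    (show 0 ≤ (2 * Real.pi) ^ (-((n : ℝ) / 2)) by positivity)
  linarith [norm_nonneg (ξ - η)]

/-- An Arzelà–Ascoli argument: a bounded sequence of values on a countable dense set lies in a
compact product, and the common Lipschitz constant carries convergence from the dense set to every
frequency. -/
theorem exists_subseq_fourierU_tendsto (hm : 0 < m) (hmn : m < (n : ℝ) / 2)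
    (hK : Bornology.IsBounded K) {w : ℕ → E n → ℝ} {M : ℝ} (hw : ∀ k, FiniteEnergy K m (w k))
    (hM : ∀ k, normSq m (w k) ≤ M) :
    ∃ σ : ℕ → ℕ, StrictMono σ ∧ ∃ F : E n → ℂ,
      ∀ ξ, Tendsto (fun k => fourierU (w (σ k)) ξ) atTop (𝓝 (F ξ)) := by
  obtain ⟨A, hA⟩ := exists_norm_fourierU_bound hm hmn hK M
  obtain ⟨Λ, hΛ, hLip⟩ := exists_lipschitz_fourierU hm hmn hK M
  set D := TopologicalSpace.denseSeq (E n)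
  have hcomp : IsCompact (Set.pi Set.univ fun _ : ℕ => Metric.closedBall (0 : ℂ) A) :=
    isCompact_univ_pi fun _ => isCompact_closedBall 0 A
  obtain ⟨b, -, σ, hσ, hb⟩ := hcomp.tendsto_subseq
    (x := fun k j => fourierU (w k) (D j))
    (fun k j _ => by simpa using hA _ (hw k) (hM k) (D j))
  rw [tendsto_pi_nhds] at hb
  refine ⟨σ, hσ, ?_⟩
  have : ∀ ξ, ∃ z : ℂ, Tendsto (fun k => fourierU (w (σ k)) ξ) atTop (𝓝 z) := by
    intro ξ
    refine cauchySeq_tendsto_of_complete (Metric.cauchySeq_iff.2 fun ε hε => ?_)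
    obtain ⟨j, hj⟩ := (TopologicalSpace.denseRange_denseSeq (E n)).exists_dist_lt ξ
      (show 0 < ε / (4 * Λ) by positivity)
    obtain ⟨N, hN⟩ := Metric.cauchySeq_iff.1 (hb j).cauchySeq (ε / 2) (by positivity)
    refine ⟨N, fun k hk l hl => ?_⟩
    have h1 := hN k hk l hl
    have h2 := hLip _ (hw (σ k)) (hM _) ξ (D j)
    have h3 := hLip _ (hw (σ l)) (hM _) ξ (D j)
    rw [dist_eq_norm] at hj
    have h4 : Λ * ‖ξ - D j‖ < ε / 4 := by
      calc Λ * ‖ξ - D j‖ < Λ * (ε / (4 * Λ)) := mul_lt_mul_of_pos_left hj hΛ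
        _ = ε / 4 := by field_simp
    simp only [Function.comp_apply, dist_eq_norm] at h1
    rw [dist_eq_norm]
    have e : fourierU (w (σ k)) ξ - fourierU (w (σ l)) ξ =
      (fourierU (w (σ k)) ξ - fourierU (w (σ k)) (D j)) +
      (fourierU (w (σ k)) (D j) - fourierU (w (σ l)) (D j)) -
      (fourierU (w (σ l)) ξ - fourierU (w (σ l)) (D j)) := by ring
    rw [e]
    refine (norm_sub_le _ _).trans_lt ?_
    have h5 := norm_add_le (fourierU (w (σ k)) ξ - fourierU (w (σ k)) (D j))
      (fourierU (w (σ k)) (D j) - fourierU (w (σ l)) (D j))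
    linarith
  choose F hF using this
  exact ⟨F, hF⟩

/-- Weak convergence in the energy space, in the form in which it is used: convergence almost
everywhere and of the Fourier transforms at each point, with bounded energies. -/
structure EnergyConverges (K : Set (E n)) (m : ℝ) (w : ℕ → E n → ℝ) (u : E n → ℝ) : Prop where
  seq : ∀ k, FiniteEnergy K m (w k)
  lim : FiniteEnergy K m u
  bounded : ∃ M, ∀ k, normSq m (w k) ≤ M
  ae_tendsto : ∀ᵐ x, Tendsto (fun k => w k x) atTop (𝓝 (u x))
  fourier_tendsto : ∀ ξ, Tendsto (fun k => fourierU (w k) ξ) atTop (𝓝 (fourierU u ξ))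

theorem dist_toLp_sq {u v : E n → ℝ} (hu1 : Integrable u) (hv1 : Integrable v)
    (hu : MemLp u 2) (hv : MemLp v 2) :
    dist (hu.toLp u) (hv.toLp v) ^ 2 = ∫ ξ, ‖fourierU (u - v) ξ‖ ^ 2 := by
  rw [integral_sq_fourierU (hu1.sub hv1) (hu.sub hv), dist_eq_norm, ← MemLp.toLp_sub,
    Lp.norm_toLp, (hu.sub hv).eLpNorm_eq_integral_rpow_norm two_ne_zero (by norm_num),
    ENNReal.toReal_ofReal (by positivity), ENNReal.toReal_ofNat, ← Real.rpow_natCast,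
    ← Real.rpow_mul (integral_nonneg fun x => by positivity)]
  norm_num

theorem fourierU_tendsto_of_eLpNorm {R : ℝ} {w : ℕ → E n → ℝ} {u : E n → ℝ}
    (hw : ∀ k, MemLp (w k) 2) (hu : MemLp u 2)
    (hw0 : ∀ k, ∀ᵐ x, x ∉ Metric.closedBall (0 : E n) R → w k x = 0)
    (hu0 : ∀ᵐ x, x ∉ Metric.closedBall (0 : E n) R → u x = 0)
    (hlim : Tendsto (fun k => eLpNorm (w k - u) 2 volume) atTop (𝓝 0)) (ξ : E n) :
    Tendsto (fun k => fourierU (w k) ξ) atTop (𝓝 (fourierU u ξ)) := by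
  set B := Metric.closedBall (0 : E n) R
  set e : E n → ℂ := fun x => Complex.exp (-Complex.I * ((inner ℝ ξ x : ℝ) : ℂ)) with he
  have he1 : ∀ x, ‖e x‖ = 1 := fun x => by rw [he, Complex.norm_exp]; simp
  have hec : Continuous e := by fun_prop
  have heB : MemLp (B.indicator e) 2 := by
    rw [memLp_indicator_iff_restrict measurableSet_closedBall]
    have : IsFiniteMeasure ((volume : Measure (E n)).restrict B) :=
      ⟨by simpa using measure_closedBall_lt_top⟩
    exact MemLp.of_bound hec.aestronglyMeasurable 1 (Eventually.of_forall fun x => (he1 x).le)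
  have key : ∀ v : E n → ℝ, (∀ᵐ x, x ∉ B → v x = 0) → fourierU v ξ =
      (((2 * Real.pi) ^ (-((n : ℝ) / 2)) : ℝ) : ℂ) * ∫ x, (v x : ℂ) * B.indicator e x := by
    intro v hv
    rw [fourierU_eq]
    congr 1
    refine integral_congr_ae ?_
    filter_upwards [hv] with x hx
    by_cases h : x ∈ B
    · rw [Set.indicator_of_mem h, mul_comm]
    · rw [hx h]; simp
  simp_rw [key _ (hw0 _), key u hu0]
  refine Tendsto.const_mul _ ?_
  refine tendsto_integral_mul_of_tendsto_eLpNorm (p := 2) (q := 2) (f := fun k x => (w k x : ℂ))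
    (fun k => memLp_coe (hw k)) (memLp_coe hu) heB ?_
  refine hlim.congr fun k => eLpNorm_congr_norm_ae (Eventually.of_forall fun x => ?_)
  simp only [Pi.sub_apply, ← Complex.ofReal_sub, Complex.norm_real]

/-- Fatou's lemma on the frequency side. -/
theorem integrable_energy_of_tendsto (hK : Bornology.IsBounded K) {w : ℕ → E n → ℝ} {u : E n → ℝ}
    {M : ℝ} (hw : ∀ k, FiniteEnergy K m (w k)) (hM : ∀ k, normSq m (w k) ≤ M)
    (hu : Integrable u)
    (hlim : ∀ ξ, Tendsto (fun k => fourierU (w k) ξ) atTop (𝓝 (fourierU u ξ))) :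
    Integrable (fun ξ => ‖ξ‖ ^ (2 * m) * ‖fourierU u ξ‖ ^ 2) := by
  have hmeas : ∀ v : E n → ℝ, Integrable v →
      Measurable (fun ξ => ‖ξ‖ ^ (2 * m) * ‖fourierU v ξ‖ ^ 2) := fun v hv =>
    (measurable_norm.pow_const _).mul ((continuous_fourierU hv).measurable.norm.pow_const 2)
  refine ⟨(hmeas u hu).aestronglyMeasurable, ?_⟩
  rw [hasFiniteIntegral_iff_ofReal (Eventually.of_forall fun x => by positivity)]
  have h1 : ∀ ξ, ENNReal.ofReal (‖ξ‖ ^ (2 * m) * ‖fourierU u ξ‖ ^ 2) =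
      liminf (fun k => ENNReal.ofReal (‖ξ‖ ^ (2 * m) * ‖fourierU (w k) ξ‖ ^ 2)) atTop := by
    intro ξ
    refine (Tendsto.liminf_eq ?_).symm
    exact ENNReal.tendsto_ofReal ((((hlim ξ).norm).pow 2).const_mul _)
  rw [lintegral_congr h1]
  refine (lintegral_liminf_le fun k =>
    (hmeas _ ((hw k).integrable hK)).ennreal_ofReal).trans_lt ?_
  refine lt_of_le_of_lt ?_ (ENNReal.ofReal_lt_top (r := M))
  refine liminf_le_of_frequently_le' (Frequently.of_forall fun k => ?_)
  rw [← ofReal_integral_eq_lintegral_ofReal (hw k).integrable_energy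
    (Eventually.of_forall fun x => by positivity)]
  exact ENNReal.ofReal_le_ofReal (hM k)

/-- Bounded sequences in the energy space have convergent subsequences. -/
theorem exists_subseq_energyConverges (hm : 0 < m) (hmn : m < (n : ℝ) / 2)
    (hK : Bornology.IsBounded K) {w : ℕ → E n → ℝ} {M : ℝ} (hw : ∀ k, FiniteEnergy K m (w k))
    (hM : ∀ k, normSq m (w k) ≤ M) :
    ∃ σ : ℕ → ℕ, StrictMono σ ∧ ∃ u, EnergyConverges K m (w ∘ σ) u := by
  obtain ⟨σ, hσ, F, hF⟩ := exists_subseq_fourierU_tendsto hm hmn hK hw hM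
  obtain ⟨R, hR⟩ := hK.subset_closedBall 0
  have hdiff : ∀ q : ℕ × ℕ, FiniteEnergy K m (w (σ q.1) - w (σ q.2)) := fun q =>
    (hw _).sub hK (hw _)
  have hdM : ∀ q : ℕ × ℕ, normSq m (w (σ q.1) - w (σ q.2)) ≤ 4 * M := fun q => by
    linarith [normSq_sub_le hK hm.le (hw (σ q.1)) (hw (σ q.2)), hM (σ q.1), hM (σ q.2)]
  obtain ⟨A, hA⟩ := exists_norm_fourierU_bound hm hmn hK (4 * M)
  -- The energy of order `0` of the differences tends to `0`, so by Plancherel the subsequence is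
  -- Cauchy in `L²`.
  have hL2 : Tendsto (fun q : ℕ × ℕ => ∫ ξ, ‖fourierU (w (σ q.1) - w (σ q.2)) ξ‖ ^ 2) atTop
      (𝓝 0) := by
    have h := tendsto_integral_weighted_zero (l := (atTop : Filter (ℕ × ℕ))) (a := 0) le_rfl hm
      (h := fun q : ℕ × ℕ => fourierU (w (σ q.1) - w (σ q.2)))
      (fun q => (hdiff q).integrable_weighted hK le_rfl hm.le)
      (fun q => (hdiff q).integrable_energy) (fun q => hA _ (hdiff q) (hdM q)) hdM
      (fun ξ => by
        simp_rw [fourierU_sub ((hw _).integrable hK) ((hw _).integrable hK), Pi.sub_apply]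
        rw [← prod_atTop_atTop_eq]
        have := ((hF ξ).comp (tendsto_fst (g := (atTop : Filter ℕ)))).sub
          ((hF ξ).comp (tendsto_snd (f := (atTop : Filter ℕ))))
        rw [sub_self] at this
        exact this)
    simpa using h
  set g : ℕ → Lp ℝ 2 (volume : Measure (E n)) := fun k => (hw (σ k)).memLp.toLp _ with hg
  have hcs : CauchySeq g := by
    rw [cauchySeq_iff_tendsto_dist_atTop_0]
    have h1 := hL2.sqrt
    rw [Real.sqrt_zero] at h1
    refine h1.congr fun q => ?_
    rw [← dist_toLp_sq ((hw _).integrable hK) ((hw _).integrable hK) (hw _).memLp (hw _).memLp,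
      Real.sqrt_sq dist_nonneg]
  obtain ⟨γ, hγ⟩ := cauchySeq_tendsto_of_complete hcs
  have hγ2 : MemLp (γ : E n → ℝ) 2 := Lp.memLp γ
  have hGγ : Tendsto (fun k => eLpNorm (w (σ k) - (γ : E n → ℝ)) 2 volume) atTop (𝓝 0) := by
    have h1 := (Lp.tendsto_Lp_iff_tendsto_eLpNorm' g γ).1 hγ
    refine h1.congr fun k => eLpNorm_congr_ae ?_
    filter_upwards [(hw (σ k)).memLp.coeFn_toLp] with x hx
    simp [hg, hx]
  -- A second extraction gives almost everywhere convergence. Since the supports lie in a ball,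
  -- convergence in `L²` identifies the limit of the transforms with the transform of `γ`.
  obtain ⟨τ, hτ, hae⟩ := (tendstoInMeasure_of_tendsto_eLpNorm two_ne_zero
    (fun k => (hw (σ k)).memLp.1) hγ2.1 hGγ).exists_seq_tendsto_ae
  have h0 : ∀ᵐ x, x ∉ K → (γ : E n → ℝ) x = 0 := by
    have hall : ∀ᵐ x, ∀ k, x ∉ K → w (σ k) x = 0 := ae_all_iff.2 fun k => (hw (σ k)).ae_zero
    filter_upwards [hae, hall] with x h1 h2 hx
    refine tendsto_nhds_unique h1 ?_
    simp_rw [h2 _ hx]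
    exact tendsto_const_nhds
  have hR0 : ∀ v : E n → ℝ, (∀ᵐ x, x ∉ K → v x = 0) →
      ∀ᵐ x, x ∉ Metric.closedBall (0 : E n) R → v x = 0 := fun v hv => by
    filter_upwards [hv] with x hx hxR
    exact hx fun h => hxR (hR h)
  have hγ1 : Integrable (γ : E n → ℝ) :=
    memLp_one_iff_integrable.1 (memLp_of_memLp_of_ae_zero hK hγ2 h0 (by norm_num))
  have hft := fourierU_tendsto_of_eLpNorm (fun k => (hw (σ k)).memLp) hγ2
    (fun k => hR0 _ (hw (σ k)).ae_zero) (hR0 _ h0) hGγ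
  refine ⟨σ ∘ τ, hσ.comp hτ, γ, ⟨fun k => hw _, ⟨hγ2, h0, ?_⟩, ⟨M, fun k => hM _⟩, hae,
    fun ξ => (hft ξ).comp hτ.tendsto_atTop⟩⟩
  exact integrable_energy_of_tendsto hK (fun k => hw (σ k)) (fun k => hM _) hγ1 hft

namespace EnergyConverges

variable {w : ℕ → E n → ℝ} {u : E n → ℝ}

theorem bounded_sub (h : EnergyConverges K m w u) (hK : Bornology.IsBounded K) (hm : 0 ≤ m) :
    ∃ M, ∀ k, normSq m (w k - u) ≤ M := by
  obtain ⟨M, hM⟩ := h.bounded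
  exact ⟨2 * M + 2 * normSq m u, fun k => by
    linarith [normSq_sub_le hK hm (h.seq k) h.lim, hM k]⟩

theorem fourier_sub_tendsto (h : EnergyConverges K m w u) (hK : Bornology.IsBounded K) (ξ : E n) :
    Tendsto (fun k => fourierU (w k - u) ξ) atTop (𝓝 0) := by
  simp_rw [fourierU_sub ((h.seq _).integrable hK) (h.lim.integrable hK), Pi.sub_apply]
  simpa using (h.fourier_tendsto ξ).sub_const (fourierU u ξ)

theorem ae_sub_tendsto (h : EnergyConverges K m w u) :
    ∀ᵐ x, Tendsto (fun k => (w k - u) x) atTop (𝓝 0) := by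
  filter_upwards [h.ae_tendsto] with x hx
  simpa using hx.sub_const (u x)

theorem tendsto_normSq_sub (h : EnergyConverges K m w u) (hK : Bornology.IsBounded K) (hm : 0 < m)
    (hmn : m < (n : ℝ) / 2) {s : ℝ} (hs : 0 ≤ s) (hsm : s < m) :
    Tendsto (fun k => normSq s (w k - u)) atTop (𝓝 0) := by
  obtain ⟨M, hM⟩ := h.bounded_sub hK hm.le
  obtain ⟨A, hA⟩ := exists_norm_fourierU_bound hm hmn hK M
  have hd := fun k => (h.seq k).sub hK h.lim
  exact tendsto_integral_weighted_zero hs hsm (fun k => (hd k).integrable_weighted hK hs hsm.le)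
    (fun k => (hd k).integrable_energy) (fun k => hA _ (hd k) (hM k)) hM
    (h.fourier_sub_tendsto hK)

theorem tendsto_energyForm_sub (h : EnergyConverges K m w u) (hK : Bornology.IsBounded K)
    (hm : 0 < m) {v : E n → ℝ} (hv : FiniteEnergy K m v) :
    Tendsto (fun k => energyForm m v (w k - u)) atTop (𝓝 0) := by
  obtain ⟨M, hM⟩ := h.bounded_sub hK hm.le
  have hd := fun k => (h.seq k).sub hK h.lim
  have hcv := continuous_fourierU (hv.integrable hK)
  have hcd := fun k => continuous_fourierU ((hd k).integrable hK)
  have hint : ∀ k, Integrable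
      (fun ξ => ‖ξ‖ ^ (2 * m) * (‖fourierU v ξ‖ * ‖fourierU (w k - u) ξ‖)) := fun k => by
    refine (hv.integrable_energy.add (hd k).integrable_energy).mono'
      ((measurable_norm.pow_const _).mul
        (hcv.norm.mul (hcd k).norm).measurable).aestronglyMeasurable
      (Eventually.of_forall fun ξ => ?_)
    rw [Real.norm_of_nonneg (by positivity), Pi.add_apply, ← mul_add]
    refine mul_le_mul_of_nonneg_left ?_ (by positivity)
    nlinarith [sq_nonneg (‖fourierU v ξ‖ - ‖fourierU (w k - u) ξ‖), sq_nonneg (‖fourierU v ξ‖),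
      sq_nonneg (‖fourierU (w k - u) ξ‖)]
  have key : Tendsto (fun k =>
      ∫ ξ, ‖ξ‖ ^ (2 * m) * (‖fourierU v ξ‖ * ‖fourierU (w k - u) ξ‖)) atTop (𝓝 0) := by
    refine tendsto_integral_zero_of_le_add hint (fun k ξ => by positivity)
      (fun k => (hd k).integrable_energy) (fun k ξ => by positivity) hM
      (Eventually.of_forall fun ξ => ?_) fun δ hδ => ?_
    · have := ((h.fourier_sub_tendsto hK ξ).norm.const_mul (‖fourierU v ξ‖)).const_mul
        (‖ξ‖ ^ (2 * m))
      simpa using this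
    -- Young's inequality `AB ≤ δ B² + A²/(4δ)`, with `A` from the fixed function `v` and `B` from
    -- the difference.
    · refine ⟨_, hv.integrable_energy.const_mul (4 * δ)⁻¹, fun k =>
        Eventually.of_forall fun ξ => ?_⟩
      rw [mul_left_comm δ, mul_left_comm (4 * δ)⁻¹, ← mul_add]
      refine mul_le_mul_of_nonneg_left ?_ (by positivity)
      have e : δ * ‖fourierU (w k - u) ξ‖ ^ 2 + (4 * δ)⁻¹ * ‖fourierU v ξ‖ ^ 2 -
          ‖fourierU v ξ‖ * ‖fourierU (w k - u) ξ‖ =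
          δ * (‖fourierU (w k - u) ξ‖ - (2 * δ)⁻¹ * ‖fourierU v ξ‖) ^ 2 := by
        field_simp; ring
      have := mul_nonneg hδ.le (sq_nonneg (‖fourierU (w k - u) ξ‖ - (2 * δ)⁻¹ * ‖fourierU v ξ‖))
      linarith
  refine squeeze_zero_norm (fun k => ?_) key
  refine norm_integral_le_of_norm_le (hint k) (Eventually.of_forall fun ξ => ?_)
  rw [norm_mul, Real.norm_of_nonneg (by positivity)]
  refine mul_le_mul_of_nonneg_left ((Complex.abs_re_le_norm _).trans ?_) (by positivity)
  rw [norm_mul, RCLike.norm_conj]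

/-- Expanding the energy of `u + (w k - u)` leaves a cross term, which tends to `0` by weak
convergence. -/
theorem tendsto_normSq_sub_sub (h : EnergyConverges K m w u) (hK : Bornology.IsBounded K)
    (hm : 0 < m) :
    Tendsto (fun k => normSq m (w k) - normSq m (w k - u)) atTop (𝓝 (normSq m u)) := by
  have h1 := ((h.tendsto_energyForm_sub hK hm h.lim).const_mul 2).const_add (normSq m u)
  rw [mul_zero, add_zero] at h1
  refine h1.congr fun k => ?_
  have h2 := normSq_add_smul hK h.lim ((h.seq k).sub hK h.lim) hm.le le_rfl 1
  have e : u + (1 : ℝ) • (w k - u) = w k := by ext x; simp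
  rw [e] at h2
  rw [h2]; ring

end EnergyConverges

end Compactness

end FracCritical

namespace FracCritical

variable {n : ℕ}

/-! ### The two compact forms: energy of order `s` and Hardy weight -/

section Forms

variable {K : Set (E n)} {m s : ℝ}

/-- Symmetric nonnegative forms on the energy space that are continuous along weakly convergent
sequences. -/
structure CompactForm (K : Set (E n)) (m : ℝ) (b : (E n → ℝ) → (E n → ℝ) → ℝ) : Prop where
  add_smul : ∀ u v, FiniteEnergy K m u → FiniteEnergy K m v → ∀ t : ℝ,
    b (u + t • v) (u + t • v) = b u u + 2 * t * b u v + t ^ 2 * b v v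
  smul_left : ∀ (c : ℝ) u v, b (c • u) v = c * b u v
  nonneg : ∀ u, 0 ≤ b u u
  ae_zero : ∀ u : E n → ℝ, u =ᵐ[volume] 0 → b u u = 0
  pos : ∀ u, FiniteEnergy K m u → ¬ u =ᵐ[volume] 0 → 0 < b u u
  tendsto_sub : ∀ w u, EnergyConverges K m w u →
    Tendsto (fun k => b (w k - u) (w k - u)) atTop (𝓝 0)

theorem fourierU_ae_zero {u : E n → ℝ} (hu : u =ᵐ[volume] 0) : fourierU u = 0 := by
  rw [fourierU_congr_ae hu, show (0 : E n → ℝ) = (0 : ℝ) • (0 : E n → ℝ) by simp, fourierU_smul]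
  simp

theorem normSq_ae_zero (a : ℝ) {u : E n → ℝ} (hu : u =ᵐ[volume] 0) : normSq a u = 0 := by
  simp [normSq, fourierU_ae_zero hu]

theorem critSq_pos (hm : 0 < m) (hmn : m < (n : ℝ) / 2) (hK : Bornology.IsBounded K)
    {u : E n → ℝ} (hu : FiniteEnergy K m u) (h0 : ¬ u =ᵐ[volume] 0) : 0 < critSq m u := by
  have hp2 := critExp_gt_two hm hmn
  have hi := integrable_rpow_critExp hm hmn (hu.memLp_crit hm hmn hK)
  have h1 : 0 < ∫ x, |u x| ^ critExp n m := by
    refine lt_of_le_of_ne (integral_nonneg fun x => by positivity) fun h => h0 ?_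
    have h2 := (integral_eq_zero_iff_of_nonneg (fun x => by positivity) hi).1 h.symm
    filter_upwards [h2] with x hx
    have h3 : |u x| ^ critExp n m = 0 := hx
    rw [Real.rpow_eq_zero (abs_nonneg _) (by linarith)] at h3
    simpa using h3
  exact Real.rpow_pos_of_pos h1 _

theorem normSq_pos (hm : 0 < m) (hmn : m < (n : ℝ) / 2) (hK : Bornology.IsBounded K)
    {u : E n → ℝ} (hu : FiniteEnergy K m u) (h0 : ¬ u =ᵐ[volume] 0) : 0 < normSq m u := by
  obtain ⟨c, hc, hS⟩ := exists_sobolev hm hmn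
  exact (mul_pos hc (critSq_pos hm hmn hK hu h0)).trans_le
    (hS u (hu.integrable hK) hu.memLp hu.integrable_energy).2

/-- If the energy of order `s` vanished, the transform would be zero almost everywhere, and so would
the energy of order `m`, against the Sobolev inequality. -/
theorem normSq_pos_of_le (hm : 0 < m) (hmn : m < (n : ℝ) / 2) (hs : 0 ≤ s) (hsm : s ≤ m)
    (hK : Bornology.IsBounded K) {u : E n → ℝ} (hu : FiniteEnergy K m u)
    (h0 : ¬ u =ᵐ[volume] 0) : 0 < normSq s u := by
  have : Nonempty (Fin n) := ⟨⟨0, dim_pos hm hmn⟩⟩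
  refine lt_of_le_of_ne (normSq_nonneg s u) fun h => ?_
  have h1 := (integral_eq_zero_iff_of_nonneg (fun ξ => by positivity)
    (hu.integrable_weighted hK hs hsm)).1 h.symm
  refine (normSq_pos hm hmn hK hu h0).ne' ?_
  unfold normSq
  refine (integral_congr_ae ?_).trans (integral_zero (E n) ℝ)
  filter_upwards [h1, Measure.ae_ne volume (0 : E n)] with ξ h2 h3
  have h4 : 0 < ‖ξ‖ := norm_pos_iff.2 h3
  rcases mul_eq_zero.1 (show ‖ξ‖ ^ (2 * s) * ‖fourierU u ξ‖ ^ 2 = 0 from h2) with h5 | h5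
  · exact absurd h5 (Real.rpow_pos_of_pos h4 _).ne'
  · rw [h5, mul_zero]

theorem compactForm_energyForm (hs : 0 ≤ s) (hsm : s < m) (hmn : m < (n : ℝ) / 2)
    (hK : Bornology.IsBounded K) : CompactForm K m (energyForm s) where
  add_smul u v hu hv t := by
    simp only [energyForm_self]
    exact normSq_add_smul hK hu hv hs hsm.le t
  smul_left c u v := energyForm_smul_left s c u v
  nonneg u := by rw [energyForm_self]; exact normSq_nonneg s u
  ae_zero u hu := by rw [energyForm_self]; exact normSq_ae_zero s hu
  pos u hu h0 := by
    rw [energyForm_self]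
    exact normSq_pos_of_le (hs.trans_lt hsm) hmn hs hsm.le hK hu h0
  tendsto_sub w u h := by
    simp only [energyForm_self]
    exact h.tendsto_normSq_sub hK (hs.trans_lt hsm) hmn hs hsm

/-- The bilinear form of the Hardy weight `|x|^(-2s)`. -/
noncomputable def hardyForm (s : ℝ) (u v : E n → ℝ) : ℝ := ∫ x : E n, ‖x‖ ^ (-(2 * s)) * u x * v x

theorem hardyForm_self (s : ℝ) (u : E n → ℝ) : hardyForm s u u = hardySq s u := by
  unfold hardyForm hardySq
  refine integral_congr_ae (Eventually.of_forall fun x => ?_)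
  simp only
  ring

/-- Young's inequality with the conjugate exponents `p/2 = n/(n-2m)` and `n/(2m)`. The weight is
raised to `|x|^(-sn/m)`, locally integrable because `s < m`. The arbitrarily small coefficient of
the critical power makes the Hardy form compact. -/
theorem exists_hardy_weight_le (hs : 0 ≤ s) (hsm : s < m) (hmn : m < (n : ℝ) / 2)
    (hK : Bornology.IsBounded K) {δ : ℝ} (hδ : 0 < δ) :
    ∃ G : E n → ℝ, Integrable G ∧ ∀ u, FiniteEnergy K m u →
      ∀ᵐ x, ‖x‖ ^ (-(2 * s)) * u x ^ 2 ≤ δ * |u x| ^ critExp n m + G x := by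
  have hm : 0 < m := hs.trans_lt hsm
  have hn := dim_pos hm hmn
  obtain ⟨R, hR⟩ := hK.subset_closedBall 0
  have hnm : 0 < (n : ℝ) - 2 * m := by linarith
  have hn0 : (0 : ℝ) < n := by exact_mod_cast hn
  set r : ℝ := n / (n - 2 * m) with hr
  set q : ℝ := n / (2 * m) with hq
  have hrq : r.HolderConjugate q := by
    rw [Real.holderConjugate_iff]
    constructor
    · rw [hr, lt_div_iff₀ hnm]; linarith
    · rw [hr, hq]; field_simp; ring
  have hr0 : 0 < r := hrq.pos
  have hq0 : 0 < q := hrq.symm.pos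
  -- Balances the two Young factors so that `κ^r / r = δ`.
  set κ : ℝ := (δ * r) ^ (1 / r) with hκ
  have hκ0 : 0 < κ := by positivity
  have hκr : κ ^ r / r = δ := by
    rw [hκ, ← Real.rpow_mul (by positivity), one_div_mul_cancel hr0.ne', Real.rpow_one]
    field_simp
  set B := Metric.closedBall (0 : E n) R
  refine ⟨B.indicator fun x => (κ⁻¹ ^ q / q) * ‖x‖ ^ (-(2 * s * q)), ?_, fun u hu => ?_⟩
  · rw [integrable_indicator_iff measurableSet_closedBall]
    have h2 : IntegrableOn (fun x : E n => ‖x‖ ^ (-(2 * s * q))) B := by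
      refine (integrableOn_ball_rpow_neg (R := R + 1) hn ?_).mono_set
        (Metric.closedBall_subset_ball (by linarith))
      rw [hq, mul_div_assoc', div_lt_iff₀ (by linarith)]
      nlinarith
    exact h2.const_mul _
  · filter_upwards [hu.ae_zero] with x hx
    have hpow : 0 ≤ |u x| ^ critExp n m := by positivity
    by_cases hxK : x ∈ K
    · rw [Set.indicator_of_mem (hR hxK)]
      have hY := Real.young_inequality_of_nonneg (a := κ * u x ^ 2)
        (b := κ⁻¹ * ‖x‖ ^ (-(2 * s))) (by positivity) (by positivity) hrq
      have e1 : κ * u x ^ 2 * (κ⁻¹ * ‖x‖ ^ (-(2 * s))) = ‖x‖ ^ (-(2 * s)) * u x ^ 2 := by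
        field_simp
      have e2 : (κ * u x ^ 2) ^ r / r = δ * |u x| ^ critExp n m := by
        rw [Real.mul_rpow hκ0.le (sq_nonneg _), ← sq_abs, ← Real.rpow_natCast,
          ← Real.rpow_mul (abs_nonneg _), mul_div_right_comm, hκr]
        congr 2
        rw [hr, critExp]; push_cast; ring
      have e3 : (κ⁻¹ * ‖x‖ ^ (-(2 * s))) ^ q / q = κ⁻¹ ^ q / q * ‖x‖ ^ (-(2 * s * q)) := by
        rw [Real.mul_rpow (by positivity) (by positivity), ← Real.rpow_mul (norm_nonneg _),
          mul_div_right_comm]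
        congr 2; ring
      rw [e1, e2, e3] at hY
      exact hY
    · rw [hx hxK]
      have h0 : 0 ≤ B.indicator (fun x => (κ⁻¹ ^ q / q) * ‖x‖ ^ (-(2 * s * q))) x :=
        Set.indicator_nonneg (fun _ _ => by positivity) _
      have : 0 ≤ δ * |(0 : ℝ)| ^ critExp n m := by positivity
      simp only [ne_eq, OfNat.ofNat_ne_zero, not_false_eq_true, zero_pow, mul_zero]
      exact add_nonneg this h0

theorem integrable_hardy (hs : 0 ≤ s) (hsm : s < m) (hmn : m < (n : ℝ) / 2)
    (hK : Bornology.IsBounded K) {u : E n → ℝ} (hu : FiniteEnergy K m u) :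
    Integrable (fun x => ‖x‖ ^ (-(2 * s)) * u x ^ 2) := by
  have hm : 0 < m := hs.trans_lt hsm
  obtain ⟨G, hG, h⟩ := exists_hardy_weight_le hs hsm hmn hK one_pos
  refine (((integrable_rpow_critExp hm hmn (hu.memLp_crit hm hmn hK)).const_mul 1).add hG).mono'
    ((measurable_norm.pow_const _).aestronglyMeasurable.mul (hu.memLp.1.pow 2)) ?_
  filter_upwards [h u hu] with x hx
  rw [Real.norm_of_nonneg (by positivity)]
  exact hx

theorem integrable_hardyForm (hs : 0 ≤ s) (hsm : s < m) (hmn : m < (n : ℝ) / 2)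
    (hK : Bornology.IsBounded K) {u v : E n → ℝ} (hu : FiniteEnergy K m u)
    (hv : FiniteEnergy K m v) : Integrable (fun x => ‖x‖ ^ (-(2 * s)) * u x * v x) := by
  refine ((integrable_hardy hs hsm hmn hK hu).add (integrable_hardy hs hsm hmn hK hv)).mono'
    (((measurable_norm.pow_const _).aestronglyMeasurable.mul hu.memLp.1).mul hv.memLp.1)
    (Eventually.of_forall fun x => ?_)
  rw [mul_assoc, norm_mul, Real.norm_of_nonneg (by positivity), Pi.add_apply, ← mul_add]
  refine mul_le_mul_of_nonneg_left ?_ (by positivity)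
  rw [Real.norm_eq_abs, abs_le]
  constructor <;> nlinarith [sq_nonneg (u x - v x), sq_nonneg (u x + v x)]

theorem compactForm_hardyForm (hs : 0 ≤ s) (hsm : s < m) (hmn : m < (n : ℝ) / 2)
    (hK : Bornology.IsBounded K) : CompactForm K m (hardyForm s) where
  add_smul u v hu hv t := by
    have h1 := integrable_hardyForm hs hsm hmn hK hu hu
    have h2 := (integrable_hardyForm hs hsm hmn hK hu hv).const_mul (2 * t)
    have h3 := (integrable_hardyForm hs hsm hmn hK hv hv).const_mul (t ^ 2)
    have h12 : Integrable (fun x => ‖x‖ ^ (-(2 * s)) * u x * u x +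
      2 * t * (‖x‖ ^ (-(2 * s)) * u x * v x)) := h1.add h2
    unfold hardyForm
    rw [← integral_const_mul, ← integral_const_mul, ← integral_add h1 h2, ← integral_add h12 h3]
    refine integral_congr_ae (Eventually.of_forall fun x => ?_)
    simp only [Pi.add_apply, Pi.smul_apply, smul_eq_mul]
    ring
  smul_left c u v := by
    unfold hardyForm
    rw [← integral_const_mul]
    refine integral_congr_ae (Eventually.of_forall fun x => ?_)
    simp only [Pi.smul_apply, smul_eq_mul]
    ring
  nonneg u := by
    rw [hardyForm_self]
    exact integral_nonneg fun x => by positivity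
  ae_zero u hu := by
    unfold hardyForm
    refine (integral_congr_ae ?_).trans (integral_zero (E n) ℝ)
    filter_upwards [hu] with x hx
    simp [hx]
  pos u hu h0 := by
    have : Nonempty (Fin n) := ⟨⟨0, dim_pos (hs.trans_lt hsm) hmn⟩⟩
    rw [hardyForm_self]
    refine lt_of_le_of_ne (integral_nonneg fun x => by positivity) fun h => h0 ?_
    have h2 := (integral_eq_zero_iff_of_nonneg (fun x => by positivity)
      (integrable_hardy hs hsm hmn hK hu)).1 h.symm
    filter_upwards [h2, Measure.ae_ne volume (0 : E n)] with x hx hx0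
    have h4 : 0 < ‖x‖ := norm_pos_iff.2 hx0
    rcases mul_eq_zero.1 (show ‖x‖ ^ (-(2 * s)) * u x ^ 2 = 0 from hx) with h5 | h5
    · exact absurd h5 (Real.rpow_pos_of_pos h4 _).ne'
    · simpa using h5
  tendsto_sub w u h := by
    have hm : 0 < m := hs.trans_lt hsm
    obtain ⟨M, hM⟩ := h.bounded_sub hK hm.le
    obtain ⟨L, hL⟩ := exists_integral_rpow_bound hm hmn hK M
    have hd := fun k => (h.seq k).sub hK h.lim
    simp only [hardyForm_self]
    refine tendsto_integral_zero_of_le_add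
      (fun k => integrable_hardy hs hsm hmn hK (hd k)) (fun k x => by positivity)
      (fun k => integrable_rpow_critExp hm hmn ((hd k).memLp_crit hm hmn hK))
      (fun k x => by positivity) (fun k => hL _ (hd k) (hM k)) ?_ fun δ hδ => ?_
    · filter_upwards [h.ae_sub_tendsto] with x hx
      simpa using (hx.pow 2).const_mul (‖x‖ ^ (-(2 * s)))
    · obtain ⟨G, hG, h⟩ := exists_hardy_weight_le hs hsm hmn hK hδ
      exact ⟨G, hG, fun k => h _ (hd k)⟩

namespace CompactForm

variable {b : (E n → ℝ) → (E n → ℝ) → ℝ}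

theorem smul_smul (hb : CompactForm K m b) {u : E n → ℝ} (hu : FiniteEnergy K m u) (c : ℝ) :
    b (c • u) (c • u) = c ^ 2 * b u u := by
  have h := hb.add_smul u u hu hu (c - 1)
  have e : u + (c - 1) • u = c • u := by rw [sub_smul, one_smul]; abel
  rw [e] at h
  rw [h]; ring

/-- Cauchy–Schwarz: the nonnegative quadratic `t ↦ b(u + tv, u + tv)` has nonpositive discriminant.
-/
theorem sq_le (hb : CompactForm K m b) {u v : E n → ℝ} (hu : FiniteEnergy K m u)
    (hv : FiniteEnergy K m v) : b u v ^ 2 ≤ b u u * b v v := by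
  have h := discrim_le_zero (a := b v v) (b := 2 * b u v) (c := b u u) fun t => by
    have h1 := hb.add_smul u v hu hv t
    have h2 := hb.nonneg (u + t • v)
    nlinarith
  unfold discrim at h
  linarith

theorem tendsto (hb : CompactForm K m b) (hK : Bornology.IsBounded K) {w : ℕ → E n → ℝ}
    {u : E n → ℝ} (h : EnergyConverges K m w u) :
    Tendsto (fun k => b (w k) (w k)) atTop (𝓝 (b u u)) := by
  have hd := fun k => (h.seq k).sub hK h.lim
  have h0 := hb.tendsto_sub w u h
  have h1 : Tendsto (fun k => b u (w k - u)) atTop (𝓝 0) := by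
    have h2 := (h0.const_mul (b u u)).sqrt
    rw [mul_zero, Real.sqrt_zero] at h2
    exact squeeze_zero_norm (fun k => Real.abs_le_sqrt (hb.sq_le h.lim (hd k))) h2
  have h3 := ((h1.const_mul 2).const_add (b u u)).add h0
  rw [mul_zero, add_zero, add_zero] at h3
  refine h3.congr fun k => ?_
  have h4 := hb.add_smul u (w k - u) h.lim (hd k) 1
  have e : u + (1 : ℝ) • (w k - u) = w k := by ext x; simp
  rw [e] at h4
  rw [h4]; ring

end CompactForm

end Forms

end FracCritical

namespace FracCritical

variable {n : ℕ}

/-! ### Eigenfunction, minimizers below the Sobolev level, Euler–Lagrange equation -/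

section Minimization

variable {K : Set (E n)} {m : ℝ} {b : (E n → ℝ) → (E n → ℝ) → ℝ}

theorem critSq_smul (hm : 0 < m) (hmn : m < (n : ℝ) / 2) (c : ℝ) (u : E n → ℝ) :
    critSq m (c • u) = c ^ 2 * critSq m u := by
  have hp2 := critExp_gt_two hm hmn
  have hp0 : critExp n m ≠ 0 := by linarith
  unfold critSq
  simp only [Pi.smul_apply, smul_eq_mul, abs_mul, Real.mul_rpow (abs_nonneg _) (abs_nonneg _)]
  rw [integral_const_mul, Real.mul_rpow (by positivity) (integral_nonneg fun x => by positivity),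
    ← Real.rpow_mul (abs_nonneg _), mul_div_cancel₀ _ hp0, Real.rpow_two, sq_abs]

/-- The first eigenvalue of the energy form relative to a compact form is attained. -/
theorem CompactForm.exists_eigenfunction (hb : CompactForm K m b) (hm : 0 < m)
    (hmn : m < (n : ℝ) / 2) (hK : Bornology.IsBounded K)
    (hne : ∃ u, FiniteEnergy K m u ∧ ¬ u =ᵐ[volume] 0) :
    ∃ u, (FiniteEnergy K m u ∧ ¬ u =ᵐ[volume] 0) ∧
      ∀ v, FiniteEnergy K m v → ¬ v =ᵐ[volume] 0 →
        normSq m u / b u u ≤ normSq m v / b v v := by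
  set S : Set ℝ := (fun u => normSq m u / b u u) ''
    {u | FiniteEnergy K m u ∧ ¬ u =ᵐ[volume] 0} with hS
  have hSne : S.Nonempty := by
    obtain ⟨u, hu⟩ := hne
    exact ⟨_, u, hu, rfl⟩
  have hSb : BddBelow S := ⟨0, by
    rintro _ ⟨u, hu, rfl⟩
    exact div_nonneg (normSq_nonneg _ _) (hb.nonneg u)⟩
  obtain ⟨r, -, hr, hrS⟩ := exists_seq_tendsto_sInf hSne hSb
  choose v hv hvr using hrS
  have hbv : ∀ k, 0 < b (v k) (v k) := fun k => hb.pos _ (hv k).1 (hv k).2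
  set w : ℕ → E n → ℝ := fun k => (√(b (v k) (v k)))⁻¹ • v k with hw
  have hsq : ∀ k, ((√(b (v k) (v k)))⁻¹) ^ 2 = (b (v k) (v k))⁻¹ := fun k => by
    rw [inv_pow, Real.sq_sqrt (hbv k).le]
  have hwF : ∀ k, FiniteEnergy K m (w k) := fun k => (hv k).1.smul _
  have hwb : ∀ k, b (w k) (w k) = 1 := fun k => by
    rw [hw, hb.smul_smul (hv k).1, hsq, inv_mul_cancel₀ (hbv k).ne']
  have hwn : ∀ k, normSq m (w k) = r k := fun k => by
    rw [hw, normSq_smul, hsq, ← hvr]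
    exact (div_eq_inv_mul _ _).symm
  obtain ⟨M, hM⟩ := hr.bddAbove_range
  obtain ⟨σ, hσ, u, hu⟩ := exists_subseq_energyConverges (M := M) hm hmn hK hwF fun k => by
    rw [hwn]; exact hM ⟨k, rfl⟩
  -- Compactness of `b` preserves the normalisation in the limit, which also excludes `u = 0`.
  have hbu : b u u = 1 := by
    refine tendsto_nhds_unique (hb.tendsto hK hu) ?_
    simp only [Function.comp_apply, hwb]
    exact tendsto_const_nhds
  have hle : normSq m u ≤ sInf S := by
    refine le_of_tendsto_of_tendsto' (hu.tendsto_normSq_sub_sub hK hm)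
      (hr.comp hσ.tendsto_atTop) fun k => ?_
    have := normSq_nonneg m ((w ∘ σ) k - u)
    simp only [Function.comp_apply, hwn] at this ⊢
    linarith
  refine ⟨u, ⟨hu.lim, fun h => ?_⟩, fun v hv hv0 => ?_⟩
  · rw [hb.ae_zero u h] at hbu
    exact zero_ne_one hbu
  · rw [hbu, div_one]
    exact hle.trans (csInf_le hSb ⟨v, ⟨hv, hv0⟩, rfl⟩)

/-- One half of the Brezis–Lieb lemma along weakly convergent sequences. -/
theorem EnergyConverges.eventually_integral_rpow_le {w : ℕ → E n → ℝ} {u : E n → ℝ}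
    (h : EnergyConverges K m w u) (hK : Bornology.IsBounded K) (hm : 0 < m)
    (hmn : m < (n : ℝ) / 2) {ε : ℝ} (hε : 0 < ε) :
    ∀ᶠ k in atTop, ∫ x, |w k x| ^ critExp n m ≤
      (∫ x, |u x| ^ critExp n m) + (∫ x, |(w k - u) x| ^ critExp n m) + ε := by
  have hp2 := critExp_gt_two hm hmn
  set p := critExp n m
  obtain ⟨M, hM⟩ := h.bounded_sub hK hm.le
  obtain ⟨L, hL⟩ := exists_integral_rpow_bound hm hmn hK M
  have hd := fun k => (h.seq k).sub hK h.lim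
  have hint : ∀ v, FiniteEnergy K m v → Integrable fun x => |v x| ^ p := fun v hv =>
    integrable_rpow_critExp hm hmn (hv.memLp_crit hm hmn hK)
  have hi := fun k => ((hint _ (h.seq k)).sub (hint _ h.lim)).sub (hint _ (hd k))
  have key := eventually_integral_le_of_le_add (l := atTop) (M := L) hi (fun k => hint _ (hd k))
    (fun k x => by positivity) (fun k => hL _ (hd k) (hM k)) ?_ ?_ hε
  · filter_upwards [key] with k hk
    have e : ∫ x, ((fun x => |w k x| ^ p) - (fun x => |u x| ^ p) -
        fun x => |(w k - u) x| ^ p) x =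
        (∫ x, |w k x| ^ p) - (∫ x, |u x| ^ p) - ∫ x, |(w k - u) x| ^ p := by
      rw [integral_sub' ((hint _ (h.seq k)).sub (hint _ h.lim)) (hint _ (hd k)),
        integral_sub' (hint _ (h.seq k)) (hint _ h.lim)]
    rw [e] at hk
    linarith
  · filter_upwards [h.ae_tendsto, h.ae_sub_tendsto] with x h1 h2
    have hc : Continuous fun y : ℝ => |y| ^ p :=
      continuous_abs.rpow_const fun _ => Or.inr (by linarith)
    have h3 := (((hc.tendsto _).comp h1).sub_const (|u x| ^ p)).sub ((hc.tendsto _).comp h2)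
    simp only [sub_self, abs_zero, Real.zero_rpow (show p ≠ 0 by linarith)] at h3
    exact h3
  · intro δ hδ
    -- This gives `|w|^p ≤ (1+δ)|w-u|^p + C|u|^p`: the excess is a small multiple of a bounded
    -- integral plus a fixed integrable function.
    obtain ⟨C, hC0, hC⟩ := exists_add_rpow_le (p := p) (by linarith) hδ
    refine ⟨_, (hint _ h.lim).const_mul C, fun k => Eventually.of_forall fun x => ?_⟩
    have h1 := hC |u x| |(w k - u) x| (abs_nonneg _) (abs_nonneg _)
    have h2 : |w k x| ^ p ≤ (|u x| + |(w k - u) x|) ^ p := by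
      refine Real.rpow_le_rpow (abs_nonneg _) ?_ (by linarith)
      have := abs_add_le (u x) ((w k - u) x)
      simpa using this
    have h3 : 0 ≤ |u x| ^ p := by positivity
    simp only [Pi.sub_apply] at h1 h2 ⊢
    linarith

/-- If the lower bound `S` of the quotient is below the Sobolev constant `c`, then it is attained
along the weak limit of a minimizing sequence. -/
theorem le_of_minimizing (hb : CompactForm K m b) (hm : 0 < m) (hmn : m < (n : ℝ) / 2)
    (hK : Bornology.IsBounded K) {c S lam : ℝ} (hS0 : 0 < S) (hSc : S < c)
    (hc : ∀ v, FiniteEnergy K m v → c * critSq m v ≤ normSq m v)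
    (hS : ∀ v, FiniteEnergy K m v → S * critSq m v ≤ normSq m v - lam * b v v)
    {w : ℕ → E n → ℝ} {u : E n → ℝ} (h : EnergyConverges K m w u)
    (hw1 : ∀ k, critSq m (w k) = 1)
    (hwS : Tendsto (fun k => normSq m (w k) - lam * b (w k) (w k)) atTop (𝓝 S)) :
    1 ≤ critSq m u ∧ normSq m u - lam * b u u ≤ S := by
  have hp2 := critExp_gt_two hm hmn
  set p := critExp n m with hp
  have hp0 : 0 < p := by linarith
  have hc0 : 0 < c := hS0.trans hSc
  have hd := fun k => (h.seq k).sub hK h.lim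
  set Q := normSq m u - lam * b u u with hQ
  -- The form `b` passes to the limit, so the whole defect `S - Q` of the quotient is the limiting
  -- energy of the differences.
  have hD : Tendsto (fun k => normSq m (w k - u)) atTop (𝓝 (S - Q)) := by
    have h1 := (hwS.add ((hb.tendsto hK h).const_mul lam)).sub (h.tendsto_normSq_sub_sub hK hm)
    have e : S + lam * b u u - normSq m u = S - Q := by rw [hQ]; ring
    rw [e] at h1
    refine h1.congr fun k => ?_
    ring
  have hD0 : 0 ≤ S - Q := ge_of_tendsto' hD fun k => normSq_nonneg _ _
  set a := ∫ x, |u x| ^ p with ha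
  have ha0 : 0 ≤ a := integral_nonneg fun x => by positivity
  have haC : a ^ (2 / p) = critSq m u := rfl
  -- By the Sobolev inequality, `β` bounds the critical mass that the differences can carry in the
  -- limit.
  set β := ((S - Q) / c) ^ (p / 2) with hβ
  have hdiv : 0 ≤ (S - Q) / c := by positivity
  have hβ0 : 0 ≤ β := by positivity
  have hβp : β ^ (2 / p) = (S - Q) / c := by
    rw [hβ, ← Real.rpow_mul hdiv]
    have : p / 2 * (2 / p) = 1 := by field_simp
    rw [this, Real.rpow_one]
  have hP : Tendsto (fun k => (normSq m (w k - u) / c) ^ (p / 2)) atTop (𝓝 β) :=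
    (hD.div_const c).rpow_const (Or.inr (by positivity))
  have hsum : 1 ≤ a + β := by
    refine le_of_forall_pos_le_add fun ε hε => ?_
    refine ge_of_tendsto ((hP.const_add a).add_const ε) ?_
    filter_upwards [h.eventually_integral_rpow_le hK hm hmn hε] with k hk
    rw [integral_rpow_critExp_eq hm hmn (w k), hw1, Real.one_rpow,
      integral_rpow_critExp_eq hm hmn (w k - u)] at hk
    have h2 : critSq m (w k - u) ^ (p / 2) ≤ (normSq m (w k - u) / c) ^ (p / 2) := by
      refine Real.rpow_le_rpow (critSq_nonneg _ _) ?_ (by positivity)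
      rw [le_div_iff₀ hc0, mul_comm]
      exact hc _ (hd k)
    linarith
  have hSu := hS u h.lim
  rw [← haC] at hSu ⊢
  have hpow : 1 ≤ a ^ (2 / p) + β ^ (2 / p) := by
    have h1 := Real.rpow_add_le_add_rpow ha0 hβ0 (p := 2 / p) (by positivity)
      (by rw [div_le_one hp0]; exact hp2.le)
    exact (Real.one_le_rpow hsum (by positivity)).trans h1
  -- Subadditivity of the power `2/p < 1` gave `1 ≤ critSq m u + (S-Q)/c`. Multiplying by `S` and
  -- using `S · critSq m u ≤ Q` gives `S ≤ Q + S(S-Q)/c`, which is less than `S` if `S - Q > 0`,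
  -- because `S < c`.
  have hzero : S - Q = 0 := by
    by_contra hne
    have hpos : 0 < S - Q := lt_of_le_of_ne hD0 (Ne.symm hne)
    have h1 : 0 < (S - Q) / c := by positivity
    have h2 : S * ((S - Q) / c) < S - Q := by
      rw [mul_div_assoc', div_lt_iff₀ hc0]
      nlinarith
    rw [hβp] at hpow
    nlinarith
  rw [hβp, hzero, zero_div, add_zero] at hpow
  exact ⟨hpow, by linarith⟩

/-- The derivative at the origin of the critical integral along a line. -/
theorem hasDerivAt_integral_rpow (hm : 0 < m) (hmn : m < (n : ℝ) / 2) {u v : E n → ℝ}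
    (hu : MemLp u (ENNReal.ofReal (critExp n m))) (hv : MemLp v (ENNReal.ofReal (critExp n m))) :
    HasDerivAt (fun t : ℝ => ∫ x, |(u + t • v) x| ^ critExp n m)
      (critExp n m * ∫ x, |u x| ^ (critExp n m - 2) * u x * v x) 0 := by
  have hp2 := critExp_gt_two hm hmn
  set p := critExp n m with hp
  have habs : MemLp (fun x => |u x| + |v x|) (ENNReal.ofReal p) := hu.abs.add hv.abs
  have hint := integrable_rpow_critExp hm hmn habs
  have hmeas : ∀ t : ℝ, AEStronglyMeasurable (u + t • v) volume := fun t =>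
    hu.1.add (hv.1.const_smul t)
  have h := hasDerivAt_integral_of_dominated_loc_of_deriv_le (μ := (volume : Measure (E n)))
    (F := fun (t : ℝ) x => |(u + t • v) x| ^ p)
    (F' := fun (t : ℝ) x => p * |(u + t • v) x| ^ (p - 2) * (u + t • v) x * v x)
    -- For `|t| < 1` both `|u + tv|` and `|v|` are at most `|u| + |v|`, so the derivative is at most
    -- `p(|u| + |v|)^p`.
    (bound := fun x => p * |(|u x| + |v x|)| ^ p) (x₀ := (0 : ℝ))
    (Metric.ball_mem_nhds 0 one_pos)
    (Eventually.of_forall fun t => ((hmeas t).norm.aemeasurable.pow_const p).aestronglyMeasurable)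
    ?_ ?_ ?_ (hint.const_mul p) ?_
  · have e : ∫ x, p * |(u + (0 : ℝ) • v) x| ^ (p - 2) * (u + (0 : ℝ) • v) x * v x =
        p * ∫ x, |u x| ^ (p - 2) * u x * v x := by
      rw [← integral_const_mul]
      refine integral_congr_ae (Eventually.of_forall fun x => ?_)
      simp only [zero_smul, add_zero]
      ring
    rw [← e]
    exact h.2
  · simpa using integrable_rpow_critExp hm hmn hu
  · refine (((AEMeasurable.aestronglyMeasurable ?_).mul (hmeas 0)).mul hv.1)
    exact ((hmeas 0).norm.aemeasurable.pow_const (p - 2)).const_mul p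
  · refine Eventually.of_forall fun x t ht => ?_
    have ht1 : |t| < 1 := by simpa using ht
    set y := (u + t • v) x with hy
    set z := |u x| + |v x| with hz
    have hz0 : 0 ≤ z := by positivity
    have hyz : |y| ≤ z := by
      rw [hy, hz, Pi.add_apply, Pi.smul_apply, smul_eq_mul]
      refine (abs_add_le _ _).trans ?_
      rw [abs_mul]
      have := mul_le_of_le_one_left (abs_nonneg (v x)) ht1.le
      linarith
    have hvz : |v x| ≤ z := by rw [hz]; linarith [abs_nonneg (u x)]
    rw [norm_mul, norm_mul, norm_mul, Real.norm_of_nonneg (show 0 ≤ p by linarith),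
      Real.norm_of_nonneg (show 0 ≤ |y| ^ (p - 2) by positivity), Real.norm_eq_abs,
      Real.norm_eq_abs, abs_of_nonneg hz0, mul_assoc, mul_assoc]
    refine mul_le_mul_of_nonneg_left ?_ (by linarith)
    have h1 : |y| ^ (p - 2) ≤ z ^ (p - 2) := Real.rpow_le_rpow (abs_nonneg _) hyz (by linarith)
    have h2 : |y| * |v x| ≤ z * z := mul_le_mul hyz hvz (abs_nonneg _) hz0
    refine (mul_le_mul h1 h2 (by positivity) (by positivity)).trans (le_of_eq ?_)
    rcases hz0.eq_or_lt with h0 | h0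
    · rw [← h0, mul_zero, mul_zero, Real.zero_rpow (by linarith)]
    · rw [← sq, ← Real.rpow_natCast z 2, ← Real.rpow_add h0]
      congr 1; push_cast; ring
  · refine Eventually.of_forall fun x t _ => ?_
    have h1 : HasDerivAt (fun t : ℝ => (u + t • v) x) (v x) t := by
      simp only [Pi.add_apply, Pi.smul_apply, smul_eq_mul]
      simpa using ((hasDerivAt_id t).mul_const (v x)).const_add (u x)
    exact (hasDerivAt_abs_rpow ((u + t • v) x) (show 1 < p by linarith)).comp t h1

/-- The Euler–Lagrange equation of a minimizer, and the solution obtained by rescaling. -/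
theorem exists_solution_of_minimizer (hb : CompactForm K m b) (hm : 0 < m)
    (hmn : m < (n : ℝ) / 2) (hK : Bornology.IsBounded K) {S lam : ℝ} (hS0 : 0 < S)
    (hS : ∀ v, FiniteEnergy K m v → S * critSq m v ≤ normSq m v - lam * b v v)
    {u : E n → ℝ} (hu : FiniteEnergy K m u) (hu0 : ¬ u =ᵐ[volume] 0)
    (huS : normSq m u - lam * b u u = S * critSq m u) :
    ∃ U, FiniteEnergy K m U ∧ ¬ U =ᵐ[volume] 0 ∧ ∀ v, FiniteEnergy K m v →
      energyForm m U v = lam * b U v + ∫ x, |U x| ^ (critExp n m - 2) * U x * v x := by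
  have hp2 := critExp_gt_two hm hmn
  set p := critExp n m with hp
  have hup := hu.memLp_crit hm hmn hK
  have hcp := critSq_pos hm hmn hK hu hu0
  set N := ∫ x, |u x| ^ p with hN
  have hN0 : 0 < N := by
    rw [hN, integral_rpow_critExp_eq hm hmn]; positivity
  -- The Lagrange multiplier: the derivative of `S · critSq` along `v` is `2κ` times the nonlinear
  -- pairing.
  set κ := S * N ^ (2 / p - 1) with hκ
  have hκ0 : 0 < κ := by positivity
  have hEL : ∀ v, FiniteEnergy K m v →
      energyForm m u v - lam * b u v = κ * ∫ x, |u x| ^ (p - 2) * u x * v x := by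
    intro v hv
    set I := ∫ x, |u x| ^ (p - 2) * u x * v x with hI
    have hder := hasDerivAt_integral_rpow hm hmn hup (hv.memLp_crit hm hmn hK)
    rw [← hp, ← hI] at hder
    have hcrit : HasDerivAt (fun t : ℝ => critSq m (u + t • v))
        (p * I * (2 / p) * N ^ (2 / p - 1)) 0 := by
      have hN' : ∫ x, |(u + (0 : ℝ) • v) x| ^ p = N := by simp [hN]
      have h1 : HasDerivAt (fun t : ℝ => critSq m (u + t • v))
          (p * I * (2 / p) * (∫ x, |(u + (0 : ℝ) • v) x| ^ p) ^ (2 / p - 1)) 0 :=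
        hder.rpow_const (Or.inl (by rw [hN']; exact hN0.ne'))
      rwa [hN'] at h1
    have hquad : HasDerivAt (fun t : ℝ => (normSq m u - lam * b u u) +
        2 * t * (energyForm m u v - lam * b u v) + t ^ 2 * (normSq m v - lam * b v v))
        (2 * (energyForm m u v - lam * b u v)) 0 := by
      have h1 := (((hasDerivAt_id (0 : ℝ)).const_mul 2).mul_const
        (energyForm m u v - lam * b u v)).const_add (normSq m u - lam * b u u)
      have h2 := ((hasDerivAt_pow 2 (0 : ℝ)).mul_const (normSq m v - lam * b v v))
      simpa using h1.fun_add h2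
    have hfun : (fun t : ℝ => (normSq m u - lam * b u u) +
        2 * t * (energyForm m u v - lam * b u v) + t ^ 2 * (normSq m v - lam * b v v)) =
        fun t : ℝ => normSq m (u + t • v) - lam * b (u + t • v) (u + t • v) := by
      ext t
      rw [normSq_add_smul hK hu hv hm.le le_rfl, hb.add_smul u v hu hv]
      ring
    rw [hfun] at hquad
    have htot := hquad.sub (hcrit.const_mul S)
    -- The function is nonnegative for every `t` by the definition of `S` as a lower bound, and
    -- vanishes at `t = 0`.
    have hmin : IsLocalMin (fun t : ℝ => (normSq m (u + t • v) -
        lam * b (u + t • v) (u + t • v)) - S * critSq m (u + t • v)) 0 := by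
      refine Eventually.of_forall fun t => ?_
      have h1 := hS _ (hu.add hK (hv.smul t))
      simp only [zero_smul, add_zero]
      linarith
    have h0 := hmin.hasDerivAt_eq_zero htot
    have e : p * I * (2 / p) * N ^ (2 / p - 1) = 2 * (N ^ (2 / p - 1) * I) := by
      have : p ≠ 0 := by linarith
      field_simp
    rw [e] at h0
    rw [hκ]
    linarith
  -- Replacing `u` by `τu` multiplies the linear terms by `τ` and the nonlinearity by `τ^(p-1)`, so
  -- `τ^(p-2) = κ` absorbs the multiplier.
  set τ := κ ^ (1 / (p - 2)) with hτ
  have hp20 : 0 < p - 2 := by linarith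
  have hτ0 : 0 < τ := by positivity
  have hτκ : τ ^ (p - 2) = κ := by
    rw [hτ, ← Real.rpow_mul hκ0.le, one_div_mul_cancel hp20.ne', Real.rpow_one]
  refine ⟨τ • u, hu.smul τ, fun h => hu0 ?_, fun v hv => ?_⟩
  · filter_upwards [h] with x hx
    simpa [hτ0.ne'] using hx
  · have e : ∫ x, |(τ • u) x| ^ (p - 2) * (τ • u) x * v x =
        τ * (κ * ∫ x, |u x| ^ (p - 2) * u x * v x) := by
      rw [← integral_const_mul, ← integral_const_mul]
      refine integral_congr_ae (Eventually.of_forall fun x => ?_)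
      simp only [Pi.smul_apply, smul_eq_mul, abs_mul, abs_of_pos hτ0]
      rw [Real.mul_rpow hτ0.le (abs_nonneg _), hτκ]
      ring
    rw [e, ← hEL v hv, energyForm_smul_left, hb.smul_left]
    ring

/-- Existence of minimizers and of solutions for parameters near the first eigenvalue. -/
theorem CompactForm.exists_threshold (hb : CompactForm K m b) (hm : 0 < m)
    (hmn : m < (n : ℝ) / 2) (hK : Bornology.IsBounded K)
    (hne : ∃ u, FiniteEnergy K m u ∧ ¬ u =ᵐ[volume] 0) :
    ∃ lamStar : ℝ, 0 ≤ lamStar ∧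
      lamStar < sInf ((fun u => normSq m u / b u u) ''
        {u | FiniteEnergy K m u ∧ ¬ u =ᵐ[volume] 0}) ∧
      ∀ lam : ℝ, lamStar < lam →
        lam < sInf ((fun u => normSq m u / b u u) ''
          {u | FiniteEnergy K m u ∧ ¬ u =ᵐ[volume] 0}) →
        (∃ u, (FiniteEnergy K m u ∧ ¬ u =ᵐ[volume] 0) ∧
          ∀ v, FiniteEnergy K m v → ¬ v =ᵐ[volume] 0 →
            (normSq m u - lam * b u u) / critSq m u ≤ (normSq m v - lam * b v v) / critSq m v) ∧
        ∃ U, FiniteEnergy K m U ∧ ¬ U =ᵐ[volume] 0 ∧ ∀ v, FiniteEnergy K m v →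
          energyForm m U v = lam * b U v + ∫ x, |U x| ^ (critExp n m - 2) * U x * v x := by
  obtain ⟨φ, ⟨hφ, hφ0⟩, hφmin⟩ := hb.exists_eigenfunction hm hmn hK hne
  obtain ⟨c, hc0, hcS⟩ := exists_sobolev hm hmn
  have hc : ∀ v, FiniteEnergy K m v → c * critSq m v ≤ normSq m v := fun v hv =>
    (hcS v (hv.integrable hK) hv.memLp hv.integrable_energy).2
  set Λ := sInf ((fun u => normSq m u / b u u) ''
        {u | FiniteEnergy K m u ∧ ¬ u =ᵐ[volume] 0}) with hΛ
  have hΛφ : Λ = normSq m φ / b φ φ :=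
    IsLeast.csInf_eq ⟨⟨φ, ⟨hφ, hφ0⟩, rfl⟩, by rintro _ ⟨v, hv, rfl⟩; exact hφmin v hv.1 hv.2⟩
  have hbφ := hb.pos φ hφ hφ0
  have hnφ := normSq_pos hm hmn hK hφ hφ0
  have hcφ := critSq_pos hm hmn hK hφ hφ0
  have hΛ0 : 0 < Λ := by rw [hΛφ]; positivity
  have hΛle : ∀ v, FiniteEnergy K m v → Λ * b v v ≤ normSq m v := by
    intro v hv
    by_cases hv0 : v =ᵐ[volume] 0
    · rw [hb.ae_zero v hv0, normSq_ae_zero m hv0, mul_zero]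
    · have h1 := hφmin v hv hv0
      rw [← hΛφ] at h1
      exact (le_div_iff₀ (hb.pos v hv hv0)).1 h1
  -- The quotient at `φ` is `(Λ - λ) b(φ,φ) / critSq m φ`, which is below `c` exactly when `λ`
  -- exceeds the second entry.
  refine ⟨max 0 (Λ - c * critSq m φ / b φ φ), le_max_left _ _,
    max_lt hΛ0 (sub_lt_self _ (by positivity)), fun lam h1 h2 => ?_⟩
  have hlam0 : 0 < lam := (le_max_left _ _).trans_lt h1
  have hlam1 : Λ - c * critSq m φ / b φ φ < lam := (le_max_right _ _).trans_lt h1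
  -- The coercivity constant: `λ b(v,v) ≤ (λ/Λ) ‖v‖_m²` leaves the fraction `θ` of the energy. It
  -- makes `S` positive and bounds minimizing sequences.
  set θ := 1 - lam / Λ with hθ
  have hθ0 : 0 < θ := by rw [hθ, sub_pos, div_lt_one hΛ0]; exact h2
  have hcoer : ∀ v, FiniteEnergy K m v → θ * normSq m v ≤ normSq m v - lam * b v v := by
    intro v hv
    have h3 : lam / Λ * (Λ * b v v) ≤ lam / Λ * normSq m v :=
      mul_le_mul_of_nonneg_left (hΛle v hv) (by positivity)
    have h4 : lam / Λ * (Λ * b v v) = lam * b v v := by field_simp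
    rw [hθ]; linarith
  set Z : Set (E n → ℝ) := {u | FiniteEnergy K m u ∧ ¬ u =ᵐ[volume] 0} with hZ
  set T : Set ℝ := (fun u => (normSq m u - lam * b u u) / critSq m u) '' Z with hT
  have hTlow : ∀ y ∈ T, θ * c ≤ y := by
    rintro _ ⟨v, hv, rfl⟩
    have hcv := critSq_pos hm hmn hK hv.1 hv.2
    simp only
    rw [le_div_iff₀ hcv, mul_assoc]
    exact (mul_le_mul_of_nonneg_left (hc v hv.1) hθ0.le).trans (hcoer v hv.1)
  have hTb : BddBelow T := ⟨_, hTlow⟩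
  have hTφ : (normSq m φ - lam * b φ φ) / critSq m φ ∈ T := ⟨φ, ⟨hφ, hφ0⟩, rfl⟩
  have hTne : T.Nonempty := ⟨_, hTφ⟩
  set S := sInf T with hSdef
  have hS0 : 0 < S := (mul_pos hθ0 hc0).trans_le (le_csInf hTne hTlow)
  have hSc : S < c := by
    refine (csInf_le hTb hTφ).trans_lt ?_
    rw [div_lt_iff₀ hcφ]
    have h3 : normSq m φ = Λ * b φ φ := by rw [hΛφ]; field_simp
    rw [sub_lt_iff_lt_add, ← sub_lt_iff_lt_add', lt_div_iff₀ hbφ] at hlam1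
    rw [h3]; linarith
  have hSle : ∀ v, FiniteEnergy K m v → S * critSq m v ≤ normSq m v - lam * b v v := by
    intro v hv
    by_cases hv0 : v =ᵐ[volume] 0
    · have h3 : critSq m v = 0 := by
        have h4 := hc v hv
        rw [normSq_ae_zero m hv0] at h4
        nlinarith [critSq_nonneg m v]
      rw [hb.ae_zero v hv0, normSq_ae_zero m hv0, h3]
      simp
    · rw [← le_div_iff₀ (critSq_pos hm hmn hK hv hv0)]
      exact csInf_le hTb ⟨v, ⟨hv, hv0⟩, rfl⟩
  obtain ⟨r, -, hr, hrT⟩ := exists_seq_tendsto_sInf hTne hTb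
  choose v hv hvr using hrT
  have hcv : ∀ k, 0 < critSq m (v k) := fun k => critSq_pos hm hmn hK (hv k).1 (hv k).2
  set w : ℕ → E n → ℝ := fun k => (√(critSq m (v k)))⁻¹ • v k with hw
  have hsq : ∀ k, ((√(critSq m (v k)))⁻¹) ^ 2 = (critSq m (v k))⁻¹ := fun k => by
    rw [inv_pow, Real.sq_sqrt (hcv k).le]
  have hwF : ∀ k, FiniteEnergy K m (w k) := fun k => (hv k).1.smul _
  have hw1 : ∀ k, critSq m (w k) = 1 := fun k => by
    rw [hw, critSq_smul hm hmn, hsq, inv_mul_cancel₀ (hcv k).ne']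
  have hwr : ∀ k, normSq m (w k) - lam * b (w k) (w k) = r k := fun k => by
    rw [hw, normSq_smul, hb.smul_smul (hv k).1, hsq, ← hvr]
    simp only
    field_simp
  obtain ⟨M, hM⟩ := hr.bddAbove_range
  obtain ⟨σ, hσ, u, hu⟩ := exists_subseq_energyConverges (M := M / θ) hm hmn hK hwF fun k => by
    rw [le_div_iff₀ hθ0, mul_comm]
    refine (hcoer _ (hwF k)).trans ?_
    rw [hwr]; exact hM ⟨k, rfl⟩
  obtain ⟨hu1, huS⟩ := le_of_minimizing hb hm hmn hK hS0 hSc hc hSle hu (fun k => hw1 _)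
    (by simpa only [Function.comp_apply, hwr] using! hr.comp hσ.tendsto_atTop)
  have hu0 : ¬ u =ᵐ[volume] 0 := fun h0 => by
    have h4 := hc u hu.lim
    rw [normSq_ae_zero m h0] at h4
    nlinarith
  have hcu : 0 < critSq m u := by linarith
  -- With `Q` the numerator at `u`, the chain `Q ≤ S ≤ S · critSq m u ≤ Q` forces equality.
  have hueq : normSq m u - lam * b u u = S * critSq m u := by
    refine le_antisymm (huS.trans ?_) (hSle u hu.lim)
    nlinarith
  refine ⟨⟨u, ⟨hu.lim, hu0⟩, fun v hv hv0 => ?_⟩,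
    exists_solution_of_minimizer hb hm hmn hK hS0 hSle hu.lim hu0 hueq⟩
  rw [hueq, mul_div_cancel_right₀ _ hcu.ne']
  exact csInf_le hTb ⟨v, ⟨hv, hv0⟩, rfl⟩

end Minimization

/-! ### Nontrivial elements of the space over a domain -/

section Domain

theorem exists_test_function {Ω : Set (E n)} {m : ℝ} (hΩ : IsOpen Ω) (hne : Ω.Nonempty)
    (hm : 0 < m) (hmn : m < (n : ℝ) / 2) (hb : Bornology.IsBounded Ω) :
    ∃ u, FiniteEnergy (closure Ω) m u ∧ ¬ u =ᵐ[volume] 0 := by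
  obtain ⟨x, hx⟩ := hne
  obtain ⟨f, hfs, hfc, hfd, -, hfx⟩ := exists_contDiff_tsupport_subset (n := (⊤ : ℕ∞))
    (hΩ.mem_nhds hx)
  have hmem : f ∈ HTilde Ω m := by
    -- A test function belongs to the completion through the constant sequence.
    refine ⟨⟨hfd.continuous.memLp_of_hasCompactSupport hfc, fun _ => f, fun _ => ⟨hfd, hfc⟩, ?_, ?_⟩,
      Eventually.of_forall fun y hy => ?_⟩
    · simp
    · simp [normSq_ae_zero m (Filter.EventuallyEq.refl (ae volume) (0 : E n → ℝ))]
    · by_contra h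
      exact hy (subset_closure (hfs (subset_tsupport f h)))
  refine ⟨f, (mem_HTilde_iff hm hmn hb).1 hmem, fun h => ?_⟩
  have h1 : f = 0 := (hfd.continuous.ae_eq_iff_eq volume continuous_const).1 h
  rw [h1] at hfx
  exact zero_ne_one hfx

theorem HTildeNZ_eq {Ω : Set (E n)} {m : ℝ} (hm : 0 < m) (hmn : m < (n : ℝ) / 2)
    (hb : Bornology.IsBounded Ω) :
    HTildeNZ Ω m = {u | FiniteEnergy (closure Ω) m u ∧ ¬ u =ᵐ[volume] 0} := by
  ext u
  simp only [HTildeNZ, mem_HTilde_iff hm hmn hb]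

end Domain

end FracCritical

/-! ### The theorem: the threshold result applied to both forms -/

theorem theorem2 (n : ℕ) (m s : ℝ) (hs : 0 ≤ s) (hsm : s < m) (hmn : m < (n : ℝ) / 2)
    (hcrit : s < 2 * m - (n : ℝ) / 2)
    (Ω : Set (EuclideanSpace ℝ (Fin n))) (hΩ : FracCritical.IsBoundedSmoothDomain Ω) :
    (∃ lamStar : ℝ, 0 ≤ lamStar ∧ lamStar < FracCritical.Lambda1 Ω m s ∧
      ∀ lam : ℝ, lamStar < lam → lam < FracCritical.Lambda1 Ω m s →
        IsLeast (FracCritical.quotR m s lam '' FracCritical.HTildeNZ Ω m)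
          (FracCritical.infS Ω m s lam) ∧
        ∃ u : EuclideanSpace ℝ (Fin n) → ℝ, FracCritical.IsNontrivialSol Ω m s lam u) ∧
    ((0 : EuclideanSpace ℝ (Fin n)) ∈ Ω →
      ∃ lamStar : ℝ, 0 ≤ lamStar ∧ lamStar < FracCritical.Lambda1Tilde Ω m s ∧
        ∀ lam : ℝ, lamStar < lam → lam < FracCritical.Lambda1Tilde Ω m s →
          IsLeast (FracCritical.quotRTilde m s lam '' FracCritical.HTildeNZ Ω m)
            (FracCritical.infSTilde Ω m s lam) ∧
          ∃ u : EuclideanSpace ℝ (Fin n) → ℝ,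
            FracCritical.IsNontrivialSolTilde Ω m s lam u) := by
  have hm : 0 < m := hs.trans_lt hsm
  have hK : Bornology.IsBounded (closure Ω) := hΩ.isBounded.closure
  have hne := FracCritical.exists_test_function hΩ.isOpen hΩ.isConnected.nonempty hm hmn
    hΩ.isBounded
  have hNZ := FracCritical.HTildeNZ_eq (Ω := Ω) hm hmn hΩ.isBounded
  have hiff := fun u => FracCritical.mem_HTilde_iff (Ω := Ω) (u := u) hm hmn hΩ.isBounded
  constructor
  · obtain ⟨lamStar, h0, h1, h2⟩ := (FracCritical.compactForm_energyForm hs hsm hmn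
      hK).exists_threshold hm hmn hK hne
    simp only [FracCritical.energyForm_self, ← hNZ] at h1 h2
    refine ⟨lamStar, h0, h1, fun lam hl hl' => ?_⟩
    obtain ⟨⟨u, hu, humin⟩, U, hU, hU0, hUeq⟩ := h2 lam hl hl'
    have hleast : IsLeast (FracCritical.quotR m s lam '' FracCritical.HTildeNZ Ω m)
        (FracCritical.quotR m s lam u) := by
      rw [hNZ]
      exact ⟨⟨u, hu, rfl⟩, by rintro _ ⟨v, hv, rfl⟩; exact humin v hv.1 hv.2⟩
    refine ⟨?_, U, ⟨(hiff U).2 hU, hU0⟩, fun v hv => hUeq v ((hiff v).1 hv)⟩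
    have e : FracCritical.infS Ω m s lam = FracCritical.quotR m s lam u := hleast.csInf_eq
    rw [e]
    exact hleast
  · intro _
    obtain ⟨lamStar, h0, h1, h2⟩ := (FracCritical.compactForm_hardyForm hs hsm hmn
      hK).exists_threshold hm hmn hK hne
    simp only [FracCritical.hardyForm_self, ← hNZ] at h1 h2
    refine ⟨lamStar, h0, h1, fun lam hl hl' => ?_⟩
    obtain ⟨⟨u, hu, humin⟩, U, hU, hU0, hUeq⟩ := h2 lam hl hl'
    have hleast : IsLeast (FracCritical.quotRTilde m s lam '' FracCritical.HTildeNZ Ω m)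
        (FracCritical.quotRTilde m s lam u) := by
      rw [hNZ]
      exact ⟨⟨u, hu, rfl⟩, by rintro _ ⟨v, hv, rfl⟩; exact humin v hv.1 hv.2⟩
    refine ⟨?_, U, ⟨(hiff U).2 hU, hU0⟩, fun v hv => hUeq v ((hiff v).1 hv)⟩
    have e : FracCritical.infSTilde Ω m s lam = FracCritical.quotRTilde m s lam u :=
      hleast.csInf_eq
    rw [e]
    exact hleast
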